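/- Let $\zeta_k=e^{2\pi i/k}$, let $\mathfrak f(\tau)=\zeta_{48}^{-1}\eta(\frac{\tau+1}2)/\eta(\tau)$, $\mathfrak f_1(\tau)=\eta(\frac{\tau}2)/\eta(\tau)$, $\mathfrak f_2(\tau)=\sqrt2\,\eta(2\tau)/\eta(\tau)$ be the Weber functions, and put $(\mathfrak u_0,\mathfrak u_1,\mathfrak u_2)=(\mathfrak f,\zeta_{16}\mathfrak f_1,\zeta_{16}^{-1}\mathfrak f_2)$. For $N\mid 24$ let $\Gamma_N\subseteq\mathrm{PSL}_2(\mathbb Z)$ be the subgroup of elements that fix each of the functions $\mathfrak u_0^{24/N},\mathfrak u_1^{24/N},\mathfrak u_2^{24/N}$. Let $K$ be a field with an embedding into $\mathbb C$ that contains $\sqrt2$ and a primitive $24$-th root of unity, and let $\mu_m\subset K^\times$ be the group of $m$-th roots of unity. The Weber curve $\mathcal W_N\subset\mathbb P^3_K$ is defined, for $N=3n$ with $n\mid 8$, by $$X_0^n+X_1^n+X_2^n=0,\qquad X_0X_1X_2=\sqrt2^{\,8/n}X_3^3,$$ and, for $N=n$ with $n\mid 8$, by $$X_0^n+X_1^n+X_2^n=48X_3^n,\qquad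 X_0X_1X_2=\sqrt8^{\,8/n}X_3^3.$$ For $mn\mid 24$ let $\pi:\mathcal W_{mn}\to\mathcal W_n$ be the morphism $(X_0:X_1:X_2:X_3)\mapsto(X_0^m:X_1^m:X_2^m:X_3^m)$. The group $\mu_m^3$ acts on $\mathbb P^3$ by $(h_0,h_1,h_2)\cdot(X_0:X_1:X_2:X_3)=(h_0X_0:h_1X_1:h_2X_2:X_3)$. **Proposition.** Let $mn\mid 24$. The curves $\mathcal W_{mn}$ and $\mathcal W_n$ are integral, $\pi$ maps $\mathcal W_{mn}(K)$ into $\mathcal W_n(K)$ (onto it if $K$ is algebraically closed) and is dominant, and there is a subgroup $H\subseteq\mu_m^3$, acting on $\mathcal W_{mn}$ by automorphisms over $\mathcal W_n$, such that $\pi$ is the quotient by $H$ in the sense of covers of curves: the extension of function fields $K(\mathcal W_{mn})/\pi^*K(\mathcal W_n)$ is Galois, its automorphism group is $H$ (acting by $X_i/X_3\mapsto h_iX_i/X_3$), and $\pi^*K(\mathcal W_n)=K(\mathcal W_{mn})^H$. Moreover any two $K$-rational points of $\mathcal W_{mn}$ with the same image, a nonsingular point of $\mathcal W_n$, lie in one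 $H$-orbit. Furthermore $\Gamma_{mn}\subseteq\Gamma_n$, $\Gamma_{mn}$ is normal in $\Gamma_n$, and there is an isomorphism $\Gamma_n/\Gamma_{mn}\cong H$, $\gamma\mapsto h$, given by $\mathfrak u_i^{24/(mn)}\circ\gamma=h_i\,\mathfrak u_i^{24/(mn)}$ for $i=0,1,2$. * If $m=3$, then $H=\Delta(\mu_3)=\{(a,a,a):a\in\mu_3\}$. * If $m\mid 8$, then $H=\nabla(\mu_m^2)=\{(a,b,(ab)^{-1}):a,b\in\mu_m\}$. Hence $\pi$ has degree $[K(\mathcal W_{mn}):\pi^*K(\mathcal W_n)]=3$ if $m=3$, and $m^2$ if $m\mid 8$. -/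

import Mathlib

open MvPolynomial
open scoped UpperHalfPlane MatrixGroups LinearAlgebra.Projectivization

namespace Weber

noncomputable section

/-! ### Weber functions and the groups `Γ_N` -/

/-- The standard primitive `k`-th root of unity `exp (2πi / k)`. -/
def zeta (k : ℕ) : ℂ := Complex.exp (2 * Real.pi * Complex.I / k)

/-- The classical Weber function `𝔣`. -/
def weberF (τ : ℍ) : ℂ :=
  (zeta 48)⁻¹ * ModularForm.eta (((τ : ℂ) + 1) / 2) / ModularForm.eta (τ : ℂ)

/-- The classical Weber function `𝔣₁`. -/
def weberF₁ (τ : ℍ) : ℂ :=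
  ModularForm.eta ((τ : ℂ) / 2) / ModularForm.eta (τ : ℂ)

/-- The classical Weber function `𝔣₂`. -/
def weberF₂ (τ : ℍ) : ℂ :=
  (Real.sqrt 2 : ℂ) * ModularForm.eta (2 * (τ : ℂ)) / ModularForm.eta (τ : ℂ)

/-- The normalized Weber functions `(𝔲₀, 𝔲₁, 𝔲₂) = (𝔣, ζ₁₆ 𝔣₁, ζ₁₆⁻¹ 𝔣₂)`. -/
def weberU : Fin 3 → ℍ → ℂ :=
  ![weberF, fun τ => zeta 16 * weberF₁ τ, fun τ => (zeta 16)⁻¹ * weberF₂ τ]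

/-- The matrices in `SL₂(ℤ)` acting trivially, through Möbius transformations, on the triple
of functions `(𝔲₀^(24/N), 𝔲₁^(24/N), 𝔲₂^(24/N))`. -/
def weberKernelSL (N : ℕ) : Subgroup SL(2, ℤ) where
  carrier := {γ | ∀ (i : Fin 3) (τ : ℍ), weberU i (γ • τ) ^ (24 / N) = weberU i τ ^ (24 / N)}
  one_mem' := by intro i τ; simp
  mul_mem' := by
    intro a b ha hb i τ
    rw [mul_smul, ha i, hb i]
  inv_mem' := by
    intro a ha i τ
    have h := ha i (a⁻¹ • τ)
    rw [smul_inv_smul] at h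
    exact h.symm

/-- `Γ_N`: the kernel of the action of `PSL₂(ℤ)` on the triple of functions
`(𝔲₀^(24/N), 𝔲₁^(24/N), 𝔲₂^(24/N))`. -/
def weberGamma (N : ℕ) : Subgroup (Matrix.ProjectiveSpecialLinearGroup (Fin 2) ℤ) :=
  (weberKernelSL N).map (QuotientGroup.mk' (Subgroup.center SL(2, ℤ)))

/-! ### Weber curves

Throughout, `r` is a square root of `2` in the base field `K`. -/

section Curves

variable {K : Type*} [Field K]

/-- The first form defining the Weber curve `W_N` in `ℙ³`, for `N ∣ 24`: with `n = N / 3` it is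
`X₀ⁿ + X₁ⁿ + X₂ⁿ` if `3 ∣ N`, and it is `X₀ᴺ + X₁ᴺ + X₂ᴺ - 48 X₃ᴺ` otherwise. -/
def weberForm₁ (K : Type*) [Field K] (N : ℕ) : MvPolynomial (Fin 4) K :=
  if 3 ∣ N then X 0 ^ (N / 3) + X 1 ^ (N / 3) + X 2 ^ (N / 3)
  else X 0 ^ N + X 1 ^ N + X 2 ^ N - C 48 * X 3 ^ N

/-- The constant `X₀X₁X₂ / X₃³` on the Weber curve `W_N`, for `N ∣ 24`:
`√2 ^ m` with `m * (N / 3) = 8` if `3 ∣ N`, and `√8 ^ m` with `m * N = 8` otherwise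
(here `√8 = 2√2`). -/
def weberConst (r : K) (N : ℕ) : K :=
  if 3 ∣ N then r ^ (8 / (N / 3)) else (2 * r) ^ (8 / N)

/-- The second form defining the Weber curve `W_N` in `ℙ³`. -/
def weberForm₂ (r : K) (N : ℕ) : MvPolynomial (Fin 4) K :=
  X 0 * X 1 * X 2 - C (weberConst r N) * X 3 ^ 3

/-- The (`K`-rational points of the) Weber curve `W_N` in `ℙ³`. -/
def weberCurve (r : K) (N : ℕ) : Set (ℙ K (Fin 4 → K)) :=
  {P | eval P.rep (weberForm₁ K N) = 0 ∧ eval P.rep (weberForm₂ r N) = 0}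

/-- Jacobian criterion: the gradients of the two forms defining `W_N` are linearly independent
at `P`. -/
def IsNonsingularAt (r : K) (N : ℕ) (P : ℙ K (Fin 4 → K)) : Prop :=
  LinearIndependent K
    ![fun j => eval P.rep (pderiv j (weberForm₁ K N)),
      fun j => eval P.rep (pderiv j (weberForm₂ r N))]

/-- The map `(X₀ : X₁ : X₂ : X₃) ↦ (X₀ᵐ : X₁ᵐ : X₂ᵐ : X₃ᵐ)`; it induces the covers
`W_{mn} → W_n`. -/
def powMap (m : ℕ) : ℙ K (Fin 4 → K) → ℙ K (Fin 4 → K) :=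
  Projectivization.lift
    (fun v => Projectivization.mk K (fun j => v.1 j ^ m) (by
      intro h
      apply v.2
      funext j
      exact eq_zero_of_pow_eq_zero (congrFun h j)))
    (by
      intro a b t hab
      rw [Projectivization.mk_eq_mk_iff']
      refine ⟨t ^ m, ?_⟩
      funext j
      simp [hab, mul_pow])

/-- The diagonal automorphism `(X₀ : X₁ : X₂ : X₃) ↦ (h₀X₀ : h₁X₁ : h₂X₂ : X₃)` of `ℙ³`. -/
def scaleMap (h : Fin 3 → Kˣ) : ℙ K (Fin 4 → K) → ℙ K (Fin 4 → K) :=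
  Projectivization.map
    (LinearEquiv.piCongrRight fun j : Fin 4 =>
      LinearEquiv.smulOfUnit (M := K) ((![h 0, h 1, h 2, 1] : Fin 4 → Kˣ) j)).toLinearMap
    (LinearEquiv.injective _)

/-- Restriction of forms to the affine chart `X₃ = 1` of `ℙ³`. -/
def dehomogenize : MvPolynomial (Fin 4) K →ₐ[K] MvPolynomial (Fin 3) K :=
  aeval ![X 0, X 1, X 2, 1]

/-- The ideal of the affine Weber curve `W_N ∩ {X₃ ≠ 0}` in `𝔸³`. -/
def weberIdeal (r : K) (N : ℕ) : Ideal (MvPolynomial (Fin 3) K) :=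
  Ideal.span {dehomogenize (weberForm₁ K N), dehomogenize (weberForm₂ r N)}

/-- The coordinate ring of the affine Weber curve `W_N ∩ {X₃ ≠ 0}`. As `W_N` has only finitely many
points with `X₃ = 0`, its fraction field (when it is a domain) is the function field of `W_N`. -/
abbrev WeberRing (r : K) (N : ℕ) : Type _ := MvPolynomial (Fin 3) K ⧸ weberIdeal r N

/-- The coordinate function `x_i = X_i / X₃` on the affine Weber curve. -/
def coord (r : K) (N : ℕ) (i : Fin 3) : WeberRing r N := Ideal.Quotient.mk _ (X i)

lemma coord_rel₁ (r : K) (N : ℕ) :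
    if 3 ∣ N then
      coord r N 0 ^ (N / 3) + coord r N 1 ^ (N / 3) + coord r N 2 ^ (N / 3) = 0
    else coord r N 0 ^ N + coord r N 1 ^ N + coord r N 2 ^ N = 48 := by
  have h : Ideal.Quotient.mk (weberIdeal r N) (dehomogenize (weberForm₁ K N)) = 0 :=
    Ideal.Quotient.eq_zero_iff_mem.2 (Ideal.subset_span (by simp))
  split_ifs with h3
  · simpa [weberForm₁, dehomogenize, h3, coord] using h
  · have e : (algebraMap K (WeberRing r N)) 48 = 48 := map_ofNat _ 48
    have e' : Ideal.Quotient.mk (weberIdeal r N) (C 48) = 48 := e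
    simpa [weberForm₁, dehomogenize, h3, coord, sub_eq_zero, e', e] using h

lemma coord_rel₂ (r : K) (N : ℕ) :
    coord r N 0 * coord r N 1 * coord r N 2 = algebraMap K _ (weberConst r N) := by
  have h : Ideal.Quotient.mk (weberIdeal r N) (dehomogenize (weberForm₂ r N)) = 0 :=
    Ideal.Quotient.eq_zero_iff_mem.2 (Ideal.subset_span (by simp))
  rw [← sub_eq_zero]
  simpa [weberForm₂, dehomogenize, coord] using! h

lemma weberConst_pow {r : K} (hr : r ^ 2 = 2) {m n : ℕ} (h : m * n ∣ 24) :
    weberConst r (m * n) ^ m = weberConst r n := by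
  have hm : m ∣ 24 := (Dvd.intro _ rfl).trans h
  have hn : n ∣ 24 := (Dvd.intro_left _ rfl).trans h
  have hm' : m ∈ Nat.divisors 24 := by simp [hm]
  have hn' : n ∈ Nat.divisors 24 := by simp [hn]
  rw [show Nat.divisors 24 = {1, 2, 3, 4, 6, 8, 12, 24} by decide] at hm' hn'
  have h3 : (2 : K) * r = r ^ 3 := by rw [← hr]; ring
  simp only [Finset.mem_insert, Finset.mem_singleton] at hm' hn'
  unfold weberConst
  rw [h3]
  rcases hm' with rfl | rfl | rfl | rfl | rfl | rfl | rfl | rfl <;>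
  rcases hn' with rfl | rfl | rfl | rfl | rfl | rfl | rfl | rfl <;>
  first
  | (exfalso; revert h; decide)
  | (norm_num; try ring)

lemma coord_pow_rel {r : K} (hr : r ^ 2 = 2) {m n : ℕ} (h : m * n ∣ 24) :
    if 3 ∣ n then
      (coord r (m * n) 0 ^ m) ^ (n / 3) + (coord r (m * n) 1 ^ m) ^ (n / 3)
        + (coord r (m * n) 2 ^ m) ^ (n / 3) = 0
    else (coord r (m * n) 0 ^ m) ^ n + (coord r (m * n) 1 ^ m) ^ n
        + (coord r (m * n) 2 ^ m) ^ n = 48 := by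
  have h1 := coord_rel₁ r (m * n)
  have h2 := coord_rel₂ r (m * n)
  split_ifs with h3
  · rw [if_pos (h3.mul_left m), Nat.mul_div_assoc m h3] at h1
    simpa only [← pow_mul] using h1
  · by_cases hm : 3 ∣ m
    · obtain ⟨k, rfl⟩ := hm
      rw [if_pos ⟨k * n, by ring⟩, show 3 * k * n / 3 = k * n by
        rw [mul_assoc]; exact Nat.mul_div_cancel_left _ (by norm_num)] at h1
      have hc : weberConst r (3 * k * n) ^ (k * n) = 16 := by
        have h4 : 3 ∣ 3 * k * n := ⟨k * n, by ring⟩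
        have h5 : 3 * k * n / 3 = k * n := by
          rw [mul_assoc]; exact Nat.mul_div_cancel_left _ (by norm_num)
        have h6 : k * n ∣ 8 := by
          rw [mul_assoc] at h
          exact Nat.dvd_of_mul_dvd_mul_left (by norm_num : 0 < 3) (by simpa using h)
        rw [weberConst, if_pos h4, h5, ← pow_mul, Nat.div_mul_cancel h6]
        calc r ^ 8 = (r ^ 2) ^ 4 := by ring
          _ = 16 := by rw [hr]; norm_num
      have h7 := congrArg (fun t => t ^ (k * n)) h2
      simp only [mul_pow, ← map_pow] at h7
      rw [hc, map_ofNat] at h7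
      have e : ∀ x : WeberRing r (3 * k * n), (x ^ (3 * k)) ^ n = (x ^ (k * n)) ^ 3 := by
        intro x; ring
      rw [e, e, e]
      generalize coord r (3 * k * n) 0 ^ (k * n) = a at *
      generalize coord r (3 * k * n) 1 ^ (k * n) = b at *
      generalize coord r (3 * k * n) 2 ^ (k * n) = c at *
      linear_combination (a ^ 2 + b ^ 2 + c ^ 2 - a * b - b * c - c * a) * h1 + 3 * h7
    · have : ¬ 3 ∣ m * n := by
        rw [Nat.Prime.dvd_mul Nat.prime_three]; tauto
      rw [if_neg this] at h1
      simpa only [← pow_mul] using h1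

/-- Pullback of functions along the cover `W_{mn} → W_n`: `x_i ↦ x_iᵐ`. -/
def pullback {r : K} (hr : r ^ 2 = 2) {m n : ℕ} (h : m * n ∣ 24) :
    WeberRing r n →ₐ[K] WeberRing r (m * n) :=
  Ideal.Quotient.liftₐ (weberIdeal r n) (aeval fun i => coord r (m * n) i ^ m) (by
    intro a ha
    have hle : weberIdeal r n ≤
        RingHom.ker (aeval (R := K) fun i => coord r (m * n) i ^ m) := by
      rw [weberIdeal, Ideal.span_le]
      rintro x (rfl | rfl)
      · have := coord_pow_rel hr h
        rw [SetLike.mem_coe, RingHom.mem_ker]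
        split_ifs at this with h3
        · simpa [weberForm₁, dehomogenize, h3] using this
        · have e : (algebraMap K (WeberRing r (m * n))) 48 = 48 := map_ofNat _ 48
          simpa [weberForm₁, dehomogenize, h3, sub_eq_zero, e] using this
      · have := coord_rel₂ r (m * n)
        rw [SetLike.mem_coe, RingHom.mem_ker]
        simp only [weberForm₂, dehomogenize, map_sub, map_mul, map_pow, aeval_X, algHom_C,
          Matrix.cons_val, one_pow, mul_one, ← mul_pow, this]
        simp only [algebraMap_eq, algHom_C]
        rw [← weberConst_pow hr h, map_pow, sub_self]
    exact hle ha)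

/-- The function field of the Weber curve `W_N`. -/
abbrev WeberField (r : K) (N : ℕ) : Type _ := FractionRing (WeberRing r N)

/-- The coordinate function `X_i / X₃` in the function field of `W_N`. -/
def coordFun (r : K) (N : ℕ) (i : Fin 3) : WeberField r N :=
  algebraMap (WeberRing r N) (WeberField r N) (coord r N i)

/-- The function field of `W_n`, as a subfield of the function field of `W_{mn}` through pullback
along the cover `W_{mn} → W_n`. -/
def pullbackField {r : K} (hr : r ^ 2 = 2) {m n : ℕ} (h : m * n ∣ 24)
    [IsDomain (WeberRing r n)] [IsDomain (WeberRing r (m * n))]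
    (hinj : Function.Injective (pullback hr h).toRingHom) : Subfield (WeberField r (m * n)) :=
  (IsFractionRing.map (K := WeberField r n) (L := WeberField r (m * n)) hinj).fieldRange

/-- The action on `ℙ³` of an element of `μ_m³`. -/
abbrev rootAct {m : ℕ} (h : Fin 3 → rootsOfUnity m K) : ℙ K (Fin 4 → K) → ℙ K (Fin 4 → K) :=
  scaleMap fun i => (h i : Kˣ)

end Curves

/-! ### Subgroups of `μ_m³` -/

/-- The antidiagonal group `∇(μ_m²) = {(a, b, (ab)⁻¹)}` in `μ_m³`. -/
def antidiagonalGroup (m : ℕ) (K : Type*) [Field K] : Subgroup (Fin 3 → rootsOfUnity m K) where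
  carrier := {h | ∃ a b : rootsOfUnity m K, h = ![a, b, (a * b)⁻¹]}
  one_mem' := ⟨1, 1, by funext i; fin_cases i <;> simp⟩
  mul_mem' := by
    rintro _ _ ⟨a, b, rfl⟩ ⟨c, d, rfl⟩
    refine ⟨a * c, b * d, ?_⟩
    funext i
    fin_cases i
    · rfl
    · rfl
    · simp [mul_comm, mul_left_comm, mul_assoc]
  inv_mem' := by
    rintro _ ⟨a, b, rfl⟩
    refine ⟨a⁻¹, b⁻¹, ?_⟩
    funext i
    fin_cases i
    · rfl
    · rfl
    · simp [mul_comm]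

/-- The diagonal group `Δ(μ_m) = {(a, a, a)}` in `μ_m³`. -/
def diagonalGroup (m : ℕ) (K : Type*) [Field K] : Subgroup (Fin 3 → rootsOfUnity m K) where
  carrier := {h | ∃ a : rootsOfUnity m K, h = fun _ => a}
  one_mem' := ⟨1, rfl⟩
  mul_mem' := by
    rintro _ _ ⟨a, rfl⟩ ⟨b, rfl⟩
    exact ⟨a * b, rfl⟩
  inv_mem' := by
    rintro _ ⟨a, rfl⟩
    exact ⟨a⁻¹, rfl⟩

end

end Weber

namespace Weber

/-! ### Roots of unity `zeta k` -/

/-! Write `k` for `coverExp m`, so `m = 3k` if `3 ∣ m` and `k = m` otherwise. One group serves all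
the assertions: `coverGroup m K`, the triples in `μ_m³` with product `1` whose `k`-th powers
coincide. It has at least `mk` elements, and is `Δ(μ₃)` for `m = 3` and `∇(μ_m²)` for `m ∣ 8`.

Modular side: `S` and `T` permute the `𝔲_i` up to 24th roots of unity `c_i` with product `1` and
equal eighth powers (`exists_weberU_smul`). The functions `𝔲_i²⁴` are distinct
(`weberU_pow_injective`), so elements of `Γ_n` do not permute, and the powers `c_i ^ e` with `e =
24/(mn)` form a triple in the group. Conversely `T²` and `S T² S` act diagonally and realize every
such triple. The result is a surjection from `Γ_n` with kernel `Γ_{mn}` (`exists_weberGamma_hom`).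

Integrality: `W₂₄` is birational to a plane curve that is irreducible by Eisenstein's criterion
(`weberRing_isDomain`). The other coordinate rings embed into that of `W₂₄`
(`injective_to_weberRing_24`). For `W₁` and `W₃` this uses a normal form `P(x₀) + Q(x₀)x₁` and the
symmetry exchanging `x₁` and `x₂`; the remaining cases follow by independence of characters of
`μ₈²`.

Galois theory: over `F = π^*K(W_n)` the field `K(W_{mn})` is generated by `x₀` and `x₁/x₀`. The
powers `x₀ᵐ` and `(x₁/x₀)ᵏ` lie in `F`, so the degree is at most `mk`; a group of at least `mk`
elements acts faithfully, so equality holds throughout (`isGalois_and_exists_mulEquiv`).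

Rational points: two points with the same image differ by roots of unity. If the group does not
contain their quotient, then `3 ∣ m` and the image satisfies `X₀ⁿ = X₁ⁿ = X₂ⁿ`, which makes it
singular (`exists_rootAct_eq`). -/

lemma zeta_mul_pow (a b : ℕ) (hb : b ≠ 0) : zeta (a * b) ^ b = zeta a := by
  rw [zeta, zeta, ← Complex.exp_nat_mul]
  congr 1
  have : (b : ℂ) ≠ 0 := by exact_mod_cast hb
  by_cases ha : a = 0
  · simp [ha]
  have : (a : ℂ) ≠ 0 := by exact_mod_cast ha
  push_cast
  field_simp

lemma zeta_ne_zero (k : ℕ) : zeta k ≠ 0 := Complex.exp_ne_zero _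

lemma zeta_isPrimitiveRoot {k : ℕ} (hk : k ≠ 0) : IsPrimitiveRoot (zeta k) k :=
  Complex.isPrimitiveRoot_exp k hk

/-! ### The Euler product and the Dedekind eta function -/

/-- The Euler product `∏ (1 - q ^ n)`. -/
noncomputable def eulerProd (q : ℂ) : ℂ := ∏' n : ℕ, (1 - q ^ (n + 1))

lemma multipliable_odd_one_sub_pow {q : ℂ} (hq : ‖q‖ < 1) :
    Multipliable fun n : ℕ => 1 - q ^ (2 * n + 1) := by
  apply multipliable_one_add_of_summable (f := fun n ↦ -q ^ (2 * n + 1))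
  have h := summable_geometric_of_lt_one (norm_nonneg _) hq
  simpa [Function.comp_def] using
    h.comp_injective (i := fun n : ℕ => 2 * n + 1) (fun a b h => by simpa using h)

lemma norm_pow_lt_one {q : ℂ} (hq : ‖q‖ < 1) {k : ℕ} (hk : k ≠ 0) : ‖q ^ k‖ < 1 := by
  rw [norm_pow]
  exact pow_lt_one₀ (norm_nonneg _) hq hk

lemma eulerProd_eq_odd_mul {q : ℂ} (hq : ‖q‖ < 1) :
    eulerProd q = (∏' n : ℕ, (1 - q ^ (2 * n + 1))) * eulerProd (q ^ 2) := by
  have he : (fun k : ℕ => 1 - q ^ (2 * k + 1 + 1)) = fun k : ℕ => 1 - (q ^ 2) ^ (k + 1) := by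
    funext k; ring
  have := tprod_even_mul_odd (f := fun n : ℕ => 1 - q ^ (n + 1))
    (multipliable_odd_one_sub_pow hq)
    (by rw [he]; exact ModularForm.multipliable_one_sub_pow (norm_pow_lt_one hq two_ne_zero))
  rw [he] at this
  exact this.symm

/-- With `O(q)` the product over odd exponents, the Euler product satisfies `E(q) = O(q)E(q²)`, and
`O(p)O(-p) = O(p²)` factor by factor. This is the product identity behind `𝔣𝔣₁𝔣₂ = √2`. -/
lemma eulerProd_identity {p : ℂ} (hp : ‖p‖ < 1) :
    eulerProd p * eulerProd (-p) * eulerProd (p ^ 4) = eulerProd (p ^ 2) ^ 3 := by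
  have hp2 := norm_pow_lt_one hp two_ne_zero
  have hn : ‖-p‖ < 1 := by simpa using hp
  have h1 := eulerProd_eq_odd_mul hp
  have h2 := eulerProd_eq_odd_mul hn
  have h3 := eulerProd_eq_odd_mul hp2
  have h4 : (∏' n : ℕ, (1 - p ^ (2 * n + 1))) * (∏' n : ℕ, (1 - (-p) ^ (2 * n + 1))) =
      ∏' n : ℕ, (1 - (p ^ 2) ^ (2 * n + 1)) := by
    rw [← (multipliable_odd_one_sub_pow hp).tprod_mul (multipliable_odd_one_sub_pow hn)]
    congr 1
    funext n
    rw [Odd.neg_pow ⟨n, rfl⟩]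
    ring
  rw [neg_sq] at h2
  rw [← pow_mul, show 2 * 2 = 4 from rfl] at h3
  rw [← h4] at h3
  rw [h1, h2]
  calc _ = eulerProd (p ^ 2) ^ 2 * (((∏' n : ℕ, (1 - p ^ (2 * n + 1))) *
      (∏' n : ℕ, (1 - (-p) ^ (2 * n + 1)))) * eulerProd (p ^ 4)) := by ring
    _ = _ := by rw [← h3]; ring

lemma eta_eq_eulerProd (z : ℂ) : ModularForm.eta z =
    Complex.exp (2 * Real.pi * Complex.I * z / 24) *
      eulerProd (Complex.exp (2 * Real.pi * Complex.I * z)) := by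
  simp [ModularForm.eta, eulerProd, ModularForm.eta_q, Function.Periodic.qParam]

lemma eta_add_one (z : ℂ) : ModularForm.eta (z + 1) = zeta 24 * ModularForm.eta z := by
  rw [eta_eq_eulerProd, eta_eq_eulerProd, zeta, ← mul_assoc, ← Complex.exp_add]
  congr 2
  · push_cast; ring
  · rw [mul_add, mul_one, Complex.exp_add, Complex.exp_two_pi_mul_I, mul_one]

lemma eta_neg_inv {z : ℂ} (hz : 0 < z.im) : ModularForm.eta (-z⁻¹) =
    (Complex.sqrt Complex.I)⁻¹ * Complex.sqrt z * ModularForm.eta z := by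
  have := ModularForm.eta_comp_eq_csqrt_I_inv (x := z) hz
  simpa [neg_div, mul_assoc] using this

/-- The principal square root is not multiplicative in general, but a positive real factor leaves
the argument unchanged, so no branch jump occurs. -/
lemma sqrt_ofReal_mul {r : ℝ} (hr : 0 < r) {z : ℂ} (hz : z ≠ 0) :
    Complex.sqrt (r * z) = (Real.sqrt r : ℂ) * Complex.sqrt z := by
  have hr' : (r : ℂ) ≠ 0 := by exact_mod_cast hr.ne'
  rw [sqrt_eq_exp hz, sqrt_eq_exp (mul_ne_zero hr' hz),
    Complex.log_ofReal_mul hr hz, add_div, Complex.exp_add]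
  congr 1
  rw [Real.sqrt_eq_rpow, Real.rpow_def_of_pos hr]
  push_cast
  ring_nf

lemma eta_ofReal_mul_I {y : ℝ} (hy : 0 < y) :
    ∃ R : ℝ, R ≠ 0 ∧ ModularForm.eta (y * Complex.I) = R := by
  have e : Complex.exp (2 * Real.pi * Complex.I * (y * Complex.I)) =
      ((Real.exp (-2 * Real.pi * y) : ℝ) : ℂ) := by
    push_cast
    congr 1
    linear_combination (2 * Real.pi * y : ℂ) * Complex.I_mul_I
  have e' : Complex.exp (2 * Real.pi * Complex.I * (y * Complex.I) / 24) =
      ((Real.exp (-2 * Real.pi * y / 24) : ℝ) : ℂ) := by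
    push_cast
    congr 1
    linear_combination (2 * Real.pi * y / 24 : ℂ) * Complex.I_mul_I
  have hq : ‖(Real.exp (-2 * Real.pi * y) : ℝ)‖ < 1 := by
    rw [Real.norm_of_nonneg (Real.exp_pos _).le, Real.exp_lt_one_iff]
    nlinarith [Real.pi_pos, mul_pos Real.pi_pos hy]
  have hm : Multipliable fun n : ℕ ↦ 1 - (Real.exp (-2 * Real.pi * y) : ℝ) ^ (n + 1) := by
    apply multipliable_one_add_of_summable (f := fun n ↦ -(Real.exp (-2 * Real.pi * y)) ^ (n + 1))
    simpa using (summable_nat_add_iff 1).mpr (summable_geometric_of_lt_one (norm_nonneg _) hq)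
  have hp : eulerProd ((Real.exp (-2 * Real.pi * y) : ℝ) : ℂ) =
      ((∏' n : ℕ, (1 - (Real.exp (-2 * Real.pi * y) : ℝ) ^ (n + 1)) : ℝ) : ℂ) := by
    have := hm.map_tprod Complex.ofRealHom Complex.continuous_ofReal
    simpa [eulerProd] using this.symm
  have key : ModularForm.eta (y * Complex.I) = ((Real.exp (-2 * Real.pi * y / 24) *
      ∏' n : ℕ, (1 - (Real.exp (-2 * Real.pi * y) : ℝ) ^ (n + 1)) : ℝ) : ℂ) := by
    rw [eta_eq_eulerProd, e, e', hp, Complex.ofReal_mul]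
  refine ⟨_, ?_, key⟩
  intro h
  rw [h] at key
  exact ModularForm.eta_ne_zero (z := y * Complex.I) (by simpa using hy) (by simpa using key)

/-! ### The Weber functions -/

lemma eta_coe_ne_zero (τ : ℍ) : ModularForm.eta (τ : ℂ) ≠ 0 := ModularForm.eta_ne_zero τ.2

lemma weberF_mul (τ : ℍ) : weberF τ * weberF₁ τ * weberF₂ τ = (Real.sqrt 2 : ℂ) := by
  have h48 := zeta_ne_zero 48
  have h0 := eta_coe_ne_zero τ
  suffices h : ModularForm.eta (((τ : ℂ) + 1) / 2) * ModularForm.eta ((τ : ℂ) / 2) *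
      ModularForm.eta (2 * (τ : ℂ)) = zeta 48 * ModularForm.eta (τ : ℂ) ^ 3 by
    rw [weberF, weberF₁, weberF₂]
    rw [show (zeta 48)⁻¹ * ModularForm.eta (((τ : ℂ) + 1) / 2) / ModularForm.eta ↑τ *
      (ModularForm.eta (↑τ / 2) / ModularForm.eta ↑τ) *
      (↑√2 * ModularForm.eta (2 * ↑τ) / ModularForm.eta ↑τ) = ↑√2 *
      (ModularForm.eta (((τ : ℂ) + 1) / 2) * ModularForm.eta ((τ : ℂ) / 2) *
      ModularForm.eta (2 * (τ : ℂ))) / (zeta 48 * ModularForm.eta ↑τ ^ 3) by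
        field_simp, h]
    field_simp
  -- With `p = exp(πiτ)`, the values of `exp(2πiz)` at `z = (τ+1)/2, τ/2, τ, 2τ` are `-p, p, p²,
  -- p⁴`.
  set p := Complex.exp (2 * Real.pi * Complex.I * ((τ : ℂ) / 2)) with hp
  have hp1 : ‖p‖ < 1 := by
    rw [hp, Complex.norm_exp, Real.exp_lt_one_iff]
    have : (2 * Real.pi * Complex.I * ((τ : ℂ) / 2)).re = -(Real.pi * τ.im) := by
      simp [Complex.mul_re, Complex.mul_im]
      ring
    rw [this]
    have := mul_pos Real.pi_pos τ.im_pos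
    linarith
  have e1 : Complex.exp (2 * Real.pi * Complex.I * (((τ : ℂ) + 1) / 2)) = -p := by
    rw [hp, show 2 * Real.pi * Complex.I * (((τ : ℂ) + 1) / 2) =
      2 * Real.pi * Complex.I * ((τ : ℂ) / 2) + Real.pi * Complex.I by ring, Complex.exp_add,
      Complex.exp_pi_mul_I]
    ring
  have e2 : Complex.exp (2 * Real.pi * Complex.I * (2 * (τ : ℂ))) = p ^ 4 := by
    rw [hp, ← Complex.exp_nat_mul]; congr 1; push_cast; ring
  have e3 : Complex.exp (2 * Real.pi * Complex.I * (τ : ℂ)) = p ^ 2 := by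
    rw [hp, ← Complex.exp_nat_mul]; congr 1; push_cast; ring
  simp only [eta_eq_eulerProd]
  rw [e1, e2, e3, ← hp, zeta]
  have hid := eulerProd_identity hp1
  have : Complex.exp (2 * Real.pi * Complex.I * (((τ : ℂ) + 1) / 2) / 24) *
      Complex.exp (2 * Real.pi * Complex.I * ((τ : ℂ) / 2) / 24) *
      Complex.exp (2 * Real.pi * Complex.I * (2 * (τ : ℂ)) / 24) =
      Complex.exp (2 * Real.pi * Complex.I / (48 : ℕ)) *
        Complex.exp (2 * Real.pi * Complex.I * (τ : ℂ) / 24) ^ 3 := by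
    rw [← Complex.exp_nat_mul, ← Complex.exp_add, ← Complex.exp_add, ← Complex.exp_add]
    congr 1
    push_cast
    ring
  rw [mul_pow, ← hid]
  linear_combination (eulerProd p * eulerProd (-p) * eulerProd (p ^ 4)) * this

lemma weberU_mul (τ : ℍ) : weberU 0 τ * weberU 1 τ * weberU 2 τ = (Real.sqrt 2 : ℂ) := by
  have h := zeta_ne_zero 16
  rw [← weberF_mul τ]
  simp only [weberU, Matrix.cons_val]
  field_simp

lemma weberU_ne_zero (i : Fin 3) (τ : ℍ) : weberU i τ ≠ 0 := by
  have h := weberU_mul τ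
  have h2 : (Real.sqrt 2 : ℂ) ≠ 0 := by norm_num
  intro h0
  apply h2
  rw [← h]
  fin_cases i <;> simp_all

lemma coe_T_smul (τ : ℍ) : ((ModularGroup.T • τ : ℍ) : ℂ) = τ + 1 := by
  rw [UpperHalfPlane.modular_T_smul, UpperHalfPlane.coe_vadd]
  push_cast
  ring

lemma coe_S_smul (τ : ℍ) : ((ModularGroup.S • τ : ℍ) : ℂ) = -(τ : ℂ)⁻¹ := by
  rw [UpperHalfPlane.modular_S_smul]
  simp [inv_neg]

lemma zeta_48_pow_three : zeta 48 ^ 3 = zeta 16 := zeta_mul_pow 16 3 (by norm_num)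

lemma zeta_48_pow_two : zeta 48 ^ 2 = zeta 24 := zeta_mul_pow 24 2 (by norm_num)

lemma weberU_T (τ : ℍ) :
    weberU 0 (ModularGroup.T • τ) = (zeta 24 ^ 2)⁻¹ * weberU 1 τ ∧
    weberU 1 (ModularGroup.T • τ) = zeta 24 * weberU 0 τ ∧
    weberU 2 (ModularGroup.T • τ) = zeta 24 * weberU 2 τ := by
  have h48 := zeta_ne_zero 48
  have h0 := eta_coe_ne_zero τ
  have h1 := eta_add_one τ
  have h2 : ModularForm.eta (((τ : ℂ) + 1 + 1) / 2) = zeta 24 * ModularForm.eta ((τ : ℂ) / 2) := by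
    rw [← eta_add_one]; congr 1; ring
  have h3 : ModularForm.eta (2 * ((τ : ℂ) + 1)) =
      zeta 24 * (zeta 24 * ModularForm.eta (2 * (τ : ℂ))) := by
    rw [← eta_add_one, ← eta_add_one]; congr 1; ring
  simp only [weberU, weberF, weberF₁, weberF₂, Matrix.cons_val, coe_T_smul]
  rw [h1, h2, h3, ← zeta_48_pow_three, ← zeta_48_pow_two]
  refine ⟨?_, ?_, ?_⟩ <;> field_simp

lemma weberU_S (τ : ℍ) :
    weberU 0 (ModularGroup.S • τ) = weberU 0 τ ∧
    weberU 1 (ModularGroup.S • τ) = zeta 24 ^ 3 * weberU 2 τ ∧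
    weberU 2 (ModularGroup.S • τ) = (zeta 24 ^ 3)⁻¹ * weberU 1 τ := by
  have h48 := zeta_ne_zero 48
  have h0 := eta_coe_ne_zero τ
  have hτ : (τ : ℂ) ≠ 0 := τ.ne_zero
  have him : 0 < (τ : ℂ).im := τ.2
  have hI : Complex.sqrt Complex.I ≠ 0 := by
    rw [sqrt_eq_exp Complex.I_ne_zero]; exact Complex.exp_ne_zero _
  have hs : Complex.sqrt (τ : ℂ) ≠ 0 := by
    rw [sqrt_eq_exp hτ]; exact Complex.exp_ne_zero _
  have h2 : (Real.sqrt 2 : ℂ) ^ 2 = 2 := by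
    rw [← Complex.ofReal_pow, Real.sq_sqrt (by norm_num)]; norm_num
  have h2' : (Real.sqrt 2 : ℂ) ≠ 0 := by norm_num
  have h1 := eta_neg_inv him
  have ha : ModularForm.eta (-(τ : ℂ)⁻¹ / 2) = (Complex.sqrt Complex.I)⁻¹ *
      ((Real.sqrt 2 : ℂ) * Complex.sqrt τ) * ModularForm.eta (2 * τ) := by
    have := eta_neg_inv (z := (2 : ℝ) * (τ : ℂ)) (by simpa using him)
    rw [sqrt_ofReal_mul (by norm_num) hτ] at this
    rw [Complex.ofReal_ofNat] at this
    convert this using 2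
    field_simp
  have hb : (Real.sqrt 2 : ℂ) * ModularForm.eta (2 * -(τ : ℂ)⁻¹) = (Complex.sqrt Complex.I)⁻¹ *
      Complex.sqrt τ * ModularForm.eta (τ / 2) := by
    have := eta_neg_inv (z := (1 / 2 : ℝ) * (τ : ℂ)) (by simpa using him)
    rw [sqrt_ofReal_mul (by norm_num) hτ] at this
    have e1 : -(((1 / 2 : ℝ) : ℂ) * (τ : ℂ))⁻¹ = 2 * -(τ : ℂ)⁻¹ := by
      push_cast; field_simp
    have e2 : ((1 / 2 : ℝ) : ℂ) * (τ : ℂ) = τ / 2 := by push_cast; ring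
    have e3 : (Real.sqrt 2 : ℂ) * (Real.sqrt (1 / 2 : ℝ) : ℂ) = 1 := by
      rw [← Complex.ofReal_mul, ← Real.sqrt_mul (by norm_num)]; norm_num
    rw [e1, e2] at this
    rw [this]
    linear_combination ((Complex.sqrt Complex.I)⁻¹ * Complex.sqrt τ *
      ModularForm.eta (τ / 2)) * e3
  have hU1 : weberU 1 (ModularGroup.S • τ) = zeta 24 ^ 3 * weberU 2 τ := by
    simp only [weberU, weberF₁, weberF₂, Matrix.cons_val, coe_S_smul]
    rw [h1, ha, ← zeta_48_pow_three, ← zeta_48_pow_two]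
    field_simp
  have hU2 : weberU 2 (ModularGroup.S • τ) = (zeta 24 ^ 3)⁻¹ * weberU 1 τ := by
    simp only [weberU, weberF₁, weberF₂, Matrix.cons_val, coe_S_smul]
    rw [hb, h1, ← zeta_48_pow_three, ← zeta_48_pow_two]
    field_simp
  -- The product relation at `Sτ` and at `τ` determines the transformation of `𝔲₀` from the other
  -- two, so `η` at `(Sτ+1)/2` never has to be transformed.
  refine ⟨?_, hU1, hU2⟩
  have e := (weberU_mul (ModularGroup.S • τ)).trans (weberU_mul τ).symm
  rw [hU1, hU2] at e
  have n1 := weberU_ne_zero 1 τ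
  have n2 := weberU_ne_zero 2 τ
  have n3 := pow_ne_zero 3 (zeta_ne_zero 24)
  have e' : weberU 0 (ModularGroup.S • τ) * (weberU 1 τ * weberU 2 τ) =
      weberU 0 τ * (weberU 1 τ * weberU 2 τ) := by
    rw [show weberU 0 (ModularGroup.S • τ) * (zeta 24 ^ 3 * weberU 2 τ) *
      ((zeta 24 ^ 3)⁻¹ * weberU 1 τ) =
      weberU 0 (ModularGroup.S • τ) * (weberU 1 τ * weberU 2 τ) by
        generalize zeta 24 ^ 3 = t at n3; field_simp] at e
    rw [e, mul_assoc]
  exact mul_right_cancel₀ (mul_ne_zero n1 n2) e'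

lemma zeta_16_pow : zeta 16 ^ 24 = -1 := by
  have h : zeta 16 ^ 8 = zeta 2 := zeta_mul_pow 2 8 (by norm_num)
  have h2 : zeta 2 = -1 := by
    rw [zeta, ← Complex.exp_pi_mul_I]
    congr 1
    push_cast
    ring
  rw [show 24 = 8 * 3 from rfl, pow_mul, h, h2]
  norm_num

/-- At `τ = i` both `𝔲₁²⁴` and `𝔲₂²⁴` are negative reals, because `η` is real on the imaginary axis
and `ζ₁₆²⁴ = -1`. If `𝔲₀²⁴` equalled `𝔲₁²⁴`, the product of the three would be negative, whereas it
is `√2²⁴`. -/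
lemma weberU_zero_ne_one : ∃ τ : ℍ, weberU 0 τ ^ 24 ≠ weberU 1 τ ^ 24 := by
  refine ⟨UpperHalfPlane.I, ?_⟩
  obtain ⟨a, ha, ea⟩ := eta_ofReal_mul_I (y := 1) one_pos
  obtain ⟨b, hb, eb⟩ := eta_ofReal_mul_I (y := 1 / 2) (by norm_num)
  obtain ⟨c, hc, ec⟩ := eta_ofReal_mul_I (y := 2) (by norm_num)
  have hI : ((UpperHalfPlane.I : ℍ) : ℂ) = Complex.I := rfl
  have e1 : weberU 1 UpperHalfPlane.I ^ 24 = ((-((b / a) ^ 24) : ℝ) : ℂ) := by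
    simp only [weberU, weberF₁, Matrix.cons_val, hI]
    rw [show Complex.I / 2 = ((1 / 2 : ℝ) : ℂ) * Complex.I by push_cast; ring, eb,
      show Complex.I = ((1 : ℝ) : ℂ) * Complex.I by simp, ea, mul_pow, zeta_16_pow]
    push_cast
    ring
  have e2 : weberU 2 UpperHalfPlane.I ^ 24 = ((-((Real.sqrt 2 * c / a) ^ 24) : ℝ) : ℂ) := by
    simp only [weberU, weberF₂, Matrix.cons_val, hI]
    rw [show 2 * Complex.I = ((2 : ℝ) : ℂ) * Complex.I by push_cast; ring, ec,
      show Complex.I = ((1 : ℝ) : ℂ) * Complex.I by simp, ea, mul_pow, inv_pow, zeta_16_pow]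
    push_cast
    ring
  intro h
  have hm := congrArg (· ^ 24) (weberU_mul UpperHalfPlane.I)
  simp only [mul_pow] at hm
  rw [h, e1, e2] at hm
  norm_cast at hm
  have h2 : (0 : ℝ) < Real.sqrt 2 := by positivity
  have p1 : 0 < (b / a) ^ 24 := (Even.pow_pos (by decide) (div_ne_zero hb ha))
  have p2 : 0 < (Real.sqrt 2 * c / a) ^ 24 :=
    (Even.pow_pos (by decide) (div_ne_zero (mul_ne_zero h2.ne' hc) ha))
  have p3 : 0 < Real.sqrt 2 ^ 24 := by positivity
  rw [← hm] at p3
  nlinarith [mul_pos (mul_pos p1 p1) p2]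

lemma eq_of_symmetric_fin_three {P : Fin 3 → Fin 3 → Prop} (hP : ∀ i j, P i j → P j i)
    (h01 : ¬ P 0 1) (h02 : ¬ P 0 2) (h12 : ¬ P 1 2) {i j : Fin 3} (h : P i j) : i = j := by
  have h10 := mt (hP 1 0) h01
  have h20 := mt (hP 2 0) h02
  have h21 := mt (hP 2 1) h12
  fin_cases i <;> fin_cases j <;> first | rfl | contradiction

/-- `S` and `T` permute the three 24th powers, so any coincidence between two of them is transported
to `𝔲₀²⁴ = 𝔲₁²⁴`. -/
lemma weberU_pow_injective {i j : Fin 3} (h : ∀ τ, weberU i τ ^ 24 = weberU j τ ^ 24) :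
    i = j := by
  have hz : zeta 24 ^ 24 = 1 := (zeta_isPrimitiveRoot (by norm_num)).pow_eq_one
  have hz2 : (zeta 24 ^ 2) ^ 24 = 1 := by rw [← pow_mul, mul_comm, pow_mul, hz, one_pow]
  have hz3 : (zeta 24 ^ 3) ^ 24 = 1 := by rw [← pow_mul, mul_comm, pow_mul, hz, one_pow]
  have h01 : ¬ ∀ τ, weberU 0 τ ^ 24 = weberU 1 τ ^ 24 := by
    obtain ⟨τ, hτ⟩ := weberU_zero_ne_one
    exact fun h => hτ (h τ)
  have h02 : ¬ ∀ τ, weberU 0 τ ^ 24 = weberU 2 τ ^ 24 := by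
    intro h
    apply h01
    intro τ
    have := h (ModularGroup.S • τ)
    rwa [(weberU_S τ).1, (weberU_S τ).2.2, mul_pow, inv_pow, hz3, inv_one, one_mul] at this
  have h12 : ¬ ∀ τ, weberU 1 τ ^ 24 = weberU 2 τ ^ 24 := by
    intro h
    apply h02
    intro τ
    have := h (ModularGroup.T • τ)
    rwa [(weberU_T τ).2.1, (weberU_T τ).2.2, mul_pow, mul_pow, hz, one_mul, one_mul] at this
  exact eq_of_symmetric_fin_three (P := fun i j => ∀ τ, weberU i τ ^ 24 = weberU j τ ^ 24)
    (fun i j h τ => (h τ).symm) h01 h02 h12 h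

/-! ### The action of `SL₂(ℤ)` on the Weber functions -/

/-- Every element of `SL₂(ℤ)` permutes the Weber functions up to `24`-th roots of unity
`c₀, c₁, c₂` of product `1` with `c₀⁸ = c₁⁸ = c₂⁸`. -/
lemma exists_weberU_smul (γ : SL(2, ℤ)) : ∃ (σ : Equiv.Perm (Fin 3)) (c : Fin 3 → ℂ),
    (∀ i, c i ^ 24 = 1) ∧ ∏ i, c i = 1 ∧ (∀ i j, c i ^ 8 = c j ^ 8) ∧
    ∀ i τ, weberU i (γ • τ) = c i * weberU (σ i) τ := by
  have hz : zeta 24 ^ 24 = 1 := (zeta_isPrimitiveRoot (by norm_num)).pow_eq_one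
  have h0 := zeta_ne_zero 24
  have hγ : γ ∈ Subgroup.closure {ModularGroup.S, ModularGroup.T} := by
    rw [SpecialLinearGroup.SL2Z_generators]; trivial
  induction hγ using Subgroup.closure_induction with
  | mem x hx =>
    rcases hx with rfl | rfl
    · refine ⟨Equiv.swap 1 2, ![1, zeta 24 ^ 3, (zeta 24 ^ 3)⁻¹], ?_, ?_, ?_, ?_⟩
      · intro i
        have hz3 : (zeta 24 ^ 3) ^ 24 = 1 := by rw [pow_right_comm, hz, one_pow]
        fin_cases i
        · simp
        · exact hz3
        · exact (inv_pow _ _).trans (by rw [hz3, inv_one])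
      · simp [Fin.prod_univ_three, h0]
      · have : ∀ i, (![1, zeta 24 ^ 3, (zeta 24 ^ 3)⁻¹] : Fin 3 → ℂ) i ^ 8 = 1 := by
          intro i
          fin_cases i <;> simp [← pow_mul, hz]
        intro i j
        rw [this, this]
      · intro i τ
        have := weberU_S τ
        have s0 : Equiv.swap (1 : Fin 3) 2 0 = 0 := by decide
        have s1 : Equiv.swap (1 : Fin 3) 2 1 = 2 := by decide
        have s2 : Equiv.swap (1 : Fin 3) 2 2 = 1 := by decide
        fin_cases i
        · simpa [s0] using this.1
        · simpa [s1] using this.2.1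
        · simpa [s2] using this.2.2
    · refine ⟨Equiv.swap 0 1, ![(zeta 24 ^ 2)⁻¹, zeta 24, zeta 24], ?_, ?_, ?_, ?_⟩
      · intro i
        fin_cases i
        · exact (inv_pow _ _).trans (by rw [pow_right_comm, hz, one_pow, inv_one])
        · exact hz
        · exact hz
      · simp [Fin.prod_univ_three]
        field_simp
      · have : ∀ i, (![(zeta 24 ^ 2)⁻¹, zeta 24, zeta 24] : Fin 3 → ℂ) i ^ 8 = zeta 24 ^ 8 := by
          intro i
          fin_cases i
          · simp only [Fin.zero_eta, Matrix.cons_val_zero, inv_pow, ← pow_mul]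
            refine (eq_inv_of_mul_eq_one_right ?_).symm
            rw [← pow_add]
            exact hz
          · rfl
          · rfl
        intro i j
        rw [this, this]
      · intro i τ
        have := weberU_T τ
        have s0 : Equiv.swap (0 : Fin 3) 1 0 = 1 := by decide
        have s1 : Equiv.swap (0 : Fin 3) 1 1 = 0 := by decide
        have s2 : Equiv.swap (0 : Fin 3) 1 2 = 2 := by decide
        fin_cases i
        · simpa [s0] using this.1
        · simpa [s1] using this.2.1
        · simpa [s2] using this.2.2
  | one => exact ⟨1, 1, by simp, by simp, by simp, by simp⟩
  | mul x y _ _ hx hy =>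
    obtain ⟨σ, c, h1, h2, h3, h4⟩ := hx
    obtain ⟨ρ, d, g1, g2, g3, g4⟩ := hy
    refine ⟨ρ * σ, fun i => c i * d (σ i), ?_, ?_, ?_, ?_⟩
    · intro i; rw [mul_pow, h1, g1, one_mul]
    · rw [Finset.prod_mul_distrib, h2, Equiv.prod_comp σ d, g2, one_mul]
    · intro i j; rw [mul_pow, mul_pow, h3 i j, g3 (σ i) (σ j)]
    · intro i τ
      rw [mul_smul, h4, g4, mul_assoc]
      rfl
  | inv x _ hx =>
    obtain ⟨σ, c, h1, h2, h3, h4⟩ := hx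
    refine ⟨σ⁻¹, fun i => (c (σ⁻¹ i))⁻¹, ?_, ?_, ?_, ?_⟩
    · intro i; rw [inv_pow, h1, inv_one]
    · rw [Finset.prod_inv_distrib, Equiv.prod_comp σ⁻¹ c, h2, inv_one]
    · intro i j; rw [inv_pow, inv_pow, h3]
    · intro i τ
      have h := h4 (σ⁻¹ i) (x⁻¹ • τ)
      rw [smul_inv_smul] at h
      have hc : c (σ⁻¹ i) ≠ 0 := fun h => by
        have h1' := h1 (σ⁻¹ i)
        rw [h, zero_pow (by norm_num)] at h1'
        exact zero_ne_one h1'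
      rw [h, inv_mul_cancel_left₀ hc]
      simp

lemma weberU_zpow_smul {i : Fin 3} {γ : SL(2, ℤ)} {c : ℂ} (hc : c ≠ 0)
    (h : ∀ τ, weberU i (γ • τ) = c * weberU i τ) (p : ℤ) (τ : ℍ) :
    weberU i (γ ^ p • τ) = c ^ p * weberU i τ := by
  induction p generalizing τ with
  | zero => simp
  | succ n ih =>
    rw [zpow_add_one, mul_smul, ih, h, zpow_add_one₀ hc, mul_assoc]
  | pred n ih =>
    have h' := h (γ⁻¹ • τ)
    rw [smul_inv_smul] at h'
    rw [zpow_sub_one, mul_smul, ih, h', zpow_sub_one₀ hc, mul_assoc, inv_mul_cancel_left₀ hc]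

/-- `T²` acts diagonally with exponents `(-1, -1, 2)` and `V = S T² S` with exponents `(-1, 2, -1)`;
the element taken is `T^(2p) V^q`. -/
lemma exists_weberU_smul_eq_zpow (p q : ℤ) : ∃ γ : SL(2, ℤ), ∀ τ,
    weberU 0 (γ • τ) = zeta 24 ^ (-p - q) * weberU 0 τ ∧
    weberU 1 (γ • τ) = zeta 24 ^ (2 * q - p) * weberU 1 τ ∧
    weberU 2 (γ • τ) = zeta 24 ^ (2 * p - q) * weberU 2 τ := by
  have h0 := zeta_ne_zero 24
  have hT (τ : ℍ) : weberU 0 ((ModularGroup.T * ModularGroup.T) • τ) = (zeta 24)⁻¹ * weberU 0 τ ∧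
      weberU 1 ((ModularGroup.T * ModularGroup.T) • τ) = (zeta 24)⁻¹ * weberU 1 τ ∧
      weberU 2 ((ModularGroup.T * ModularGroup.T) • τ) = zeta 24 ^ 2 * weberU 2 τ := by
    rw [mul_smul]
    simp only [(weberU_T _).1, (weberU_T _).2.1, (weberU_T _).2.2]
    refine ⟨?_, ?_, ?_⟩ <;> first | trivial | ring1 | field_simp
  set V := ModularGroup.S * (ModularGroup.T * ModularGroup.T) * ModularGroup.S with hVdef
  have hV (τ : ℍ) : weberU 0 (V • τ) = (zeta 24)⁻¹ * weberU 0 τ ∧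
      weberU 1 (V • τ) = zeta 24 ^ 2 * weberU 1 τ ∧
      weberU 2 (V • τ) = (zeta 24)⁻¹ * weberU 2 τ := by
    rw [hVdef, mul_smul, mul_smul]
    simp only [(weberU_S _).1, (weberU_S _).2.1, (weberU_S _).2.2, (hT _).1, (hT _).2.1,
      (hT _).2.2]
    refine ⟨?_, ?_, ?_⟩ <;> first | trivial | ring1 | field_simp
  refine ⟨(ModularGroup.T * ModularGroup.T) ^ p * V ^ q, fun τ => ⟨?_, ?_, ?_⟩⟩ <;> rw [mul_smul]
  · rw [weberU_zpow_smul (inv_ne_zero h0) (fun τ => (hT τ).1),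
      weberU_zpow_smul (inv_ne_zero h0) (fun τ => (hV τ).1), ← mul_assoc, inv_zpow', inv_zpow',
      ← zpow_add₀ h0]
    rfl
  · rw [weberU_zpow_smul (inv_ne_zero h0) (fun τ => (hT τ).2.1),
      weberU_zpow_smul (pow_ne_zero 2 h0) (fun τ => (hV τ).2.1), ← mul_assoc, inv_zpow',
      ← zpow_natCast, ← zpow_mul, ← zpow_add₀ h0]
    congr 2
    push_cast
    ring
  · rw [weberU_zpow_smul (pow_ne_zero 2 h0) (fun τ => (hT τ).2.2),
      weberU_zpow_smul (inv_ne_zero h0) (fun τ => (hV τ).2.2), ← mul_assoc, inv_zpow',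
      ← zpow_natCast, ← zpow_mul, ← zpow_add₀ h0]
    rfl

/-! ### Passing to `PSL₂(ℤ)` -/

lemma smul_eq_of_mk_eq {γ δ : SL(2, ℤ)}
    (h : (QuotientGroup.mk γ : Matrix.ProjectiveSpecialLinearGroup (Fin 2) ℤ) =
      QuotientGroup.mk δ) (τ : ℍ) : γ • τ = δ • τ := by
  rw [QuotientGroup.eq, Matrix.SpecialLinearGroup.mem_center_iff] at h
  obtain ⟨s, hs, h⟩ := h
  have hcenter : (γ⁻¹ * δ) • τ = τ := by
    rw [Fintype.card_fin, sq_eq_one_iff] at hs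
    rcases hs with rfl | rfl
    · have : γ⁻¹ * δ = 1 := by
        apply Subtype.ext
        rw [← h]
        simp
      rw [this, one_smul]
    · have : γ⁻¹ * δ = -1 := by
        apply Subtype.ext
        rw [← h]
        simp
      rw [this, ModularGroup.SL_neg_smul, one_smul]
  rw [mul_smul, inv_smul_eq_iff] at hcenter
  exact hcenter.symm

/-- `weberGamma N` is an image, so membership of a class only provides some representative in the
kernel; all representatives act alike on `ℍ`. -/
lemma mk_mem_weberGamma {N : ℕ} {γ : SL(2, ℤ)} :
    (QuotientGroup.mk γ : Matrix.ProjectiveSpecialLinearGroup (Fin 2) ℤ) ∈ weberGamma N ↔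
      γ ∈ weberKernelSL N := by
  refine ⟨?_, fun h => ⟨γ, h, rfl⟩⟩
  rintro ⟨δ, hδ, h⟩ i τ
  rw [← smul_eq_of_mk_eq h]
  exact hδ i τ

lemma weberGamma_le {m n : ℕ} (hmn : m * n ∣ 24) : weberGamma (m * n) ≤ weberGamma n := by
  apply Subgroup.map_mono
  intro γ hγ i τ
  obtain ⟨e, he⟩ := hmn
  have hn : 0 < m * n := Nat.pos_of_ne_zero (by rintro h; simp [h] at he)
  have h1 : 24 / n = (24 / (m * n)) * m := by
    rw [he, Nat.mul_div_cancel_left _ hn, mul_comm m n, mul_assoc,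
      Nat.mul_div_cancel_left _ (Nat.pos_of_mul_pos_left hn), mul_comm]
  rw [h1, pow_mul, pow_mul, hγ i τ]

/-! ### The Galois group of the cover -/

/-- The exponent `k` with `m = k` or `m = 3k` and `3 ∤ k`, for `m ∣ 24`. -/
def coverExp (m : ℕ) : ℕ := if 3 ∣ m then m / 3 else m

/-- The Galois group of the cover `W_{mn} → W_n`. -/
def coverGroup (m : ℕ) (K : Type*) [Field K] : Subgroup (Fin 3 → rootsOfUnity m K) where
  carrier := {h | h 0 * h 1 * h 2 = 1 ∧ ∀ i j, h i ^ coverExp m = h j ^ coverExp m}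
  one_mem' := by simp
  mul_mem' := by
    rintro a b ⟨ha, ha'⟩ ⟨hb, hb'⟩
    refine ⟨?_, fun i j => ?_⟩
    · simp only [Pi.mul_apply]
      rw [mul_mul_mul_comm (a 0), mul_mul_mul_comm (a 0 * a 1), ha, hb, one_mul]
    · simp only [Pi.mul_apply, mul_pow, ha' i j, hb' i j]
  inv_mem' := by
    rintro a ⟨ha, ha'⟩
    refine ⟨?_, fun i j => ?_⟩
    · simp only [Pi.inv_apply]
      rw [← mul_inv, ← mul_inv, ha, inv_one]
    · simp only [Pi.inv_apply, inv_pow, ha' i j]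

lemma mem_coverGroup {m : ℕ} {K : Type*} [Field K] {h : Fin 3 → rootsOfUnity m K} :
    h ∈ coverGroup m K ↔
      h 0 * h 1 * h 2 = 1 ∧ ∀ i j, h i ^ coverExp m = h j ^ coverExp m := Iff.rfl

lemma three_mul_coverExp {m : ℕ} (h : 3 ∣ m) : 3 * coverExp m = m := by
  rw [coverExp, if_pos h, Nat.mul_div_cancel' h]

lemma coverExp_of_not_dvd {m : ℕ} (h : ¬ 3 ∣ m) : coverExp m = m := if_neg h

lemma not_three_dvd_of_mul_dvd {m n : ℕ} (hmn : m * n ∣ 24) (hm : 3 ∣ m) : ¬ 3 ∣ n := by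
  intro hn
  have := (Nat.mul_dvd_mul hm hn).trans hmn
  revert this
  decide

/-! ### Roots of unity in `K`, and the scalars by which `Γ_n` acts. -/

section

variable {K : Type*} [Field K]

/-- The element of `K` underlying a root of unity. -/
abbrev rootVal {m : ℕ} (x : rootsOfUnity m K) : K := ((x : Kˣ) : K)

@[simp] lemma rootVal_one {m : ℕ} : rootVal (1 : rootsOfUnity m K) = 1 := rfl

@[simp] lemma rootVal_mul {m : ℕ} (x y : rootsOfUnity m K) :
    rootVal (x * y) = rootVal x * rootVal y := rfl

@[simp] lemma rootVal_pow {m : ℕ} (x : rootsOfUnity m K) (j : ℕ) :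
    rootVal (x ^ j) = rootVal x ^ j := by simp [rootVal]

lemma rootVal_injective {m : ℕ} : Function.Injective (rootVal : rootsOfUnity m K → K) :=
  fun _ _ h => Subtype.ext (Units.ext h)

lemma rootVal_ne_zero {m : ℕ} (x : rootsOfUnity m K) : rootVal x ≠ 0 := Units.ne_zero _

lemma rootVal_pow_eq_one {m : ℕ} (x : rootsOfUnity m K) : rootVal x ^ m = 1 := by
  have := x.2
  rw [mem_rootsOfUnity] at this
  rw [rootVal, ← Units.val_pow_eq_pow_val, this, Units.val_one]

lemma exists_rootVal_eq {m : ℕ} (hm : m ≠ 0) {x : K} (hx : x ^ m = 1) :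
    ∃ y : rootsOfUnity m K, rootVal y = x := by
  have : NeZero m := ⟨hm⟩
  exact ⟨rootsOfUnity.mkOfPowEq x hx, rootsOfUnity.coe_mkOfPowEq hx⟩

lemma exists_rootVal_algebraMap_eq [Algebra K ℂ] {ζ : K} (hζ : IsPrimitiveRoot ζ 24) {m : ℕ}
    (hm : m ∣ 24) {c : ℂ} (hc : c ^ m = 1) :
    ∃ y : rootsOfUnity m K, algebraMap K ℂ (rootVal y) = c := by
  have hm0 : m ≠ 0 := by rintro rfl; simp at hm
  have : NeZero m := ⟨hm0⟩
  obtain ⟨e, he⟩ := hm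
  have h1 : IsPrimitiveRoot (ζ ^ e) m := hζ.pow (by norm_num) (by rw [he, mul_comm])
  have h2 : IsPrimitiveRoot (algebraMap K ℂ (ζ ^ e)) m :=
    h1.map_of_injective (algebraMap K ℂ).injective
  obtain ⟨i, -, hi⟩ := h2.eq_pow_of_pow_eq_one hc
  obtain ⟨y, hy⟩ := exists_rootVal_eq hm0 (x := (ζ ^ e) ^ i)
    (by rw [← pow_mul, mul_comm, pow_mul, h1.pow_eq_one, one_pow])
  exact ⟨y, by rw [hy, map_pow, hi]⟩

section

variable [Algebra K ℂ]

lemma eq_of_weberU_smul_eq {m e : ℕ} {h h' : Fin 3 → rootsOfUnity m K} {γ : SL(2, ℤ)}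
    (hh : ∀ i τ, weberU i (γ • τ) ^ e = algebraMap K ℂ (rootVal (h i)) * weberU i τ ^ e)
    (hh' : ∀ i τ, weberU i (γ • τ) ^ e = algebraMap K ℂ (rootVal (h' i)) * weberU i τ ^ e) :
    h = h' := by
  funext i
  have := (hh i UpperHalfPlane.I).symm.trans (hh' i UpperHalfPlane.I)
  exact rootVal_injective ((algebraMap K ℂ).injective
    (mul_right_cancel₀ (pow_ne_zero _ (weberU_ne_zero _ _)) this))

/-- The triple is `h_i = c_i ^ e`. The `n`-th power of the condition defining `Γ_n` kills the `c_i`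
and leaves an equality of 24th powers, so the permutation is trivial. -/
lemma exists_coverGroup_of_mem_weberKernelSL {ζ : K} (hζ : IsPrimitiveRoot ζ 24) {m n e : ℕ}
    (he : m * n * e = 24) {γ : SL(2, ℤ)} (hγ : γ ∈ weberKernelSL n) :
    ∃ h ∈ coverGroup m K, ∀ i τ,
      weberU i (γ • τ) ^ e = algebraMap K ℂ (rootVal (h i)) * weberU i τ ^ e := by
  obtain ⟨σ, c, h1, h2, h3, h4⟩ := exists_weberU_smul γ
  have hn : 0 < n := Nat.pos_of_ne_zero (by rintro rfl; simp at he)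
  have hme : 24 / n = m * e := Nat.div_eq_of_eq_mul_right hn (by rw [← he]; ring)
  have hγ' : ∀ i τ, weberU i (γ • τ) ^ (m * e) = weberU i τ ^ (m * e) := by
    rw [← hme]; exact hγ
  have hσ : ∀ i, σ i = i := by
    intro i
    apply weberU_pow_injective
    intro τ
    have := congrArg (· ^ n) (hγ' i τ)
    simp only [← pow_mul] at this
    rw [show m * e * n = 24 by rw [← he]; ring, h4, mul_pow, h1, one_mul] at this
    exact this
  simp only [hσ] at h4
  have hc : ∀ i, c i ^ (m * e) = 1 := by
    intro i
    have := hγ' i UpperHalfPlane.I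
    rw [h4, mul_pow] at this
    exact mul_eq_right₀ (pow_ne_zero _ (weberU_ne_zero _ _)) |>.1 this
  have hm : m ∣ 24 := ⟨n * e, by rw [← he]; ring⟩
  have hex : ∀ i, ∃ y : rootsOfUnity m K, algebraMap K ℂ (rootVal y) = c i ^ e := fun i =>
    exists_rootVal_algebraMap_eq hζ hm (by rw [← pow_mul, mul_comm]; exact hc i)
  choose h hh using hex
  refine ⟨h, ⟨?_, fun i j => ?_⟩, fun i τ => by rw [h4, mul_pow, hh]⟩
  · apply rootVal_injective
    apply (algebraMap K ℂ).injective
    have : algebraMap K ℂ (rootVal (h 0)) * algebraMap K ℂ (rootVal (h 1)) *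
        algebraMap K ℂ (rootVal (h 2)) = 1 := by
      rw [hh, hh, hh, ← mul_pow, ← mul_pow, ← Fin.prod_univ_three, h2, one_pow]
    simpa using this
  · apply rootVal_injective
    apply (algebraMap K ℂ).injective
    have : (c i ^ e) ^ coverExp m = (c j ^ e) ^ coverExp m := by
      -- For `m = 3k` one has `c^(9ke) = (c^(me))³ = 1`, so `c^(ke)` is inverse to `c^(8ke)`, and
      -- the eighth powers of the `c_i` agree.
      by_cases h3m : 3 ∣ m
      · set k := coverExp m with hk
        have hk3 : 3 * k = m := three_mul_coverExp h3m
        have hc9 : ∀ i, c i ^ (k * e) * c i ^ (8 * (k * e)) = 1 := by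
          intro i
          rw [← pow_add, show k * e + 8 * (k * e) = m * e * 3 by rw [← hk3]; ring, pow_mul, hc,
            one_pow]
        have h8 : c i ^ (8 * (k * e)) = c j ^ (8 * (k * e)) := by
          rw [pow_mul _ 8, pow_mul _ 8, h3 i j]
        rw [← pow_mul, ← pow_mul, mul_comm e k]
        have h9 := (hc9 i).trans (hc9 j).symm
        rw [h8] at h9
        refine mul_right_cancel₀ ?_ h9
        intro h0
        have := hc9 j
        rw [h0, mul_zero] at this
        exact zero_ne_one this
      · rw [coverExp_of_not_dvd h3m, ← pow_mul, ← pow_mul, mul_comm e m, hc, hc]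
    simpa [hh] using this

lemma exists_weberKernelSL_of_mem_coverGroup {m n e : ℕ} (he : m * n * e = 24)
    {h : Fin 3 → rootsOfUnity m K} (hh : h ∈ coverGroup m K) :
    ∃ γ ∈ weberKernelSL n, ∀ i τ,
      weberU i (γ • τ) ^ e = algebraMap K ℂ (rootVal (h i)) * weberU i τ ^ e := by
  have hprim : IsPrimitiveRoot (zeta 24) 24 := zeta_isPrimitiveRoot (by norm_num)
  have h0 := zeta_ne_zero 24
  have hn : 0 < n := Nat.pos_of_ne_zero (by rintro rfl; simp at he)
  have hm : m ≠ 0 := by rintro rfl; simp at he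
  set a : Fin 3 → ℂ := fun i => algebraMap K ℂ (rootVal (h i)) with ha
  have ha0 : ∀ i, a i ≠ 0 := fun i =>
    (map_ne_zero_iff _ (algebraMap K ℂ).injective).2 (rootVal_ne_zero _)
  have ham : ∀ i, a i ^ m = 1 := fun i => by
    rw [ha]; simp only; rw [← map_pow, rootVal_pow_eq_one, map_one]
  have hprod : a 0 * a 1 * a 2 = 1 := by
    have := congrArg (fun x => algebraMap K ℂ (rootVal x)) hh.1
    simpa [ha] using this
  have hk : ∀ i j, a i ^ coverExp m = a j ^ coverExp m := fun i j => by
    have := congrArg (fun x => algebraMap K ℂ (rootVal x)) (hh.2 i j)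
    simpa [ha] using this
  have hpm : IsPrimitiveRoot (zeta 24 ^ (n * e)) m :=
    hprim.pow (by norm_num) (by rw [← he]; ring)
  have : NeZero m := ⟨hm⟩
  obtain ⟨s, -, hs⟩ := hpm.eq_pow_of_pow_eq_one (ham 0)
  -- In the family of diagonal elements with parameters `p, q`, the scalars of `𝔲₁` and `𝔲₀` have
  -- ratio `ζ₂₄^(3q)`; hence the factor `3` in the exponent to be solved for.
  have hq : ∃ q : ℤ, zeta 24 ^ (3 * q * e) = a 1 / a 0 ∧ (n : ℤ) ∣ q := by
    have hdiv : (a 1 / a 0) ^ coverExp m = 1 := by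
      rw [div_pow, hk 1 0, div_self (pow_ne_zero _ (ha0 0))]
    by_cases h3m : 3 ∣ m
    · have hk3 := three_mul_coverExp h3m
      have hpk : IsPrimitiveRoot (zeta 24 ^ (3 * n * e)) (coverExp m) :=
        hprim.pow (by norm_num) (by rw [← he]; nth_rw 1 [← hk3]; ring)
      have : NeZero (coverExp m) := ⟨by intro h; rw [h] at hk3; exact hm hk3.symm⟩
      obtain ⟨t, -, ht⟩ := hpk.eq_pow_of_pow_eq_one hdiv
      refine ⟨n * t, ?_, ⟨t, rfl⟩⟩
      rw [← ht, ← pow_mul, ← zpow_natCast]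
      congr 1
      push_cast
      ring
    · rw [coverExp_of_not_dvd h3m] at hdiv
      obtain ⟨t, -, ht⟩ := hpm.eq_pow_of_pow_eq_one hdiv
      -- Here `3 ∤ m` forces `3 ∣ ne`, so `9ne = ne + 8ne` with `24 ∣ 8ne`: multiplying the exponent
      -- `ne` by `9` does not change the root of unity.
      refine ⟨3 * (n * t), ?_, ⟨3 * t, by ring⟩⟩
      have h3 : 3 ∣ n * e := by
        have : 3 ∣ m * (n * e) := ⟨8, by rw [← mul_assoc, he]⟩
        exact (Nat.Prime.dvd_mul Nat.prime_three).1 this |>.resolve_left h3m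
      obtain ⟨f, hf⟩ := h3
      have e1 : (3 * (3 * ((n : ℤ) * t)) * e) = ((n * e * t + 24 * (f * t) : ℕ) : ℤ) := by
        have : (n : ℤ) * e = 3 * f := by exact_mod_cast hf
        push_cast
        linear_combination (8 * t : ℤ) * this
      rw [← ht, ← pow_mul, e1, zpow_natCast, pow_add, pow_mul _ 24, hprim.pow_eq_one, one_pow,
        mul_one]
  obtain ⟨q, hq, t, rfl⟩ := hq
  -- With `p = -q - ns` the exponents of `𝔲₀` and `𝔲₁` become `ns` and `3q + ns`, which give `a 0`
  -- and `a 1` after the `e`-th power. The third scalar is then forced by the product.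
  obtain ⟨γ, hγ⟩ := exists_weberU_smul_eq_zpow (-(n * t) - n * s) (n * t)
  have c0 : (zeta 24 ^ (-(-(n * t : ℤ) - n * s) - n * t)) ^ e = a 0 := by
    rw [← hs, ← pow_mul, ← zpow_natCast, ← zpow_natCast, ← zpow_mul]
    congr 1
    push_cast
    ring
  have c1 : (zeta 24 ^ (2 * (n * t : ℤ) - (-(n * t) - n * s))) ^ e = a 1 := by
    rw [← mul_div_cancel₀ (a 1) (ha0 0), mul_comm, ← hq, mul_comm, ← c0, ← zpow_natCast,
      ← zpow_natCast, ← zpow_mul, ← zpow_mul, ← zpow_add₀ h0]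
    congr 1
    ring
  have c2 : (zeta 24 ^ (2 * (-(n * t : ℤ) - n * s) - n * t)) ^ e = a 2 := by
    have e2 : a 2 = (a 0 * a 1)⁻¹ := eq_inv_of_mul_eq_one_right hprod
    rw [e2, ← c0, ← c1, ← mul_pow, ← zpow_add₀ h0, ← inv_pow, ← zpow_neg]
    congr 2
    ring
  have hall : ∀ i τ, weberU i (γ • τ) ^ e = a i * weberU i τ ^ e := by
    intro i τ
    fin_cases i
    · simp only [Fin.zero_eta, (hγ τ).1, mul_pow, c0]
    · simp only [Fin.mk_one, (hγ τ).2.1, mul_pow, c1]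
    · simp only [Fin.reduceFinMk, (hγ τ).2.2, mul_pow, c2]
  refine ⟨γ, ?_, hall⟩
  intro i τ
  rw [Nat.div_eq_of_eq_mul_right hn (show 24 = n * (e * m) by rw [← he]; ring), pow_mul, hall,
    mul_pow, ham, one_mul, ← pow_mul]

/-- The homomorphism `Γ_n → H` describing the action of `Γ_n` on the functions
`𝔲_i ^ (24 / (mn))`. -/
lemma exists_weberGamma_hom {ζ : K} (hζ : IsPrimitiveRoot ζ 24) {m n : ℕ} (hmn : m * n ∣ 24) :
    ∃ Φ : weberGamma n →* coverGroup m K, Function.Surjective Φ ∧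
      Φ.ker = (weberGamma (m * n)).subgroupOf (weberGamma n) ∧
      ∀ (γ : SL(2, ℤ)) (hγ : (QuotientGroup.mk γ :
          Matrix.ProjectiveSpecialLinearGroup (Fin 2) ℤ) ∈ weberGamma n) (i : Fin 3) (τ : ℍ),
        weberU i (γ • τ) ^ (24 / (m * n)) =
          algebraMap K ℂ (rootVal ((Φ ⟨QuotientGroup.mk γ, hγ⟩).1 i)) *
            weberU i τ ^ (24 / (m * n)) := by
  obtain ⟨e, he⟩ := hmn
  have hmn0 : 0 < m * n := Nat.pos_of_ne_zero (by rintro h; simp [h] at he)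
  have he' : 24 / (m * n) = e := Nat.div_eq_of_eq_mul_right hmn0 he
  rw [he']
  have hex : ∀ g : weberGamma n, ∃ h : coverGroup m K, ∀ γ : SL(2, ℤ),
      QuotientGroup.mk γ = g.1 → ∀ i τ,
        weberU i (γ • τ) ^ e = algebraMap K ℂ (rootVal (h.1 i)) * weberU i τ ^ e := by
    rintro ⟨g, δ, hδ, rfl⟩
    obtain ⟨h, hh, hh'⟩ := exists_coverGroup_of_mem_weberKernelSL (m := m) (n := n) (e := e)
      hζ he.symm hδ
    refine ⟨⟨h, hh⟩, fun γ hγ i τ => ?_⟩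
    rw [smul_eq_of_mk_eq hγ]
    exact hh' i τ
  choose Φ hΦ using hex
  -- The `𝔲_i` have no zeros, so any single representative determines the triple. Multiplicativity,
  -- surjectivity and the kernel all follow from this uniqueness.
  have huniq : ∀ (g : weberGamma n) (γ : SL(2, ℤ)) (h : coverGroup m K),
      QuotientGroup.mk γ = g.1 →
      (∀ i τ, weberU i (γ • τ) ^ e = algebraMap K ℂ (rootVal (h.1 i)) * weberU i τ ^ e) →
      Φ g = h := fun g γ h hg hh =>
    Subtype.ext (eq_of_weberU_smul_eq (hΦ g γ hg) hh)
  refine ⟨MonoidHom.mk' Φ ?_, ?_, ?_, ?_⟩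
  · rintro ⟨a, γ, hγ, rfl⟩ ⟨b, δ, hδ, rfl⟩
    refine huniq _ (γ * δ) _ rfl fun i τ => ?_
    rw [mul_smul, hΦ ⟨_, γ, hγ, rfl⟩ γ rfl, hΦ ⟨_, δ, hδ, rfl⟩ δ rfl, ← mul_assoc, ← map_mul]
    rfl
  · rintro ⟨h, hh⟩
    obtain ⟨γ, hγ, hγ'⟩ := exists_weberKernelSL_of_mem_coverGroup he.symm hh
    exact ⟨⟨_, γ, hγ, rfl⟩, huniq _ γ _ rfl hγ'⟩
  · ext ⟨a, γ, hγ, rfl⟩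
    rw [MonoidHom.mem_ker, Subgroup.mem_subgroupOf, MonoidHom.mk'_apply]
    have hmem := mk_mem_weberGamma (N := m * n) (γ := γ)
    refine Iff.trans ⟨fun h => ?_, fun h => ?_⟩ hmem.symm
    · intro i τ
      rw [he', hΦ ⟨_, γ, hγ, rfl⟩ γ rfl i τ, h]
      simp
    · refine huniq _ γ _ rfl fun i τ => ?_
      have := h i τ
      rw [he'] at this
      simpa using this
  · intro γ hγ i τ
    exact hΦ ⟨_, hγ⟩ γ rfl i τ

end

end

/-! ### Maps out of the coordinate rings -/

section Lift

variable {K : Type*} [Field K] {B : Type*} [CommRing B] [Algebra K B]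

/-- The affine equations of the Weber curve `W_N`. -/
def IsWeberPoint (r : K) (N : ℕ) (v : Fin 3 → B) : Prop :=
  (if 3 ∣ N then v 0 ^ (N / 3) + v 1 ^ (N / 3) + v 2 ^ (N / 3) = 0
    else v 0 ^ N + v 1 ^ N + v 2 ^ N = 48) ∧
  v 0 * v 1 * v 2 = algebraMap K B (weberConst r N)

lemma isWeberPoint_coord (r : K) (N : ℕ) : IsWeberPoint r N (coord r N) :=
  ⟨coord_rel₁ r N, coord_rel₂ r N⟩

lemma IsWeberPoint.map {C : Type*} [CommRing C] [Algebra K C] {r : K} {N : ℕ} {v : Fin 3 → B}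
    (hv : IsWeberPoint r N v) (f : B →ₐ[K] C) : IsWeberPoint r N (fun i => f (v i)) := by
  refine ⟨?_, by rw [← map_mul, ← map_mul, hv.2, f.commutes]⟩
  have := hv.1
  split_ifs at this ⊢ <;> simp only [← map_pow, ← map_add, this]
  · exact map_zero f
  · exact map_ofNat f 48

/-- The homomorphism out of the coordinate ring of `W_N` given by a point of `W_N`. -/
noncomputable def weberLift (r : K) (N : ℕ) (v : Fin 3 → B) (hv : IsWeberPoint r N v) :
    WeberRing r N →ₐ[K] B :=
  Ideal.Quotient.liftₐ (weberIdeal r N) (aeval v) (by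
    intro a ha
    have hle : weberIdeal r N ≤ RingHom.ker (aeval (R := K) v) := by
      rw [weberIdeal, Ideal.span_le]
      obtain ⟨h1, h2⟩ := hv
      rintro x (rfl | rfl)
      · rw [SetLike.mem_coe, RingHom.mem_ker]
        split_ifs at h1 with h3
        · simpa [weberForm₁, dehomogenize, h3] using h1
        · have e : (algebraMap K B) 48 = 48 := map_ofNat _ 48
          simpa [weberForm₁, dehomogenize, h3, sub_eq_zero, e] using h1
      · rw [SetLike.mem_coe, RingHom.mem_ker]
        simpa [weberForm₂, dehomogenize, sub_eq_zero] using h2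
    exact hle ha)

@[simp]
lemma weberLift_coord (r : K) (N : ℕ) (v : Fin 3 → B) (hv : IsWeberPoint r N v) (i : Fin 3) :
    weberLift r N v hv (coord r N i) = v i := by
  change aeval v (X i) = v i
  rw [aeval_X]

lemma weberRing_algHom_ext {r : K} {N : ℕ} {f g : WeberRing r N →ₐ[K] B}
    (h : ∀ i, f (coord r N i) = g (coord r N i)) : f = g := by
  apply Ideal.Quotient.algHom_ext
  apply MvPolynomial.algHom_ext
  exact h

@[simp]
lemma pullback_coord {r : K} (hr : r ^ 2 = 2) {m n : ℕ} (h : m * n ∣ 24) (i : Fin 3) :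
    pullback hr h (coord r n i) = coord r (m * n) i ^ m := by
  change aeval (fun i => coord r (m * n) i ^ m) (X i) = _
  rw [aeval_X]

lemma weberRing_induction {r : K} {N : ℕ} {p : WeberRing r N → Prop}
    (hC : ∀ a, p (algebraMap K _ a)) (hadd : ∀ f g, p f → p g → p (f + g))
    (hmul : ∀ f i, p f → p (f * coord r N i)) (f : WeberRing r N) : p f := by
  obtain ⟨P, rfl⟩ := Ideal.Quotient.mk_surjective f
  induction P using MvPolynomial.induction_on with
  | C a => exact hC a
  | add P Q hP hQ => rw [map_add]; exact hadd _ _ hP hQ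
  | mul_X P i hP => rw [map_mul]; exact hmul _ i hP

end Lift

lemma ne_zero_of_sq_eq_two {K : Type*} [Field K] [CharZero K] {r : K} (hr : r ^ 2 = 2) : r ≠ 0 := by
  rintro rfl
  norm_num at hr

lemma pow_eight_of_sq_eq_two {K : Type*} [Field K] {r : K} (hr : r ^ 2 = 2) : r ^ 8 = 16 := by
  rw [show 8 = 2 * 4 from rfl, pow_mul, hr]
  norm_num

lemma weberConst_ne_zero {K : Type*} [Field K] [CharZero K] {r : K} (hr : r ^ 2 = 2) (N : ℕ) :
    weberConst r N ≠ 0 := by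
  have := ne_zero_of_sq_eq_two hr
  unfold weberConst
  split_ifs
  · exact pow_ne_zero _ this
  · exact pow_ne_zero _ (mul_ne_zero two_ne_zero this)

lemma isUnit_coord {K : Type*} [Field K] [CharZero K] {r : K} (hr : r ^ 2 = 2) (N : ℕ)
    (i : Fin 3) : IsUnit (coord r N i) := by
  have h : IsUnit (coord r N 0 * coord r N 1 * coord r N 2) := by
    rw [coord_rel₂]
    exact (weberConst_ne_zero hr N).isUnit.map _
  rw [IsUnit.mul_iff, IsUnit.mul_iff] at h
  fin_cases i
  exacts [h.1.1, h.1.2, h.2]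

/-! ### The curve `W₂₄` is integral -/

section Domain

/-- The equation of `W₂₄` in the coordinates `u = X₁ / X₀` and `Y = X₃ / X₀`. -/
noncomputable def birationalEquation (K : Type*) [Field K] : Polynomial (Polynomial K) :=
  Polynomial.X ^ 24 +
    Polynomial.C (Polynomial.C (1 / 16 : K) * (Polynomial.X ^ 8 * (Polynomial.X ^ 8 + 1)))

variable {K : Type*} [Field K]

lemma birationalEquation_monic : (birationalEquation K).Monic :=
  Polynomial.monic_X_pow_add_C _ (by norm_num)

lemma birationalEquation_natDegree : (birationalEquation K).natDegree = 24 :=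
  Polynomial.natDegree_X_pow_add_C

lemma eval₂_birationalEquation {S : Type*} [CommRing S] (i : Polynomial K →+* S) (y : S) :
    (birationalEquation K).eval₂ i y = y ^ 24 + i (Polynomial.C (1 / 16)) *
      (i Polynomial.X ^ 8 * (i Polynomial.X ^ 8 + 1)) := by
  rw [birationalEquation, Polynomial.eval₂_add, Polynomial.eval₂_X_pow, Polynomial.eval₂_C]
  simp

/-- Eisenstein at an irreducible factor `p` of `u⁸ + 1`: this polynomial is separable in
characteristic zero, so `p² ∤ u⁸ + 1`, and `p` does not divide `u⁸`. -/
lemma birationalEquation_irreducible [CharZero K] : Irreducible (birationalEquation K) := by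
  have hsep : (Polynomial.X ^ 8 + 1 : Polynomial K).Separable := by
    have := Polynomial.separable_X_pow_sub_C (n := 8) (-1 : K) (by norm_num) (by norm_num)
    simpa using this
  have hnu : ¬ IsUnit (Polynomial.X ^ 8 + 1 : Polynomial K) := by
    intro h
    have := Polynomial.natDegree_eq_zero_of_isUnit h
    rw [← Polynomial.C_1, Polynomial.natDegree_X_pow_add_C] at this
    norm_num at this
  obtain ⟨p, hp, hpd⟩ := WfDvdMonoid.exists_irreducible_factor hnu hsep.ne_zero
  have hpp : Prime p := hp.prime
  have hpX : ¬ p ∣ (Polynomial.X : Polynomial K) ^ 8 := by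
    intro h
    apply hp.not_isUnit
    apply isUnit_of_dvd_one
    have := dvd_sub hpd h
    simpa using this
  have hcoeff : (birationalEquation K).coeff 0 =
      Polynomial.C (1 / 16 : K) * (Polynomial.X ^ 8 * (Polynomial.X ^ 8 + 1)) := by
    rw [birationalEquation, Polynomial.coeff_add, Polynomial.coeff_X_pow, Polynomial.coeff_C]
    simp
  have hcu : IsUnit (Polynomial.C (1 / 16 : K)) := Polynomial.isUnit_C.2 (by norm_num)
  have hE : (birationalEquation K).IsEisensteinAt (Ideal.span {p}) := by
    refine ⟨?_, ?_, ?_⟩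
    · rw [birationalEquation_monic.leadingCoeff, Ideal.mem_span_singleton]
      exact fun h => hp.not_isUnit (isUnit_of_dvd_one h)
    · intro n hn
      rw [birationalEquation_natDegree] at hn
      rw [Ideal.mem_span_singleton]
      rcases Nat.eq_zero_or_pos n with rfl | hn0
      · rw [hcoeff]
        exact (hpd.mul_left _).mul_left _
      · rw [birationalEquation, Polynomial.coeff_add, Polynomial.coeff_X_pow, Polynomial.coeff_C,
          if_neg hn.ne, if_neg hn0.ne', add_zero]
        exact dvd_zero p
    · rw [hcoeff, Ideal.span_singleton_pow, Ideal.mem_span_singleton, hcu.dvd_mul_left]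
      intro h
      have h1 : p ^ 2 ∣ Polynomial.X ^ 8 + 1 :=
        hpp.pow_dvd_of_dvd_mul_left 2 hpX h
      exact hp.not_isUnit (hsep.squarefree p (by rwa [← sq]))
  exact hE.irreducible ((Ideal.span_singleton_prime hp.ne_zero).2 hpp)
    birationalEquation_monic.isPrimitive (by rw [birationalEquation_natDegree]; norm_num)

variable {r : K}

/-- This inverts the substitution `u = X₁/X₀`, `Y = X₃/X₀`. The third coordinate is forced by the
product relation, and the sum of eighth powers becomes the plane equation because `r⁸ = 16`. -/
lemma isWeberPoint_model (hr : r ^ 2 = 2) {L : Type*} [Field L] [Algebra K L] {u Y : L}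
    (hu : u ≠ 0) (hY : Y ≠ 0) (h : 16 * Y ^ 24 + u ^ 8 * (u ^ 8 + 1) = 0) :
    IsWeberPoint r 24 ![1 / Y, u / Y, algebraMap K L r * Y ^ 2 / u] := by
  constructor
  · rw [if_pos (by norm_num)]
    have : algebraMap K L r ^ 8 = 16 := by
      rw [← map_pow, pow_eight_of_sq_eq_two hr]; exact map_ofNat _ 16
    simp only [Matrix.cons_val, Nat.reduceDiv, div_pow, mul_pow, this]
    field_simp
    linear_combination h
  · simp only [Matrix.cons_val, weberConst]
    norm_num
    field_simp

variable [CharZero K]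

theorem weberRing_isDomain (hr : r ^ 2 = 2) : IsDomain (WeberRing r 24) := by
  have hr0 := ne_zero_of_sq_eq_two hr
  have hr8 := pow_eight_of_sq_eq_two hr
  -- the birational model
  set F := birationalEquation K with hF
  have hFp : Prime F := birationalEquation_irreducible.prime
  have : IsDomain (AdjoinRoot F) := AdjoinRoot.isDomain_of_prime hFp
  set D := AdjoinRoot F
  have hY0 : AdjoinRoot.root F ≠ 0 := by
    rw [← AdjoinRoot.mk_X]
    apply AdjoinRoot.mk_ne_zero_of_natDegree_lt birationalEquation_monic Polynomial.X_ne_zero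
    rw [birationalEquation_natDegree, Polynomial.natDegree_X]
    norm_num
  have hu0 : AdjoinRoot.of F Polynomial.X ≠ 0 := by
    rw [← AdjoinRoot.mk_C]
    apply AdjoinRoot.mk_ne_zero_of_natDegree_lt birationalEquation_monic
      (Polynomial.C_ne_zero.2 Polynomial.X_ne_zero)
    rw [birationalEquation_natDegree, Polynomial.natDegree_C]
    norm_num
  have hYeq : AdjoinRoot.root F ^ 24 + AdjoinRoot.of F (Polynomial.C (1 / 16 : K)) *
      (AdjoinRoot.of F Polynomial.X ^ 8 * (AdjoinRoot.of F Polynomial.X ^ 8 + 1)) = 0 :=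
    (eval₂_birationalEquation _ _).symm.trans (AdjoinRoot.eval₂_root F)
  -- from the model to the coordinate ring
  have hxyz : coord r 24 0 * coord r 24 1 * coord r 24 2 = algebraMap K _ r := by
    rw [coord_rel₂]; simp [weberConst]
  have hsum : coord r 24 0 ^ 8 + coord r 24 1 ^ 8 + coord r 24 2 ^ 8 = 0 := by
    simpa using coord_rel₁ r 24
  have hux := isUnit_coord hr 24 0
  have huy := isUnit_coord hr 24 1
  set x := coord r 24 0
  set y := coord r 24 1
  set z := coord r 24 2
  -- Since `xyz = r`, the element `Y = yz/r` is the inverse of `x`.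
  obtain ⟨Y, hYdef⟩ : ∃ Y, Y = algebraMap K _ r⁻¹ * y * z := ⟨_, rfl⟩
  have hrr : algebraMap K (WeberRing r 24) r * algebraMap K _ r⁻¹ = 1 := by
    rw [← map_mul, mul_inv_cancel₀ hr0, map_one]
  have hxY : x * Y = 1 := by
    rw [hYdef]; linear_combination algebraMap K (WeberRing r 24) r⁻¹ * hxyz + hrr
  have huY : IsUnit Y := .of_mul_eq_one x (by rw [mul_comm, hxY])
  have hroot : F.eval₂ (Polynomial.aeval (R := K) (y * Y)).toRingHom Y = 0 := by
    have h16 : algebraMap K (WeberRing r 24) (1 / 16) * algebraMap K _ r ^ 8 = 1 := by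
      rw [← map_pow, hr8, ← map_mul, one_div, inv_mul_cancel₀ (by norm_num), map_one]
    have e : F.eval₂ (Polynomial.aeval (R := K) (y * Y)).toRingHom Y =
        Y ^ 24 + algebraMap K _ (1 / 16) * ((y * Y) ^ 8 * ((y * Y) ^ 8 + 1)) := by
      rw [eval₂_birationalEquation]
      simp
    rw [e]
    have hx8 : x ^ 8 * Y ^ 8 = 1 := by rw [← mul_pow, hxY, one_pow]
    have h8 : x ^ 8 * y ^ 8 * z ^ 8 = algebraMap K _ r ^ 8 := by
      rw [← mul_pow, ← mul_pow, hxyz]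
    apply (hux.pow 24).mul_right_cancel
    rw [zero_mul]
    generalize algebraMap K (WeberRing r 24) (1 / 16) = c at *
    have hx24 : x ^ 24 = x ^ 8 * x ^ 8 * x ^ 8 := by ring
    have hY24 : Y ^ 24 = Y ^ 8 * Y ^ 8 * Y ^ 8 := by ring
    rw [← h8] at h16
    rw [mul_pow, hx24, hY24]
    generalize x ^ 8 = a at *
    generalize y ^ 8 = b at *
    generalize z ^ 8 = d at *
    generalize Y ^ 8 = w at *
    have e1 : w * w * w * (a * a * a) = 1 := by
      calc _ = (a * w) ^ 3 := by ring
        _ = 1 := by rw [hx8, one_pow]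
    have e2 : b * w * (b * w + 1) * (a * a * a) = -(a * b * d) := by
      calc _ = (a * w) * (a * b) * (b * (a * w) + a) := by ring
        _ = -(a * b * d) := by rw [hx8]; linear_combination a * b * hsum
    linear_combination e1 + c * e2 - h16
  set ψ : D →+* WeberRing r 24 :=
    AdjoinRoot.lift (Polynomial.aeval (R := K) (y * Y)).toRingHom Y hroot with hψ
  have hψY : ψ (AdjoinRoot.root F) = Y := AdjoinRoot.lift_root hroot
  have hψu : ψ (AdjoinRoot.of F Polynomial.X) = y * Y := by
    rw [hψ, AdjoinRoot.lift_of]; simp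
  have hψC (a : K) : ψ (AdjoinRoot.of F (Polynomial.C a)) = algebraMap K _ a := by
    rw [hψ, AdjoinRoot.lift_of]; simp
  -- from the coordinate ring to the fraction field of the model
  let L := FractionRing D
  let ι : D →+* L := algebraMap D L
  have hι : Function.Injective ι := IsFractionRing.injective D L
  have hιC (a : K) : ι (AdjoinRoot.of F (Polynomial.C a)) = algebraMap K L a := by
    rw [IsScalarTower.algebraMap_apply K D L]
    rfl
  set Y' := ι (AdjoinRoot.root F) with hY'
  set u' := ι (AdjoinRoot.of F Polynomial.X) with hu'
  have hY'0 : Y' ≠ 0 := (map_ne_zero_iff ι hι).2 hY0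
  have hu'0 : u' ≠ 0 := (map_ne_zero_iff ι hι).2 hu0
  have hr'0 : algebraMap K L r ≠ 0 := by simpa using hr0
  have hY'eq : 16 * Y' ^ 24 + u' ^ 8 * (u' ^ 8 + 1) = 0 := by
    have := congrArg ι hYeq
    rw [map_add, map_mul, map_pow, hιC, map_mul, map_add, map_pow, map_one, map_zero] at this
    have h16 : 16 * algebraMap K L (1 / 16) = 1 := by
      rw [← map_ofNat (algebraMap K L) 16, ← map_mul]; norm_num
    linear_combination 16 * this - u' ^ 8 * (u' ^ 8 + 1) * h16
  have hpt : IsWeberPoint r 24 ![1 / Y', u' / Y', algebraMap K L r * Y' ^ 2 / u'] :=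
    isWeberPoint_model hr hu'0 hY'0 hY'eq
  set φ := weberLift r 24 _ hpt
  have hφy : φ y = u' / Y' := weberLift_coord _ _ _ _ _
  have hφz : φ z = algebraMap K L r * Y' ^ 2 / u' := weberLift_coord _ _ _ _ _
  have hφY : φ Y = Y' := by
    rw [hYdef, map_mul, map_mul, hφy, hφz, φ.commutes, map_inv₀]
    calc _ = (algebraMap K L r)⁻¹ * algebraMap K L r * (u' * u'⁻¹) * (Y' * Y'⁻¹) * Y' := by ring
      _ = Y' := by
        rw [inv_mul_cancel₀ hr'0, mul_inv_cancel₀ hu'0, mul_inv_cancel₀ hY'0]; ring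
  have hφψ (G : D) : φ (ψ G) = ι G := by
    have : φ.toRingHom.comp ψ = ι := by
      apply AdjoinRoot.ringHom_ext
      · apply Polynomial.ringHom_ext
        · intro a
          simp only [RingHom.comp_apply, hψC, hιC]
          exact φ.commutes a
        · simp only [RingHom.comp_apply, hψu]
          change φ (y * Y) = u'
          rw [map_mul, hφy, hφY, div_mul_cancel₀ _ hY'0]
      · simp only [RingHom.comp_apply, hψY]
        exact hφY
    exact congrArg (fun g : D →+* L => g G) this
  -- the coordinate ring is a localization of the model
  set v := y * Y * Y with hv
  have hvu : IsUnit v := (huy.mul huY).mul huY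
  have hvψ : v = ψ (AdjoinRoot.of F Polynomial.X * AdjoinRoot.root F) := by
    rw [map_mul, hψu, hψY]
  have hxv : x * v = ψ (AdjoinRoot.of F Polynomial.X) := by
    rw [hψu, hv]; linear_combination y * Y * hxY
  have hyv : y * v = ψ (AdjoinRoot.of F Polynomial.X ^ 2) := by
    rw [map_pow, hψu, hv]; ring
  have hzv : z * v = ψ (AdjoinRoot.of F (Polynomial.C r) * AdjoinRoot.root F ^ 3) := by
    rw [map_mul, map_pow, hψY, hψC, hv]
    have : y * z = algebraMap K _ r * Y := by
      rw [hYdef]; linear_combination -(y * z) * hrr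
    linear_combination Y ^ 2 * this
  have hgen (i : Fin 3) : ∃ G, coord r 24 i * v = ψ G := by
    fin_cases i
    exacts [⟨_, hxv⟩, ⟨_, hyv⟩, ⟨_, hzv⟩]
  -- The unit `v` is the image of `uY`. Multiplication by `v` carries each coordinate function into
  -- the image of `ψ`, so a power of `v` clears the denominators of any `f`.
  have hsurj (f : WeberRing r 24) : ∃ (k : ℕ) (G : D), f * v ^ k = ψ G := by
    induction f using weberRing_induction with
    | hC a => exact ⟨0, _, by rw [pow_zero, mul_one, hψC]⟩
    | hadd f g hf hg =>
      obtain ⟨k, G, hG⟩ := hf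
      obtain ⟨l, G', hG'⟩ := hg
      refine ⟨k + l, G * (AdjoinRoot.of F Polynomial.X * AdjoinRoot.root F) ^ l +
        G' * (AdjoinRoot.of F Polynomial.X * AdjoinRoot.root F) ^ k, ?_⟩
      rw [map_add, map_mul, map_mul, map_pow ψ, map_pow ψ, ← hvψ, ← hG, ← hG']
      ring
    | hmul f i hf =>
      obtain ⟨k, G, hG⟩ := hf
      obtain ⟨G', hG'⟩ := hgen i
      refine ⟨k + 1, G * G', ?_⟩
      rw [map_mul, ← hG, ← hG']
      ring
  have : Nontrivial (WeberRing r 24) := φ.toRingHom.domain_nontrivial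
  have : NoZeroDivisors (WeberRing r 24) := by
    -- After clearing denominators, a zero product `fg` gives `ι (G * G') = 0` through `φ ∘ ψ = ι`.
    -- The model is a domain, so `G` or `G'` vanishes, and powers of `v` can be cancelled.
    refine ⟨fun {f g} hfg => ?_⟩
    obtain ⟨k, G, hG⟩ := hsurj f
    obtain ⟨l, G', hG'⟩ := hsurj g
    have h0 : G * G' = 0 := by
      apply hι
      rw [← hφψ, map_mul, ← hG, ← hG', map_zero,
        show f * v ^ k * (g * v ^ l) = f * g * v ^ (k + l) by ring, hfg, zero_mul, map_zero]
    rcases mul_eq_zero.1 h0 with h | h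
    · left
      rw [h, map_zero] at hG
      exact (hvu.pow k).mul_left_eq_zero.1 hG
    · right
      rw [h, map_zero] at hG'
      exact (hvu.pow l).mul_left_eq_zero.1 hG'
  exact NoZeroDivisors.to_isDomain _

end Domain

/-! ### Complex points of `W₂₄` -/

section ComplexPoints

variable {K : Type*} [Field K] [Algebra K ℂ] {r : K}

/-- Eliminating the third coordinate leaves the quadratic `w⁸T² + w¹⁶T + 16 = 0` for `T = y⁸`. Its
root is `(-w⁸ + s)/2` with `s² = w¹⁶ - 64/w⁸`, and the constant term keeps `y` away from zero. -/
lemma exists_isWeberPoint_complex (hr : r ^ 2 = 2) {w : ℂ} (hw : w ≠ 0) :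
    ∃ v : Fin 3 → ℂ, IsWeberPoint r 24 v ∧ v 0 = w := by
  have hR8 : algebraMap K ℂ r ^ 8 = 16 := by
    rw [← map_pow, pow_eight_of_sq_eq_two hr]; exact map_ofNat _ 16
  obtain ⟨s, hs⟩ := IsAlgClosed.exists_pow_nat_eq (w ^ 16 - 64 / w ^ 8) (n := 2) (by norm_num)
  obtain ⟨y, hy⟩ := IsAlgClosed.exists_pow_nat_eq ((-w ^ 8 + s) / 2) (n := 8) (by norm_num)
  have hq : w ^ 8 * (y ^ 8) ^ 2 + w ^ 16 * y ^ 8 + 16 = 0 := by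
    rw [hy]
    have hs' : w ^ 8 * s ^ 2 = w ^ 24 - 64 := by rw [hs]; field_simp
    linear_combination (1 / 4 : ℂ) * hs'
  have hy0 : y ≠ 0 := by
    rintro rfl
    norm_num at hq
  refine ⟨![w, y, algebraMap K ℂ r / (w * y)], ⟨?_, ?_⟩, rfl⟩
  · rw [if_pos (by norm_num)]
    simp only [Matrix.cons_val, Nat.reduceDiv, div_pow, mul_pow, hR8]
    field_simp
    linear_combination hq
  · simp only [Matrix.cons_val, weberConst]
    norm_num
    field_simp

/-- On complex points `x₀` takes every nonzero value, hence so does `x₀ᵐ`; a polynomial relation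
would have infinitely many roots. -/
lemma coord_pow_transcendental (hr : r ^ 2 = 2) {m : ℕ} (hm : 0 < m) {P : Polynomial K}
    (hP : Polynomial.aeval (coord r 24 0 ^ m) P = 0) : P = 0 := by
  rw [← Polynomial.map_eq_zero_iff (algebraMap K ℂ).injective]
  apply Polynomial.eq_zero_of_infinite_isRoot
  refine Set.Infinite.mono (s := {0}ᶜ) ?_ (Set.finite_singleton (0 : ℂ)).infinite_compl
  intro c hc
  obtain ⟨w, rfl⟩ := IsAlgClosed.exists_pow_nat_eq c hm
  have hw : w ≠ 0 := by
    rintro rfl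
    exact hc (zero_pow hm.ne')
  obtain ⟨v, hv, rfl⟩ := exists_isWeberPoint_complex hr hw
  have := congrArg (weberLift r 24 v hv) hP
  rw [← Polynomial.aeval_algHom_apply, map_pow, weberLift_coord, map_zero] at this
  rwa [Set.mem_ofPred_eq, Polynomial.IsRoot.def, Polynomial.eval_map_algebraMap]

/-- At a complex point with `x₀ = 1`, the eighth powers `Y, Z` of the other coordinates satisfy `Y +
Z = -1` and `YZ = 16`. If `Y³ = Z³`, then `Y = Z` because `Y² + YZ + Z² = -15`; but `(Y - Z)² =
-63`. -/
lemma coord_one_pow_ne_coord_two_pow (hr : r ^ 2 = 2) {m : ℕ} (hm : m ∣ 24) :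
    coord r 24 1 ^ m ≠ coord r 24 2 ^ m := by
  intro h
  obtain ⟨e, he⟩ := hm
  have h24 : coord r 24 1 ^ 24 = coord r 24 2 ^ 24 := by
    have (t : WeberRing r 24) : t ^ 24 = (t ^ m) ^ e := by rw [← pow_mul, ← he]
    rw [this, this, h]
  obtain ⟨v, hv, hv0⟩ := exists_isWeberPoint_complex (K := K) hr one_ne_zero
  have := congrArg (weberLift r 24 v hv) h24
  rw [map_pow, map_pow, weberLift_coord, weberLift_coord] at this
  have hR8 : algebraMap K ℂ r ^ 8 = 16 := by
    rw [← map_pow, pow_eight_of_sq_eq_two hr]; exact map_ofNat _ 16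
  obtain ⟨h1, h2⟩ := hv
  rw [if_pos (by norm_num), hv0] at h1
  norm_num at h1
  have h3 : v 1 ^ 8 * v 2 ^ 8 = 16 := by
    rw [← hR8, ← mul_pow, ← one_mul (v 1), ← hv0, h2]
    simp [weberConst]
  have h4 : (v 1 ^ 8) ^ 3 = (v 2 ^ 8) ^ 3 := by
    rw [← pow_mul, ← pow_mul]; exact this
  generalize v 1 ^ 8 = Y at *
  generalize v 2 ^ 8 = Z at *
  obtain rfl : Z = -1 - Y := by linear_combination h1
  have h5 : (2 * Y + 1) = 0 := by
    linear_combination (1 / 15 : ℂ) * ((2 * Y + 1) * (-1 : ℂ)) * h3 - (1 / 15 : ℂ) * h4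
  have h6 : (63 : ℂ) = 0 := by linear_combination -(2 * Y + 1) * h5 - 4 * h3
  norm_num at h6

end ComplexPoints

/-! ### The coordinate rings embed into that of `W₂₄` -/

section Embedding

variable {K : Type*} [Field K] {r : K}

lemma isWeberPoint_coord_pow (hr : r ^ 2 = 2) {m N : ℕ} (h : m * N = 24) :
    IsWeberPoint r N (fun i => coord r 24 i ^ m) := by
  have := (isWeberPoint_coord r N).map (pullback hr h.dvd)
  simp only [pullback_coord] at this
  rwa [h] at this

lemma isWeberPoint_swap (N : ℕ) :
    IsWeberPoint r N ![coord r N 0, coord r N 2, coord r N 1] := by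
  obtain ⟨h1, h2⟩ := isWeberPoint_coord r N
  refine ⟨?_, ?_⟩
  · simp only [Matrix.cons_val]
    split_ifs at h1 ⊢
    · rw [← h1]; ring
    · rw [← h1]; ring
  · simp only [Matrix.cons_val]
    rw [← h2]; ring

/-- A linear first equation eliminates `x₂ = s - x₀ - x₁`. The product relation then reads `x₀x₁² =
(s - x₀)x₀x₁ - d`, so powers of `x₁` reduce at the cost of powers of `x₀`. This applies to `N = 1`
and `N = 3`. -/
lemma exists_pow_mul_eq_aeval_add {N : ℕ} {s : K}
    (hs : coord r N 0 + coord r N 1 + coord r N 2 = algebraMap K _ s) (f : WeberRing r N) :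
    ∃ (k : ℕ) (P Q : Polynomial K), coord r N 0 ^ k * f =
      Polynomial.aeval (coord r N 0) P + Polynomial.aeval (coord r N 0) Q * coord r N 1 := by
  have hd := coord_rel₂ r N
  set d := weberConst r N
  induction f using weberRing_induction with
  | hC a => exact ⟨0, Polynomial.C a, 0, by simp⟩
  | hadd f g hf hg =>
    obtain ⟨k, P, Q, h⟩ := hf
    obtain ⟨l, P', Q', h'⟩ := hg
    refine ⟨k + l, Polynomial.X ^ l * P + Polynomial.X ^ k * P',
      Polynomial.X ^ l * Q + Polynomial.X ^ k * Q', ?_⟩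
    simp only [map_add, map_mul, map_pow, Polynomial.aeval_X]
    linear_combination coord r N 0 ^ l * h + coord r N 0 ^ k * h'
  | hmul f i hf =>
    obtain ⟨k, P, Q, h⟩ := hf
    fin_cases i
    · refine ⟨k, Polynomial.X * P, Polynomial.X * Q, ?_⟩
      simp only [map_mul, Polynomial.aeval_X, Fin.zero_eta]
      linear_combination coord r N 0 * h
    · refine ⟨k + 1, -(Polynomial.C d * Q), Polynomial.X * P +
        (Polynomial.C s * Polynomial.X - Polynomial.X ^ 2) * Q, ?_⟩
      simp only [map_add, map_sub, map_neg, map_mul, map_pow, Polynomial.aeval_X,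
        Polynomial.aeval_C, Fin.mk_one]
      linear_combination coord r N 0 * coord r N 1 * h - Polynomial.aeval (coord r N 0) Q * hd +
        Polynomial.aeval (coord r N 0) Q * coord r N 0 * coord r N 1 * hs
    · refine ⟨k + 1, Polynomial.C d * Q + (Polynomial.C s - Polynomial.X) * Polynomial.X * P,
        -(Polynomial.X * P), ?_⟩
      simp only [map_add, map_sub, map_neg, map_mul, Polynomial.aeval_X,
        Polynomial.aeval_C, Fin.reduceFinMk]
      linear_combination coord r N 0 * coord r N 2 * h + Polynomial.aeval (coord r N 0) Q * hd +
        Polynomial.aeval (coord r N 0) P * coord r N 0 * hs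

/-- A kernel element yields `P(x₀ᵐ) + Q(x₀ᵐ)x₁ᵐ = 0` on `W₂₄`. Exchanging `x₁` and `x₂` and
subtracting leaves `Q(x₀ᵐ)(x₁ᵐ - x₂ᵐ) = 0`, so `Q = 0`, and then `P = 0`, by transcendence of `x₀ᵐ`.
-/
lemma injective_of_coord_add_eq [Algebra K ℂ] (hr : r ^ 2 = 2) {m N : ℕ} (hm : m ∣ 24) {s : K}
    (hs : coord r N 0 + coord r N 1 + coord r N 2 = algebraMap K _ s)
    (φ : WeberRing r N →ₐ[K] WeberRing r 24) (hφ : ∀ i, φ (coord r N i) = coord r 24 i ^ m) :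
    Function.Injective φ := by
  have : CharZero K := (algebraMap K ℂ).charZero
  have : IsDomain (WeberRing r 24) := weberRing_isDomain hr
  have hm0 : 0 < m := Nat.pos_of_dvd_of_pos hm (by norm_num)
  rw [injective_iff_map_eq_zero]
  intro f hf
  obtain ⟨k, P, Q, h⟩ := exists_pow_mul_eq_aeval_add hs f
  have h1 := congrArg φ h
  rw [map_mul, hf, mul_zero, map_add, map_mul, ← Polynomial.aeval_algHom_apply,
    ← Polynomial.aeval_algHom_apply, hφ, hφ] at h1
  have h2 := congrArg (weberLift r 24 _ (isWeberPoint_swap 24)) h1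
  rw [map_zero, map_add, map_mul, ← Polynomial.aeval_algHom_apply,
    ← Polynomial.aeval_algHom_apply, map_pow, map_pow, weberLift_coord, weberLift_coord] at h2
  simp only [Matrix.cons_val] at h2
  have h3 : Polynomial.aeval (coord r 24 0 ^ m) Q * (coord r 24 1 ^ m - coord r 24 2 ^ m) = 0 := by
    linear_combination h2 - h1
  have hQ : Q = 0 := by
    refine coord_pow_transcendental hr hm0 ((mul_eq_zero.1 h3).resolve_right ?_)
    exact sub_ne_zero.2 (coord_one_pow_ne_coord_two_pow hr hm)
  subst hQ
  have hP : P = 0 := by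
    refine coord_pow_transcendental hr hm0 ?_
    simpa using h1.symm
  subst hP
  rw [map_zero, zero_mul, add_zero] at h
  exact ((isUnit_coord hr N 0).pow k).mul_right_eq_zero.1 h

/-! ### Modules spanned by monomials in two elements. -/

section Span

variable {A B : Type*} [CommRing A] [CommRing B] [Algebra A B]

/-- The span of the monomials `xⁱyʲ` with `i < n` and `j < k`. -/
def monomialSpan (A : Type*) {B : Type*} [CommRing A] [CommRing B] [Algebra A B] (n k : ℕ)
    (x y : B) : Submodule A B :=
  Submodule.span A (Set.range fun p : Fin n × Fin k => x ^ (p.1 : ℕ) * y ^ (p.2 : ℕ))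

lemma pow_mul_pow_mem_monomialSpan {n k : ℕ} (hn : 0 < n) (hk : 0 < k) {x y : B} {a b : A}
    (hx : algebraMap A B a = x ^ n) (hy : algebraMap A B b = y ^ k) (i j : ℕ) :
    x ^ i * y ^ j ∈ monomialSpan A n k x y := by
  have : x ^ i * y ^ j = (a ^ (i / n) * b ^ (j / k)) • (x ^ (i % n) * y ^ (j % k)) := by
    rw [Algebra.smul_def, map_mul, map_pow, map_pow, hx, hy, ← pow_mul, ← pow_mul,
      mul_mul_mul_comm, ← pow_add, ← pow_add, Nat.div_add_mod, Nat.div_add_mod]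
  rw [this]
  exact Submodule.smul_mem _ _
    (Submodule.subset_span ⟨(⟨i % n, Nat.mod_lt _ hn⟩, ⟨j % k, Nat.mod_lt _ hk⟩), rfl⟩)

lemma mul_pow_mul_pow_mem_monomialSpan {n k : ℕ} (hn : 0 < n) (hk : 0 < k) {x y : B} {a b : A}
    (hx : algebraMap A B a = x ^ n) (hy : algebraMap A B b = y ^ k) (i j : ℕ) {s : B}
    (hs : s ∈ monomialSpan A n k x y) : s * (x ^ i * y ^ j) ∈ monomialSpan A n k x y := by
  induction hs using Submodule.span_induction with
  | mem s hs =>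
    obtain ⟨p, rfl⟩ := hs
    simp only
    rw [mul_mul_mul_comm, ← pow_add, ← pow_add]
    exact pow_mul_pow_mem_monomialSpan hn hk hx hy _ _
  | zero => rw [zero_mul]; exact Submodule.zero_mem _
  | add s t _ _ hs ht => rw [add_mul]; exact Submodule.add_mem _ hs ht
  | smul c s _ hs => rw [smul_mul_assoc]; exact Submodule.smul_mem _ _ hs

end Span

/-- From `x₀x₁x₂ = κ` one gets `x₂ = κ^(1-n) x₂ⁿ (x₀x₁)^(n-1)`, and `x₂ⁿ` is a pullback; so `x₂` is
not needed in the generating monomials. -/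
lemma coord_two_eq_pullback_mul [CharZero K] (hr : r ^ 2 = 2) {n M : ℕ} (hn : 0 < n)
    (h : n * M ∣ 24) : ∃ a, coord r (n * M) 2 = pullback hr h a *
      (coord r (n * M) 0 ^ (n - 1) * coord r (n * M) 1 ^ (n - 1)) := by
  have hκ := coord_rel₂ r (n * M)
  have hκ0 := weberConst_ne_zero hr (n * M)
  set κ := weberConst r (n * M)
  refine ⟨algebraMap K _ (κ * (κ ^ n)⁻¹) * coord r M 2, ?_⟩
  rw [map_mul, pullback_coord, AlgHom.commutes, map_mul]
  have h1 : algebraMap K (WeberRing r (n * M)) κ ^ n * algebraMap K _ (κ ^ n)⁻¹ = 1 := by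
    rw [← map_pow, ← map_mul, mul_inv_cancel₀ (pow_ne_zero _ hκ0), map_one]
  generalize algebraMap K (WeberRing r (n * M)) (κ ^ n)⁻¹ = t at *
  rw [← hκ] at h1 ⊢
  generalize coord r (n * M) 0 = x at *
  generalize coord r (n * M) 1 = y at *
  generalize coord r (n * M) 2 = z at *
  have key : ∀ k : ℕ, 0 < k → (x * y * z) ^ k * t = 1 →
      z = x * y * z * t * z ^ k * (x ^ (k - 1) * y ^ (k - 1)) := by
    rintro (_ | l) hk h
    · exact absurd hk (lt_irrefl 0)
    · rw [Nat.add_sub_cancel]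
      calc z = z * ((x * y * z) ^ (l + 1) * t) := by rw [h, mul_one]
        _ = _ := by ring
  exact key n hn h1

/-- The monomials `x₀ⁱx₁ʲ` with `i, j < n` generate the coordinate ring of `W_{nM}` over that of
`W_M`. -/
lemma exists_eq_sum_pullback_mul [CharZero K] (hr : r ^ 2 = 2) {n M : ℕ} (hn : 0 < n)
    (h : n * M ∣ 24) (f : WeberRing r (n * M)) :
    ∃ g : Fin n × Fin n → WeberRing r M, ∑ p, pullback hr h (g p) *
      (coord r (n * M) 0 ^ (p.1 : ℕ) * coord r (n * M) 1 ^ (p.2 : ℕ)) = f := by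
  let _ : Algebra (WeberRing r M) (WeberRing r (n * M)) := (pullback hr h).toRingHom.toAlgebra
  have hx : algebraMap (WeberRing r M) (WeberRing r (n * M)) (coord r M 0) =
    coord r (n * M) 0 ^ n := pullback_coord hr h 0
  have hy : algebraMap (WeberRing r M) (WeberRing r (n * M)) (coord r M 1) =
    coord r (n * M) 1 ^ n := pullback_coord hr h 1
  have htop : f ∈ monomialSpan (WeberRing r M) n n (coord r (n * M) 0) (coord r (n * M) 1) := by
    induction f using weberRing_induction with
    | hC a =>
      have h0 := pow_mul_pow_mem_monomialSpan hn hn hx hy 0 0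
      have := Submodule.smul_mem _ (algebraMap K (WeberRing r M) a) h0
      rw [pow_zero, pow_zero, mul_one, Algebra.smul_def, mul_one] at this
      rwa [show algebraMap (WeberRing r M) (WeberRing r (n * M)) (algebraMap K _ a) =
        algebraMap K _ a from (pullback hr h).commutes a] at this
    | hadd f g hf hg => exact Submodule.add_mem _ hf hg
    | hmul f i hf =>
      fin_cases i
      · have := mul_pow_mul_pow_mem_monomialSpan hn hn hx hy 1 0 hf
        rwa [pow_one, pow_zero, mul_one] at this
      · have := mul_pow_mul_pow_mem_monomialSpan hn hn hx hy 0 1 hf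
        rwa [pow_one, pow_zero, one_mul] at this
      · obtain ⟨a, ha⟩ := coord_two_eq_pullback_mul hr hn h
        have := Submodule.smul_mem _ a
          (mul_pow_mul_pow_mem_monomialSpan hn hn hx hy (n - 1) (n - 1) hf)
        rw [Algebra.smul_def, mul_left_comm] at this
        exact ha.symm ▸ this
  obtain ⟨g, hg⟩ := Submodule.mem_span_range_iff_exists_fun _ |>.1 htop
  refine ⟨g, ?_⟩
  rw [← hg]
  exact Finset.sum_congr rfl fun p _ => (Algebra.smul_def (g p) _).symm

lemma isWeberPoint_scale {N : ℕ} {h : Fin 3 → K} (hprod : h 0 * h 1 * h 2 = 1)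
    (hh : if 3 ∣ N then ∀ i, h i ^ (N / 3) = h 0 ^ (N / 3) else ∀ i, h i ^ N = 1)
    {B : Type*} [CommRing B] [Algebra K B] {v : Fin 3 → B} (hv : IsWeberPoint r N v) :
    IsWeberPoint r N (fun i => algebraMap K B (h i) * v i) := by
  obtain ⟨h2, h3⟩ := hv
  refine ⟨?_, ?_⟩
  · split_ifs at hh h2 ⊢
    · simp only [mul_pow, ← map_pow, hh]
      rw [← mul_add, ← mul_add, h2, mul_zero]
    · simpa only [mul_pow, ← map_pow, hh, map_one, one_mul] using h2
  · beta_reduce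
    have := congrArg (algebraMap K B) hprod
    rw [map_mul, map_mul, map_one] at this
    linear_combination v 0 * v 1 * v 2 * this + h3

/-- The character `(a, b) ↦ aⁱbʲ` of `μ₈²`. -/
def monomialCharacter (B : Type*) [CommRing B] [Algebra K B] (i j : ℕ) :
    rootsOfUnity 8 K × rootsOfUnity 8 K →* B where
  toFun h := algebraMap K B (rootVal h.1 ^ i * rootVal h.2 ^ j)
  map_one' := by simp
  map_mul' a b := by
    rw [← map_mul, Prod.fst_mul, Prod.snd_mul, rootVal_mul, rootVal_mul]
    ring_nf

/-- Expand a kernel element in the monomials `x₀ⁱx₁ʲ` with `i, j < n` over the ring of `W_M`. The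
group `μ₈²` acts on `W₂₄`, fixing the image of that ring and scaling the images of the monomials by
distinct characters. Independence of characters makes each term vanish, and `x₀`, `x₁` are units. -/
lemma injective_of_pullback_injective [CharZero K] (hr : r ^ 2 = 2) {ζ : K}
    (hζ : IsPrimitiveRoot ζ 24) {m n M : ℕ} (hn : n ∣ 8) (hmn : 8 ∣ m * n) (h : n * M ∣ 24)
    (hmn' : m * n ∣ 24)
    (φ : WeberRing r (n * M) →ₐ[K] WeberRing r 24)
    (hφ : ∀ i, φ (coord r (n * M) i) = coord r 24 i ^ m)
    (hinj : Function.Injective (φ.comp (pullback hr h))) : Function.Injective φ := by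
  have : IsDomain (WeberRing r 24) := weberRing_isDomain hr
  have hn0 : 0 < n := Nat.pos_of_dvd_of_pos hn (by norm_num)
  -- a primitive root separating the characters
  have hω : ∃ ω : rootsOfUnity 8 K, IsPrimitiveRoot (rootVal ω ^ m) n := by
    have h8 : IsPrimitiveRoot (ζ ^ 3) 8 := hζ.pow (by norm_num) (by norm_num)
    obtain ⟨ω, hω⟩ := exists_rootVal_eq (m := 8) (by norm_num) h8.pow_eq_one
    refine ⟨ω, ?_⟩
    rw [hω]
    -- Write `8 = nc`. Then `m = cd` with `d ∣ 3`, and raising to the `d`-th power preserves the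
    -- order `n` of `ω^c`, since `n` divides `8`.
    obtain ⟨c, hc⟩ := hn
    have hc0 : 0 < c := Nat.pos_of_ne_zero (by rintro rfl; simp at hc)
    have hdvd : c ∣ m := by
      rw [hc, mul_comm] at hmn
      exact Nat.dvd_of_mul_dvd_mul_right hn0 hmn
    obtain ⟨d, rfl⟩ := hdvd
    have h9 : d ∣ 3 := by
      have : 8 * d ∣ 8 * 3 := by
        rw [hc]
        have e : n * c * 3 = 24 := by rw [← hc]
        rw [e]
        convert hmn' using 1
        ring
      exact Nat.dvd_of_mul_dvd_mul_left (by norm_num) this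
    have hcop : Nat.Coprime d n := by
      apply Nat.Coprime.coprime_dvd_left h9
      exact Nat.Coprime.coprime_dvd_right ⟨c, hc⟩ (by norm_num)
    rw [pow_mul]
    exact (h8.pow (by norm_num) (by rw [hc, mul_comm])).pow_of_coprime _ hcop
  obtain ⟨ω, hω⟩ := hω
  have hχ : Function.Injective fun p : Fin n × Fin n =>
      monomialCharacter (K := K) (WeberRing r 24) (m * p.1) (m * p.2) := by
    intro p q hpq
    have e1 := DFunLike.congr_fun hpq (ω, 1)
    have e2 := DFunLike.congr_fun hpq (1, ω)
    have hK : Function.Injective (algebraMap K (WeberRing r 24)) := (algebraMap K _).injective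
    simp only [monomialCharacter, MonoidHom.coe_mk, OneHom.coe_mk, hK.eq_iff, rootVal_one,
      one_pow, mul_one, one_mul, pow_mul] at e1 e2
    exact Prod.ext (Fin.ext (hω.pow_inj p.1.2 q.1.2 e1)) (Fin.ext (hω.pow_inj p.2.2 q.2.2 e2))
  have hli := (linearIndependent_monoidHom (rootsOfUnity 8 K × rootsOfUnity 8 K)
    (WeberRing r 24)).comp _ hχ
  rw [Fintype.linearIndependent_iff] at hli
  rw [injective_iff_map_eq_zero]
  intro f hf
  obtain ⟨g, rfl⟩ := exists_eq_sum_pullback_mul hr hn0 h f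
  have hscale (a b : rootsOfUnity 8 K) : IsWeberPoint r 24
      (fun i => algebraMap K _ ((![rootVal a, rootVal b, (rootVal a * rootVal b)⁻¹] :
        Fin 3 → K) i) * coord r 24 i) := by
    refine isWeberPoint_scale ?_ ?_ (isWeberPoint_coord r 24)
    · exact mul_inv_cancel₀ (mul_ne_zero (rootVal_ne_zero _) (rootVal_ne_zero _))
    · rw [if_pos (by norm_num)]
      intro i
      fin_cases i <;> simp [mul_pow, rootVal_pow_eq_one]
  have hg : ∀ p, φ (pullback hr h (g p)) *
      (coord r 24 0 ^ (m * p.1) * coord r 24 1 ^ (m * p.2)) = 0 := by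
    apply hli
    funext ⟨a, b⟩
    set s := weberLift r 24 _ (hscale a b) with hs
    -- Functions from `W_M` become polynomials in the `x_i^(mn)`, which are invariant because `8 ∣
    -- mn`.
    have hinv : s.comp (φ.comp (pullback hr h)) = φ.comp (pullback hr h) := by
      apply weberRing_algHom_ext
      intro i
      simp only [AlgHom.comp_apply, pullback_coord, map_pow, hφ]
      rw [hs, weberLift_coord, ← pow_mul, ← pow_mul, mul_pow, ← map_pow]
      obtain ⟨c, hc⟩ := hmn
      rw [hc, pow_mul _ 8 c]
      fin_cases i
      · simp [rootVal_pow_eq_one]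
      · simp [rootVal_pow_eq_one]
      · simp [mul_pow, rootVal_pow_eq_one]
    have := congrArg s hf
    rw [map_zero, map_sum, map_sum] at this
    simp only [Finset.sum_apply, Pi.smul_apply, Pi.zero_apply, smul_eq_mul, Function.comp_apply]
    rw [← this]
    refine Finset.sum_congr rfl fun p _ => ?_
    have e1 : s (φ (pullback hr h (g p))) = φ (pullback hr h (g p)) :=
      DFunLike.congr_fun hinv (g p)
    rw [map_mul, map_mul, map_mul, map_mul, map_pow φ, map_pow φ, hφ, hφ, ← pow_mul, ← pow_mul,
      map_pow, map_pow, e1, hs, weberLift_coord, weberLift_coord]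
    simp only [monomialCharacter, MonoidHom.coe_mk, OneHom.coe_mk, Matrix.cons_val, mul_pow,
      map_mul, map_pow]
    ring
  have hg0 : ∀ p, g p = 0 := by
    intro p
    apply hinj
    rw [AlgHom.comp_apply, map_zero]
    refine (IsUnit.mul_left_eq_zero ?_).1 (hg p)
    exact ((isUnit_coord hr 24 0).pow _).mul ((isUnit_coord hr 24 1).pow _)
  simp [hg0]

variable [Algebra K ℂ]

/-- The case `N = 3n` is reduced to `W₃`, and the case `N ∣ 8` to `W₁`; these are the two curves
with linear first equation. -/
theorem injective_to_weberRing_24 (hr : r ^ 2 = 2) {ζ : K} (hζ : IsPrimitiveRoot ζ 24) {m N : ℕ}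
    (h : m * N = 24) : Function.Injective (weberLift r N _ (isWeberPoint_coord_pow hr h)) := by
  have : CharZero K := (algebraMap K ℂ).charZero
  by_cases h3 : 3 ∣ N
  · obtain ⟨n, rfl⟩ := h3
    have hmn : m * n = 8 := by
      have : 3 * (m * n) = 3 * 8 := by rw [← h.trans (by norm_num : 24 = 3 * 8)]; ring
      exact Nat.eq_of_mul_eq_mul_left (by norm_num) this
    obtain ⟨N, hN⟩ : ∃ N, N = 3 * n := ⟨_, rfl⟩
    revert h
    rw [mul_comm 3 n]
    intro h
    refine injective_of_pullback_injective hr hζ (m := m) (Dvd.intro_left m hmn) hmn.symm.dvd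
      (Dvd.intro_left m h) (by rw [hmn]; norm_num) _ (fun i => weberLift_coord _ _ _ _ i) ?_
    refine injective_of_coord_add_eq hr (m := 8) (by norm_num) (s := 0) ?_ _ ?_
    · simpa using coord_rel₁ r 3
    · intro i
      rw [AlgHom.comp_apply, pullback_coord, map_pow, weberLift_coord, ← pow_mul, hmn]
  · have hN : N ∣ 8 := by
      have : Nat.Coprime N 3 := ((Nat.Prime.coprime_iff_not_dvd Nat.prime_three).2 h3).symm
      refine this.dvd_of_dvd_mul_left (n := 8) ?_
      exact Dvd.intro_left m h
    obtain ⟨N', hN'⟩ : ∃ N', N' = N * 1 := ⟨_, rfl⟩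
    -- The exponent is generalized so that `N * 1` can be substituted in the type of the coordinate
    -- ring.
    have key : ∀ N' (h' : m * N' = 24), N' = N * 1 →
        Function.Injective (weberLift r N' _ (isWeberPoint_coord_pow hr h')) := by
      rintro N' h' rfl
      refine injective_of_pullback_injective hr hζ (m := m) hN ?_ (Dvd.intro_left m h')
        (by rw [h]) _ (fun i => weberLift_coord _ _ _ _ i) ?_
      · rw [h]; norm_num
      · refine injective_of_coord_add_eq hr (m := 24) (by norm_num) (s := 48) ?_ _ ?_
        · have e : (algebraMap K (WeberRing r 1)) 48 = 48 := map_ofNat _ 48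
          rw [e]
          simpa using coord_rel₁ r 1
        · intro i
          rw [AlgHom.comp_apply, pullback_coord, map_pow, weberLift_coord, ← pow_mul, h]
    exact key N h (mul_one N).symm

theorem weberRing_isDomain_of_dvd (hr : r ^ 2 = 2) {ζ : K} (hζ : IsPrimitiveRoot ζ 24) {N : ℕ}
    (h : N ∣ 24) : IsDomain (WeberRing r N) := by
  have : CharZero K := (algebraMap K ℂ).charZero
  have : IsDomain (WeberRing r 24) := weberRing_isDomain hr
  obtain ⟨m, hm⟩ := h
  have h' : m * N = 24 := by rw [hm, mul_comm]
  exact (injective_to_weberRing_24 hr hζ h').isDomain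
    (weberLift r N _ (isWeberPoint_coord_pow hr h')).toRingHom

/-- Composed with the embedding of the ring of `W_{mn}` into that of `W₂₄`, the pullback is the
embedding of the ring of `W_n`. -/
theorem pullback_injective (hr : r ^ 2 = 2) {ζ : K} (hζ : IsPrimitiveRoot ζ 24) {m n : ℕ}
    (h : m * n ∣ 24) : Function.Injective (pullback hr h).toRingHom := by
  obtain ⟨e, he⟩ := h
  have h1 : e * (m * n) = 24 := by rw [he, mul_comm]
  have h2 : (e * m) * n = 24 := by rw [← h1, mul_assoc]
  have hcomp : (weberLift r (m * n) _ (isWeberPoint_coord_pow hr h1)).comp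
      (pullback hr (Dvd.intro _ he.symm)) = weberLift r n _ (isWeberPoint_coord_pow hr h2) := by
    apply weberRing_algHom_ext
    intro i
    rw [AlgHom.comp_apply, pullback_coord, map_pow, weberLift_coord, weberLift_coord, ← pow_mul]
  have hinj := injective_to_weberRing_24 hr hζ h2
  rw [← hcomp, AlgHom.coe_comp] at hinj
  exact hinj.of_comp

end Embedding

/-! ### Generalities on field extensions -/

section FieldExtensions

lemma finrank_le_of_adjoin_pair_eq_top {F L : Type*} [Field F] [Field L] [Algebra F L] {x t : L}
    {n k : ℕ} (hn : 0 < n) (hk : 0 < k) {a b : F} (hx : algebraMap F L a = x ^ n)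
    (ht : algebraMap F L b = t ^ k) (htop : IntermediateField.adjoin F {x, t} = ⊤) :
    FiniteDimensional F L ∧ Module.finrank F L ≤ n * k := by
  have halg : ∀ y ∈ ({x, t} : Set L), IsAlgebraic F y := by
    rintro y (rfl | rfl)
    · exact IsAlgebraic.of_pow hn (hx ▸ isAlgebraic_algebraMap a)
    · exact IsAlgebraic.of_pow hk (ht ▸ isAlgebraic_algebraMap b)
  have h1 := IntermediateField.adjoin_toSubalgebra_of_isAlgebraic halg
  rw [htop, IntermediateField.top_toSubalgebra] at h1
  have hspan : monomialSpan F n k x t = ⊤ := by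
    rw [eq_top_iff, ← Algebra.top_toSubmodule, h1, Algebra.adjoin_eq_span, Submodule.span_le]
    intro y hy
    obtain ⟨i, j, rfl⟩ := (Submonoid.mem_closure_pair _ _ _).1 hy
    exact pow_mul_pow_mem_monomialSpan hn hk hx ht i j
  refine ⟨⟨⟨(Set.finite_range fun p : Fin n × Fin k =>
    x ^ (p.1 : ℕ) * t ^ (p.2 : ℕ)).toFinset, ?_⟩⟩, ?_⟩
  · rw [Set.Finite.coe_toFinset]
    exact hspan
  · have := finrank_range_le_card (R := F)
      (fun p : Fin n × Fin k => x ^ (p.1 : ℕ) * t ^ (p.2 : ℕ))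
    rw [Set.finrank, show Submodule.span F (Set.range fun p : Fin n × Fin k =>
      x ^ (p.1 : ℕ) * t ^ (p.2 : ℕ)) = ⊤ from hspan, finrank_top] at this
    simpa using this

/-- If `a + b + c = 0` and the cubes of `a`, `b` and the product `abc` lie in a subfield containing
the cube roots of unity, so does `b / a`. -/
lemma div_mem_of_add_eq_zero {L : Type*} [Field L] {F : Subfield L} {a b c ω : L} (ha : a ≠ 0)
    (h : a + b + c = 0) (ha3 : a ^ 3 ∈ F) (hb3 : b ^ 3 ∈ F) (habc : a * b * c ∈ F) (hω : ω ∈ F)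
    (hω1 : ω ^ 2 + ω + 1 = 0) : b / a ∈ F := by
  set β := b / a with hβ
  have hb : b = β * a := by rw [hβ, div_mul_cancel₀ _ ha]
  have hc : c = (-1 - β) * a := by linear_combination h - hb
  set s := β * (-1 - β) with hs
  have hsF : s ∈ F := by
    have : s = a * b * c / a ^ 3 := by
      rw [hs, hb, hc]; field_simp
    rw [this]
    exact F.div_mem habc ha3
  have hβ3 : β ^ 3 ∈ F := by
    rw [hβ, div_pow]
    exact F.div_mem hb3 ha3
  have hcube : β ^ 3 = (1 - s) * β + s := by rw [hs]; ring
  -- The relation `β³ = (1 - s)β + s` determines `β` rationally unless `s = 1`; in that case `β² + β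
  -- + 1 = 0`, and `β` is one of the cube roots of unity already in `F`.
  by_cases h1 : s = 1
  · have : (β - ω) * (β - (-1 - ω)) = 0 := by
      linear_combination -hω1 - h1 + hs
    rcases mul_eq_zero.1 this with h0 | h0
    · rw [sub_eq_zero.1 h0]; exact hω
    · rw [sub_eq_zero.1 h0]; exact F.sub_mem (F.neg_mem F.one_mem) hω
  · have hne : 1 - s ≠ 0 := sub_ne_zero.2 (Ne.symm h1)
    have : β = (β ^ 3 - s) / (1 - s) := by
      rw [hcube]; field_simp; ring
    rw [this]
    exact F.div_mem (F.sub_mem hβ3 hsF) (F.sub_mem F.one_mem hsF)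

end FieldExtensions

/-! ### The cardinality of the Galois group -/

section Card

variable {K : Type*} [Field K]

lemma coverExp_dvd (m : ℕ) : coverExp m ∣ m := by
  by_cases h : 3 ∣ m
  · exact ⟨3, by rw [mul_comm]; exact (three_mul_coverExp h).symm⟩
  · rw [coverExp_of_not_dvd h]

lemma dvd_three_mul_coverExp (m : ℕ) : m ∣ 3 * coverExp m := by
  by_cases h : 3 ∣ m
  · rw [three_mul_coverExp h]
  · rw [coverExp_of_not_dvd h]; exact Dvd.intro_left 3 rfl

lemma card_rootsOfUnity_of_dvd {ζ : K} (hζ : IsPrimitiveRoot ζ 24) {m : ℕ} (hm : m ∣ 24) :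
    Nat.card (rootsOfUnity m K) = m := by
  obtain ⟨e, he⟩ := hm
  have : NeZero m := ⟨by rintro rfl; simp at he⟩
  exact (hζ.pow (by norm_num) (by rw [he, mul_comm]) : IsPrimitiveRoot (ζ ^ e) m).card_rootsOfUnity

/-- The triples `(a, ab, (a²b)⁻¹)` with `a ∈ μ_m` and `b ∈ μ_k` are distinct. Their `k`-th powers
all equal `aᵏ`, because `m ∣ 3k` gives `a^(3k) = 1`. -/
lemma mul_coverExp_le_card_coverGroup {ζ : K} (hζ : IsPrimitiveRoot ζ 24) {m : ℕ}
    (hm : m ∣ 24) : m * coverExp m ≤ Nat.card (coverGroup m K) := by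
  have hm0 : NeZero m := ⟨by rintro rfl; simp at hm⟩
  have hk := coverExp_dvd m
  have hle := rootsOfUnity_le_of_dvd (M := K) hk
  let f : rootsOfUnity m K × rootsOfUnity (coverExp m) K → coverGroup m K := fun p =>
    ⟨![p.1, p.1 * Subgroup.inclusion hle p.2, (p.1 ^ 2 * Subgroup.inclusion hle p.2)⁻¹], by
      have h1 : (Subgroup.inclusion hle p.2) ^ coverExp m = 1 := by
        rw [← map_pow, show p.2 ^ coverExp m = 1 from Subtype.ext p.2.2, map_one]
      have h2 : p.1 ^ (3 * coverExp m) = 1 := by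
        obtain ⟨c, hc⟩ := dvd_three_mul_coverExp m
        rw [hc, pow_mul, show p.1 ^ m = 1 from Subtype.ext p.1.2, one_pow]
      have h3 : ((p.1 ^ 2)⁻¹) ^ coverExp m = p.1 ^ coverExp m := by
        rw [inv_pow, ← pow_mul, inv_eq_iff_mul_eq_one, ← pow_add, ← h2]
        congr 1; ring
      refine ⟨?_, ?_⟩
      · simp only [Matrix.cons_val]
        rw [← mul_assoc, ← sq, mul_inv_cancel]
      · have : ∀ i, (![p.1, p.1 * Subgroup.inclusion hle p.2,
            (p.1 ^ 2 * Subgroup.inclusion hle p.2)⁻¹] : Fin 3 → _) i ^ coverExp m =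
            p.1 ^ coverExp m := by
          intro i
          fin_cases i
          · rfl
          · exact (mul_pow _ _ _).trans (by rw [h1, mul_one])
          · refine (congrArg (· ^ coverExp m) (mul_inv _ _)).trans ?_
            rw [mul_pow, h3, inv_pow, h1, inv_one, mul_one]
        intro i j
        rw [this, this]⟩
  have hf : Function.Injective f := by
    rintro ⟨a, b⟩ ⟨c, d⟩ h
    have h0 : a = c := congrFun (congrArg Subtype.val h) 0
    have h1 : a * Subgroup.inclusion hle b = c * Subgroup.inclusion hle d :=
      congrFun (congrArg Subtype.val h) 1
    subst h0
    rw [Prod.mk.injEq]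
    exact ⟨rfl, Subgroup.inclusion_injective hle (mul_left_cancel h1)⟩
  have := Nat.card_le_card_of_injective f hf
  rwa [Nat.card_prod, card_rootsOfUnity_of_dvd hζ hm,
    card_rootsOfUnity_of_dvd hζ (hk.trans hm)] at this

lemma coverGroup_three : coverGroup 3 K = diagonalGroup 3 K := by
  ext h
  rw [mem_coverGroup]
  constructor
  · rintro ⟨-, h2⟩
    refine ⟨h 0, funext fun i => ?_⟩
    simpa [coverExp] using h2 i 0
  · rintro ⟨a, rfl⟩
    refine ⟨?_, fun i j => rfl⟩
    have : a ^ 3 = 1 := Subtype.ext a.2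
    rw [← this, pow_three']

lemma coverGroup_of_dvd_eight {m : ℕ} (hm : m ∣ 8) : coverGroup m K = antidiagonalGroup m K := by
  have h3 : ¬ 3 ∣ m := fun h => by
    have := h.trans hm
    revert this; decide
  ext h
  rw [mem_coverGroup]
  constructor
  · rintro ⟨h1, -⟩
    refine ⟨h 0, h 1, funext fun i => ?_⟩
    fin_cases i
    · rfl
    · rfl
    · exact eq_inv_of_mul_eq_one_right h1
  · rintro ⟨a, b, rfl⟩
    refine ⟨by simp, fun i j => ?_⟩
    have hpow (x : rootsOfUnity m K) : x ^ m = 1 := Subtype.ext x.2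
    rw [coverExp_of_not_dvd h3, hpow, hpow]

end Card

/-! ### The cover is Galois -/

section Galois

variable {K : Type*} [Field K] {r : K}

lemma exists_mul_self_eq_of_not_dvd {n : ℕ} (hn : ¬ 3 ∣ n) : ∃ q, n * n = 3 * q + 1 := by
  have h : n % 3 = 1 ∨ n % 3 = 2 := by omega
  have h1 : n * n % 3 = 1 := by
    rcases h with h | h <;> simp [Nat.mul_mod, h]
  exact ⟨n * n / 3, by omega⟩

lemma pow_eight_sq_add_of_isPrimitiveRoot {K : Type*} [Field K] {ζ : K}
    (hζ : IsPrimitiveRoot ζ 24) : (ζ ^ 8) ^ 2 + ζ ^ 8 + 1 = 0 := by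
  have h8 : IsPrimitiveRoot (ζ ^ 8) 3 := hζ.pow (by norm_num) (by norm_num)
  have := h8.geom_sum_eq_zero (by norm_num)
  simp only [Finset.sum_range_succ, Finset.sum_range_zero] at this
  linear_combination this

/-- This is what a scaling needs in order to preserve the first equation: a common factor suffices
when the right side is zero, while the constant `48` requires the factor to be `1`. -/
lemma rootVal_pow_div_three {m : ℕ} (n : ℕ) {h : Fin 3 → rootsOfUnity m K}
    (hh : h ∈ coverGroup m K) :
    if 3 ∣ m * n then ∀ i, rootVal (h i) ^ (m * n / 3) = rootVal (h 0) ^ (m * n / 3)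
      else ∀ i, rootVal (h i) ^ (m * n) = 1 := by
  split_ifs with h3
  · by_cases hm : 3 ∣ m
    · have hk := three_mul_coverExp hm
      intro i
      have e : m * n / 3 = coverExp m * n := by
        rw [← hk, mul_assoc]
        simp [coverExp, hm]
      rw [e, pow_mul, pow_mul, ← rootVal_pow, hh.2 i 0, rootVal_pow]
    · have hn : 3 ∣ n := ((Nat.Prime.dvd_mul Nat.prime_three).1 h3).resolve_left hm
      intro i
      rw [Nat.mul_div_assoc m hn, pow_mul, pow_mul, rootVal_pow_eq_one, rootVal_pow_eq_one]
  · intro i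
    rw [pow_mul, rootVal_pow_eq_one, one_pow]

lemma rootVal_prod_eq_one {m : ℕ} {h : Fin 3 → rootsOfUnity m K} (hh : h ∈ coverGroup m K) :
    rootVal (h 0) * rootVal (h 1) * rootVal (h 2) = 1 := by
  rw [← rootVal_mul, ← rootVal_mul, hh.1, rootVal_one]

/-- The action of the Galois group on the coordinate ring of `W_{mn}`. -/
noncomputable def scaleHom (r : K) {m : ℕ} (n : ℕ) (h : coverGroup m K) :
    WeberRing r (m * n) →ₐ[K] WeberRing r (m * n) :=
  weberLift r (m * n) _ (isWeberPoint_scale (rootVal_prod_eq_one h.2)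
    (rootVal_pow_div_three n h.2) (isWeberPoint_coord r (m * n)))

@[simp]
lemma scaleHom_coord {m n : ℕ} (h : coverGroup m K) (i : Fin 3) :
    scaleHom r n h (coord r (m * n) i) =
      algebraMap K _ (rootVal (h.1 i)) * coord r (m * n) i :=
  weberLift_coord _ _ _ _ _

lemma scaleHom_comp_of_mul_eq_one {m n : ℕ} {h h' : coverGroup m K}
    (hh : h * h' = 1) : (scaleHom r n h).comp (scaleHom r n h') = AlgHom.id K _ := by
  apply weberRing_algHom_ext
  intro i
  rw [AlgHom.comp_apply, scaleHom_coord, map_mul, AlgHom.commutes, scaleHom_coord, ← mul_assoc,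
    ← map_mul, ← rootVal_mul, ← Pi.mul_apply, mul_comm h'.1 h.1]
  have : h.1 * h'.1 = 1 := congrArg Subtype.val hh
  rw [this]
  simp

/-- The action of the Galois group on the coordinate ring of `W_{mn}`, by automorphisms. -/
noncomputable def scaleEquiv (r : K) {m : ℕ} (n : ℕ) (h : coverGroup m K) :
    WeberRing r (m * n) ≃ₐ[K] WeberRing r (m * n) :=
  AlgEquiv.ofAlgHom (scaleHom r n h) (scaleHom r n h⁻¹)
    (scaleHom_comp_of_mul_eq_one (mul_inv_cancel h))
    (scaleHom_comp_of_mul_eq_one (inv_mul_cancel h))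

lemma scaleHom_pullback (hr : r ^ 2 = 2) {m n : ℕ} (hmn : m * n ∣ 24) (h : coverGroup m K)
    (f : WeberRing r n) : scaleHom r n h (pullback hr hmn f) = pullback hr hmn f := by
  have : (scaleHom r n h).comp (pullback hr hmn) = pullback hr hmn := by
    apply weberRing_algHom_ext
    intro i
    rw [AlgHom.comp_apply, pullback_coord, map_pow, scaleHom_coord, mul_pow, ← map_pow,
      rootVal_pow_eq_one, map_one, one_mul]
  exact DFunLike.congr_fun this f

lemma coordFun_mul (r : K) (N : ℕ) :
    coordFun r N 0 * coordFun r N 1 * coordFun r N 2 = algebraMap K _ (weberConst r N) := by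
  rw [coordFun, coordFun, coordFun, ← map_mul, ← map_mul, coord_rel₂,
    ← IsScalarTower.algebraMap_apply]

lemma coordFun_ne_zero [CharZero K] (hr : r ^ 2 = 2) {N : ℕ} [IsDomain (WeberRing r N)]
    (i : Fin 3) : coordFun r N i ≠ 0 :=
  ((isUnit_coord hr N i).map (algebraMap _ (WeberField r N))).ne_zero

/-! ### The extension of function fields. -/

section

variable (hr : r ^ 2 = 2) {m n : ℕ} (hmn : m * n ∣ 24) [IsDomain (WeberRing r n)]
  [IsDomain (WeberRing r (m * n))] (hinj : Function.Injective (pullback hr hmn).toRingHom)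

lemma algebraMap_pullback_mem (f : WeberRing r n) :
    algebraMap (WeberRing r (m * n)) (WeberField r (m * n)) (pullback hr hmn f) ∈
      pullbackField hr hmn hinj :=
  ⟨algebraMap (WeberRing r n) (WeberField r n) f, IsLocalization.map_eq _ f⟩

lemma algebraMap_mem_pullbackField (a : K) :
    algebraMap K (WeberField r (m * n)) a ∈ pullbackField hr hmn hinj := by
  have := algebraMap_pullback_mem hr hmn hinj (algebraMap K _ a)
  rwa [AlgHom.commutes] at this

lemma coordFun_pow_mem (i : Fin 3) :
    coordFun r (m * n) i ^ m ∈ pullbackField hr hmn hinj := by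
  have := algebraMap_pullback_mem hr hmn hinj (coord r n i)
  rwa [pullback_coord, map_pow] at this

lemma exists_eq_div_of_mem_pullbackField {f : WeberField r (m * n)}
    (hf : f ∈ pullbackField hr hmn hinj) : ∃ a b : WeberRing r n,
      f = algebraMap (WeberRing r (m * n)) _ (pullback hr hmn a) /
        algebraMap (WeberRing r (m * n)) _ (pullback hr hmn b) := by
  obtain ⟨g, rfl⟩ := hf
  obtain ⟨a, b, -, rfl⟩ := IsFractionRing.div_surjective (WeberRing r n) g
  refine ⟨a, b, ?_⟩
  rw [map_div₀]
  congr 1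
  · exact IsLocalization.map_eq _ a
  · exact IsLocalization.map_eq _ b

lemma exists_algEquiv_coordFun (h : coverGroup m K) :
    ∃ σ : WeberField r (m * n) ≃ₐ[pullbackField hr hmn hinj] WeberField r (m * n),
      ∀ i, σ (coordFun r (m * n) i) =
        algebraMap K _ (rootVal (h.1 i)) * coordFun r (m * n) i := by
  let ρ : WeberField r (m * n) ≃+* WeberField r (m * n) :=
    IsFractionRing.ringEquivOfRingEquiv (scaleEquiv r n h).toRingEquiv
  have hρ (a : WeberRing r (m * n)) : ρ (algebraMap _ _ a) =
      algebraMap _ _ (scaleHom r n h a) :=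
    IsFractionRing.ringEquivOfRingEquiv_algebraMap _ a
  refine ⟨AlgEquiv.ofRingEquiv (f := ρ) ?_, ?_⟩
  · rintro ⟨f, hf⟩
    obtain ⟨a, b, hab⟩ := exists_eq_div_of_mem_pullbackField hr hmn hinj hf
    change ρ f = f
    rw [hab, map_div₀, hρ, hρ, scaleHom_pullback, scaleHom_pullback]
  · intro i
    change ρ (coordFun r (m * n) i) = _
    rw [coordFun, hρ, scaleHom_coord, map_mul, ← IsScalarTower.algebraMap_apply]

lemma algEquiv_eq_of_coordFun
    {σ τ : WeberField r (m * n) ≃ₐ[pullbackField hr hmn hinj] WeberField r (m * n)}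
    (h : ∀ i, σ (coordFun r (m * n) i) = τ (coordFun r (m * n) i)) : σ = τ := by
  have key (f : WeberRing r (m * n)) : σ (algebraMap _ _ f) = τ (algebraMap _ _ f) := by
    induction f using weberRing_induction with
    | hC a =>
      rw [← IsScalarTower.algebraMap_apply]
      have ha := algebraMap_mem_pullbackField hr hmn hinj a
      exact (σ.commutes ⟨_, ha⟩).trans (τ.commutes ⟨_, ha⟩).symm
    | hadd f g hf hg => rw [map_add, map_add, map_add, hf, hg]
    | hmul f i hf =>
      rw [map_mul, map_mul, map_mul, hf]
      congr 1
      exact h i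
  ext f
  obtain ⟨a, b, -, rfl⟩ := IsFractionRing.div_surjective (WeberRing r (m * n)) f
  rw [map_div₀, map_div₀, key, key]

variable [CharZero K]

/-- The case `m = 3k` carries the content. The elements `x_i^(kn)` sum to zero, have cubes in the
subfield and have constant product, so `div_mem_of_add_eq_zero` puts `(x₁/x₀)^(kn)` in the subfield.
It also contains `(x₁/x₀)^(3k)`, and `3 ∤ n`. -/
lemma coordFun_div_pow_mem {ζ : K} (hζ : IsPrimitiveRoot ζ 24) :
    (coordFun r (m * n) 1 / coordFun r (m * n) 0) ^ coverExp m ∈ pullbackField hr hmn hinj := by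
  have hm1 : (coordFun r (m * n) 1 / coordFun r (m * n) 0) ^ m ∈ pullbackField hr hmn hinj := by
    rw [div_pow]
    exact Subfield.div_mem _ (coordFun_pow_mem hr hmn hinj 1) (coordFun_pow_mem hr hmn hinj 0)
  by_cases h3 : 3 ∣ m
  · have hk := three_mul_coverExp h3
    set k := coverExp m with hkdef
    have hn3 := not_three_dvd_of_mul_dvd hmn h3
    have hsum : coordFun r (m * n) 0 ^ (k * n) + coordFun r (m * n) 1 ^ (k * n) +
        coordFun r (m * n) 2 ^ (k * n) = 0 := by
      have h1 := coord_rel₁ r (m * n)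
      have e : m * n / 3 = k * n := by
        rw [← hk, mul_assoc, Nat.mul_div_cancel_left _ (by norm_num)]
      rw [if_pos (h3.mul_right n), e] at h1
      simp only [coordFun, ← map_pow, ← map_add, h1, map_zero]
    have hcube (i : Fin 3) : (coordFun r (m * n) i ^ (k * n)) ^ 3 ∈ pullbackField hr hmn hinj := by
      rw [← pow_mul, show k * n * 3 = m * n by rw [← hk]; ring, pow_mul]
      exact Subfield.pow_mem _ (coordFun_pow_mem hr hmn hinj i) n
    have hprod : coordFun r (m * n) 0 ^ (k * n) * coordFun r (m * n) 1 ^ (k * n) *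
        coordFun r (m * n) 2 ^ (k * n) ∈ pullbackField hr hmn hinj := by
      rw [← mul_pow, ← mul_pow, coordFun_mul, ← map_pow]
      exact algebraMap_mem_pullbackField hr hmn hinj _
    have hω := pow_eight_sq_add_of_isPrimitiveRoot hζ
    have hω' : algebraMap K (WeberField r (m * n)) (ζ ^ 8) ^ 2 +
        algebraMap K (WeberField r (m * n)) (ζ ^ 8) + 1 = 0 := by
      rw [← map_pow, ← map_one (algebraMap K (WeberField r (m * n))), ← map_add, ← map_add, hω,
        map_zero]
    have key := div_mem_of_add_eq_zero (pow_ne_zero _ (coordFun_ne_zero hr 0)) hsum (hcube 0)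
      (hcube 1) hprod (algebraMap_mem_pullbackField hr hmn hinj (ζ ^ 8)) hω'
    rw [← div_pow] at key
    set t := coordFun r (m * n) 1 / coordFun r (m * n) 0
    have ht : t ≠ 0 := div_ne_zero (coordFun_ne_zero hr 1) (coordFun_ne_zero hr 0)
    -- Since `n² = 3q + 1`, one has `kn² = mq + k`, which expresses `tᵏ` through `t^(kn)` and `tᵐ`.
    obtain ⟨q, hq⟩ := exists_mul_self_eq_of_not_dvd hn3
    have e : t ^ k = (t ^ (k * n)) ^ n / (t ^ m) ^ q := by
      rw [eq_div_iff (pow_ne_zero _ (pow_ne_zero _ ht)), ← pow_mul, ← pow_mul, ← pow_add]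
      congr 1
      rw [mul_assoc, hq, ← hk]
      ring
    rw [e]
    exact Subfield.div_mem _ (Subfield.pow_mem _ key n) (Subfield.pow_mem _ hm1 q)
  · rwa [coverExp_of_not_dvd h3]

lemma adjoin_coordFun_eq_top : IntermediateField.adjoin (pullbackField hr hmn hinj)
    {coordFun r (m * n) 0, coordFun r (m * n) 1 / coordFun r (m * n) 0} = ⊤ := by
  set E := IntermediateField.adjoin (pullbackField hr hmn hinj)
    {coordFun r (m * n) 0, coordFun r (m * n) 1 / coordFun r (m * n) 0}
  have hK (a : K) : algebraMap K (WeberField r (m * n)) a ∈ E :=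
    E.algebraMap_mem ⟨_, algebraMap_mem_pullbackField hr hmn hinj a⟩
  have h0 : coordFun r (m * n) 0 ∈ E := IntermediateField.subset_adjoin _ _ (Or.inl rfl)
  have ht : coordFun r (m * n) 1 / coordFun r (m * n) 0 ∈ E :=
    IntermediateField.subset_adjoin _ _ (Or.inr rfl)
  have n0 := coordFun_ne_zero (N := m * n) hr 0
  have n1 := coordFun_ne_zero (N := m * n) hr 1
  have h1 : coordFun r (m * n) 1 ∈ E := by
    rw [← div_mul_cancel₀ (coordFun r (m * n) 1) n0]
    exact E.mul_mem ht h0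
  have h2 : coordFun r (m * n) 2 ∈ E := by
    have : coordFun r (m * n) 2 = algebraMap K _ (weberConst r (m * n)) /
        (coordFun r (m * n) 0 * coordFun r (m * n) 1) := by
      rw [← coordFun_mul, mul_div_cancel_left₀ _ (mul_ne_zero n0 n1)]
    rw [this]
    exact E.div_mem (hK _) (E.mul_mem h0 h1)
  have hi (i : Fin 3) : coordFun r (m * n) i ∈ E := by
    fin_cases i
    exacts [h0, h1, h2]
  have key (f : WeberRing r (m * n)) : algebraMap _ (WeberField r (m * n)) f ∈ E := by
    induction f using weberRing_induction with
    | hC a => rw [← IsScalarTower.algebraMap_apply]; exact hK a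
    | hadd f g hf hg => rw [map_add]; exact E.add_mem hf hg
    | hmul f i hf => rw [map_mul]; exact E.mul_mem hf (hi i)
  rw [eq_top_iff]
  intro f _
  obtain ⟨a, b, -, rfl⟩ := IsFractionRing.div_surjective (WeberRing r (m * n)) f
  exact E.div_mem (key a) (key b)

theorem isGalois_and_exists_mulEquiv {ζ : K} (hζ : IsPrimitiveRoot ζ 24) :
    IsGalois (pullbackField hr hmn hinj) (WeberField r (m * n)) ∧
    (∃ e : coverGroup m K ≃*
        (WeberField r (m * n) ≃ₐ[pullbackField hr hmn hinj] WeberField r (m * n)),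
      (∀ (h : coverGroup m K) (i : Fin 3), e h (coordFun r (m * n) i) =
        rootVal (h.1 i) • coordFun r (m * n) i) ∧
      ∀ f : WeberField r (m * n), f ∈ pullbackField hr hmn hinj ↔ ∀ h, e h f = f) ∧
    Module.finrank (pullbackField hr hmn hinj) (WeberField r (m * n)) = m * coverExp m := by
  have hm : m ∣ 24 := (Dvd.intro _ rfl).trans hmn
  have hm0 : 0 < m := Nat.pos_of_dvd_of_pos hm (by norm_num)
  have hk0 : 0 < coverExp m := Nat.pos_of_dvd_of_pos (coverExp_dvd m) hm0
  obtain ⟨hfin, hle⟩ := finrank_le_of_adjoin_pair_eq_top hm0 hk0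
    (a := ⟨_, coordFun_pow_mem hr hmn hinj 0⟩) (b := ⟨_, coordFun_div_pow_mem hr hmn hinj hζ⟩)
    rfl rfl (adjoin_coordFun_eq_top hr hmn hinj)
  choose σ hσ using exists_algEquiv_coordFun hr hmn hinj
  let e : coverGroup m K →*
      (WeberField r (m * n) ≃ₐ[pullbackField hr hmn hinj] WeberField r (m * n)) :=
    MonoidHom.mk' σ (by
      intro h h'
      apply algEquiv_eq_of_coordFun
      intro i
      have hc : σ h (algebraMap K _ (rootVal (h'.1 i))) = algebraMap K _ (rootVal (h'.1 i)) :=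
        (σ h).commutes ⟨_, algebraMap_mem_pullbackField hr hmn hinj _⟩
      rw [AlgEquiv.mul_apply, hσ, hσ, map_mul, hσ, hc, ← mul_assoc, ← map_mul,
        mul_comm (rootVal (h'.1 i))]
      rfl)
  have he : Function.Injective e := by
    intro h h' hh
    apply Subtype.ext
    funext i
    apply rootVal_injective
    apply (algebraMap K (WeberField r (m * n))).injective
    apply mul_right_cancel₀ (coordFun_ne_zero (N := m * n) hr i)
    rw [← hσ, ← hσ]
    exact DFunLike.congr_fun hh _
  -- The chain `mk ≤ |H| ≤ |Aut| ≤ degree ≤ mk` closes up, so the extension is Galois and `e` is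
  -- bijective.
  have c1 := mul_coverExp_le_card_coverGroup hζ hm
  have c2 := Nat.card_le_card_of_injective e he
  have c3 := AlgEquiv.card_le (F := pullbackField hr hmn hinj) (K := WeberField r (m * n))
  rw [← Nat.card_eq_fintype_card] at c3
  have hgal : IsGalois (pullbackField hr hmn hinj) (WeberField r (m * n)) :=
    IsGalois.of_card_aut_eq_finrank _ _ (le_antisymm c3 (hle.trans (c1.trans c2)))
  have hbij : Function.Bijective e :=
    he.bijective_of_nat_card_le (c3.trans (hle.trans c1))
  refine ⟨hgal, ⟨MulEquiv.ofBijective e hbij, ?_, ?_⟩, le_antisymm hle (c1.trans (c2.trans c3))⟩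
  · intro h i
    rw [Algebra.smul_def]
    exact hσ h i
  · intro f
    have := IsGalois.mem_range_algebraMap_iff_fixed (F := pullbackField hr hmn hinj) f
    constructor
    · intro hf h
      exact this.1 ⟨⟨f, hf⟩, rfl⟩ _
    · intro hf
      obtain ⟨g, hg⟩ := this.2 (fun τ => by
        obtain ⟨h, rfl⟩ := hbij.2 τ
        exact hf h)
      rw [← hg]
      exact g.2

end

end Galois

/-! ### Rational points of the projective curves -/

section Points

variable {K : Type*} [Field K] {r : K}

/-- The equations of the projective Weber curve `W_N`. -/
def IsWeberVector (r : K) (N : ℕ) (v : Fin 4 → K) : Prop :=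
  (if 3 ∣ N then v 0 ^ (N / 3) + v 1 ^ (N / 3) + v 2 ^ (N / 3) = 0
    else v 0 ^ N + v 1 ^ N + v 2 ^ N = 48 * v 3 ^ N) ∧
  v 0 * v 1 * v 2 = weberConst r N * v 3 ^ 3

lemma eval_weberForm_iff (N : ℕ) (v : Fin 4 → K) :
    (eval v (weberForm₁ K N) = 0 ∧ eval v (weberForm₂ r N) = 0) ↔ IsWeberVector r N v := by
  unfold IsWeberVector weberForm₁ weberForm₂
  split_ifs <;> simp [sub_eq_zero]

lemma isWeberVector_smul {N : ℕ} {v : Fin 4 → K} (a : K) (hv : IsWeberVector r N v) :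
    IsWeberVector r N (a • v) := by
  obtain ⟨h1, h2⟩ := hv
  refine ⟨?_, ?_⟩
  · split_ifs at h1 ⊢
    · simp only [Pi.smul_apply, smul_eq_mul, mul_pow]
      rw [← mul_add, ← mul_add, h1, mul_zero]
    · simp only [Pi.smul_apply, smul_eq_mul, mul_pow]
      rw [← mul_add, ← mul_add, h1]; ring
  · simp only [Pi.smul_apply, smul_eq_mul]
    linear_combination a ^ 3 * h2

lemma mk_mem_weberCurve {N : ℕ} {v : Fin 4 → K} (hv : v ≠ 0) :
    Projectivization.mk K v hv ∈ weberCurve r N ↔ IsWeberVector r N v := by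
  refine (eval_weberForm_iff N _).trans ?_
  obtain ⟨a, ha⟩ := Projectivization.exists_smul_eq_mk_rep K v hv
  rw [← ha]
  refine ⟨fun h => ?_, fun h => isWeberVector_smul (a : K) h⟩
  have := isWeberVector_smul ((a⁻¹ : Kˣ) : K) h
  change IsWeberVector r N (a⁻¹ • a • v) at this
  rwa [inv_smul_smul] at this

lemma pow_ne_zero_of_ne_zero {v : Fin 4 → K} (hv : v ≠ 0) (m : ℕ) : (fun j => v j ^ m) ≠ 0 :=
  fun h => hv (funext fun j => eq_zero_of_pow_eq_zero (congrFun h j))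

lemma powMap_mk (m : ℕ) {v : Fin 4 → K} (hv : v ≠ 0) :
    powMap m (Projectivization.mk K v hv) =
      Projectivization.mk K (fun j => v j ^ m) (pow_ne_zero_of_ne_zero hv m) := rfl

/-- The vector `(h₀v₀, h₁v₁, h₂v₂, v₃)`. -/
def scaleVector {m : ℕ} (h : Fin 3 → rootsOfUnity m K) (v : Fin 4 → K) : Fin 4 → K :=
  ![rootVal (h 0) * v 0, rootVal (h 1) * v 1, rootVal (h 2) * v 2, v 3]

lemma rootAct_mk {m : ℕ} (h : Fin 3 → rootsOfUnity m K) {v : Fin 4 → K} (hv : v ≠ 0) :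
    ∃ hv', rootAct h (Projectivization.mk K v hv) =
      Projectivization.mk K (scaleVector h v) hv' := by
  have e : (LinearEquiv.piCongrRight fun j : Fin 4 => LinearEquiv.smulOfUnit (M := K)
      ((![(h 0 : Kˣ), (h 1 : Kˣ), (h 2 : Kˣ), 1] : Fin 4 → Kˣ) j)).toLinearMap v =
      scaleVector h v := by
    funext j
    fin_cases j
    · rfl
    · rfl
    · rfl
    · exact one_smul Kˣ (v 3)
  have hv' : scaleVector h v ≠ 0 := by
    rw [← e]
    exact (LinearEquiv.map_ne_zero_iff _).2 hv
  refine ⟨hv', ?_⟩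
  rw [rootAct, scaleMap, Projectivization.map_mk]
  congr 1

lemma weberConst_pow_div_three (hr : r ^ 2 = 2) {N : ℕ} (h3 : 3 ∣ N) (hN : N ∣ 24) :
    weberConst r N ^ (N / 3) = 16 := by
  obtain ⟨k, rfl⟩ := h3
  have hk : k ∣ 8 := Nat.dvd_of_mul_dvd_mul_left (by norm_num : 0 < 3) (by simpa using hN)
  rw [weberConst, if_pos ⟨k, rfl⟩, Nat.mul_div_cancel_left _ (by norm_num), ← pow_mul,
    Nat.div_mul_cancel hk, pow_eight_of_sq_eq_two hr]

lemma mul_div_three_eq {m n : ℕ} (h3 : 3 ∣ m) : m * n / 3 = coverExp m * n := by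
  rw [← three_mul_coverExp h3, mul_assoc, Nat.mul_div_cancel_left _ (by norm_num),
    three_mul_coverExp h3]

lemma isWeberVector_pow (hr : r ^ 2 = 2) {m n : ℕ} (h : m * n ∣ 24) {v : Fin 4 → K}
    (hv : IsWeberVector r (m * n) v) : IsWeberVector r n (fun j => v j ^ m) := by
  obtain ⟨h1, h2⟩ := hv
  refine ⟨?_, ?_⟩
  · split_ifs with h3
    · rw [if_pos (h3.mul_left m), Nat.mul_div_assoc m h3] at h1
      simpa only [← pow_mul] using h1
    · by_cases hm : 3 ∣ m
      · have hc := weberConst_pow_div_three hr (hm.mul_right n) h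
        rw [if_pos (hm.mul_right n)] at h1
        rw [mul_div_three_eq hm] at h1 hc
        have h4 := congrArg (· ^ (coverExp m * n)) h2
        simp only [mul_pow, hc] at h4
        have e (x : K) : (x ^ m) ^ n = (x ^ (coverExp m * n)) ^ 3 := by
          rw [← pow_mul, ← pow_mul]
          congr 1
          rw [← three_mul_coverExp hm, three_mul_coverExp hm]
          nth_rw 1 [← three_mul_coverExp hm]
          ring
        simp only [e]
        rw [pow_right_comm] at h4
        generalize v 0 ^ (coverExp m * n) = a at *
        generalize v 1 ^ (coverExp m * n) = b at *
        generalize v 2 ^ (coverExp m * n) = c at *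
        linear_combination (a ^ 2 + b ^ 2 + c ^ 2 - a * b - b * c - c * a) * h1 + 3 * h4
      · have : ¬ 3 ∣ m * n := by
          rw [Nat.Prime.dvd_mul Nat.prime_three]; tauto
        rw [if_neg this] at h1
        simpa only [← pow_mul] using h1
  · rw [← mul_pow, ← mul_pow, h2, mul_pow, weberConst_pow hr h, ← pow_mul, ← pow_mul, mul_comm m 3]

theorem mapsTo_powMap (hr : r ^ 2 = 2) {m n : ℕ} (h : m * n ∣ 24) :
    Set.MapsTo (powMap (K := K) m) (weberCurve r (m * n)) (weberCurve r n) := by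
  intro P hP
  induction P using Projectivization.ind with
  | h v hv =>
    rw [powMap_mk, mk_mem_weberCurve]
    exact isWeberVector_pow hr h ((mk_mem_weberCurve hv).1 hP)

/-- The form `a³ + b³ + c³ - 3abc` splits into the linear factors `a + θb + θ²c`, one for each cube
root of unity `θ`. -/
lemma exists_cube_root_add_eq_zero {a b c ω : K} (hω : ω ^ 2 + ω + 1 = 0)
    (h : a ^ 3 + b ^ 3 + c ^ 3 = 3 * (a * b * c)) :
    ∃ θ : K, θ ^ 3 = 1 ∧ a + θ * b + θ ^ 2 * c = 0 := by
  have hω3 : ω ^ 3 = 1 := by linear_combination (ω - 1) * hω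
  have : (a + b + c) * ((a + ω * b + ω ^ 2 * c) * (a + ω ^ 2 * b + ω * c)) = 0 := by
    linear_combination h + (a + b + c) * (b ^ 2 + c ^ 2 + b * c * ω) * hω3 +
      (a + b + c) * (a * b + a * c + b * c) * hω
  rcases mul_eq_zero.1 this with h0 | h0
  · exact ⟨1, by norm_num, by linear_combination h0⟩
  · rcases mul_eq_zero.1 h0 with h0 | h0
    · exact ⟨ω, hω3, h0⟩
    · exact ⟨ω ^ 2, by linear_combination (ω ^ 3 + 1) * hω3,
        by linear_combination h0 + c * ω * hω3⟩

lemma exists_pow_eq_one_mul_eq {x y : K} {m : ℕ} (hm : m ≠ 0) (h : x ^ m = y ^ m) :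
    ∃ θ : K, θ ^ m = 1 ∧ θ * x = y := by
  by_cases hx : x = 0
  · subst hx
    refine ⟨1, one_pow m, ?_⟩
    rw [zero_pow hm] at h
    rw [mul_zero]
    exact (eq_zero_of_pow_eq_zero h.symm).symm
  · exact ⟨y / x, by rw [div_pow, ← h, div_self (pow_ne_zero _ hx)], div_mul_cancel₀ _ hx⟩

lemma coverExp_mul_not_dvd {m n : ℕ} (h : m * n ∣ 24) (h3 : 3 ∣ m) : ¬ 3 ∣ coverExp m * n := by
  intro h'
  obtain ⟨c, hc⟩ := h'
  have : 9 ∣ m * n := ⟨c, by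
    rw [show 9 * c = 3 * (3 * c) by ring, ← hc, ← mul_assoc, three_mul_coverExp h3]⟩
  have := this.trans h
  revert this
  decide

theorem surjOn_powMap [IsAlgClosed K] (hr : r ^ 2 = 2) {ζ : K} (hζ : IsPrimitiveRoot ζ 24)
    {m n : ℕ} (h : m * n ∣ 24) :
    Set.SurjOn (powMap (K := K) m) (weberCurve r (m * n)) (weberCurve r n) := by
  have hm : m ≠ 0 := by rintro rfl; simp at h
  intro Q hQ
  induction Q using Projectivization.ind with
  | h w hw =>
    obtain ⟨h1, h2⟩ := (mk_mem_weberCurve hw).1 hQ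
    suffices hs : ∃ v, IsWeberVector r (m * n) v ∧ ∀ j, v j ^ m = w j by
      obtain ⟨v, hv, hvw⟩ := hs
      have hv0 : v ≠ 0 := by
        rintro rfl
        apply hw
        funext j
        rw [← hvw j]
        exact zero_pow hm
      refine ⟨Projectivization.mk K v hv0, (mk_mem_weberCurve hv0).2 hv, ?_⟩
      rw [powMap_mk]
      congr 1
      funext j
      exact hvw j
    have hy : ∀ j, ∃ y : K, y ^ m = w j := fun j =>
      IsAlgClosed.exists_pow_nat_eq (w j) (Nat.pos_of_ne_zero hm)
    choose y hy using hy
    -- Arbitrary `m`-th roots of the coordinates satisfy the product relation only up to an `m`-th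
    -- root of unity, which is absorbed into the first coordinate.
    obtain ⟨θ, hθ, hθ'⟩ := exists_pow_eq_one_mul_eq (x := y 0 * y 1 * y 2)
      (y := weberConst r (m * n) * y 3 ^ 3) hm (by
        rw [mul_pow, mul_pow, mul_pow, weberConst_pow hr h, pow_right_comm, hy, hy, hy, hy, h2])
    by_cases h3 : 3 ∣ m
    · have hn3 := not_three_dvd_of_mul_dvd h h3
      rw [if_neg hn3] at h1
      have hω := pow_eight_sq_add_of_isPrimitiveRoot hζ
      have hkn := mul_div_three_eq (n := n) h3
      have hc := weberConst_pow_div_three hr (h3.mul_right n) h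
      rw [hkn] at hc
      have e (x : K) : (x ^ (coverExp m * n)) ^ 3 = (x ^ m) ^ n := by
        rw [← pow_mul, ← pow_mul]
        congr 1
        nth_rw 2 [← three_mul_coverExp h3]
        ring
      have hprod := congrArg (· ^ (coverExp m * n)) hθ'
      simp only [mul_pow, hc] at hprod
      rw [pow_right_comm _ 3] at hprod
      -- The identity `48 = 3 * 16` turns the equation of `W_n` into vanishing of `a³ + b³ + c³ -
      -- 3abc`.
      obtain ⟨φ, hφ3, hφ⟩ := exists_cube_root_add_eq_zero
        (a := (θ * y 0) ^ (coverExp m * n)) (b := y 1 ^ (coverExp m * n))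
        (c := y 2 ^ (coverExp m * n)) hω (by
          have e0 := e (θ * y 0)
          have e1 := e (y 1)
          have e2 := e (y 2)
          have e3 := e (y 3)
          rw [mul_pow θ (y 0) m, hθ, one_mul, hy] at e0
          rw [hy] at e1 e2 e3
          rw [e0, e1, e2, h1, ← e3]
          rw [mul_pow]
          linear_combination -3 * hprod)
      -- As `f² ≡ 1` modulo `3`, the cube root of unity `ψ = φ^f` satisfies `ψ^f = φ`. Multiplying
      -- the second and third coordinates by `ψ` and `ψ²` makes the chosen linear factor into the
      -- first equation, without changing the product or the `m`-th powers.
      obtain ⟨q, hq⟩ := exists_mul_self_eq_of_not_dvd (coverExp_mul_not_dvd h h3)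
      set f := coverExp m * n with hf
      have hψ3 : (φ ^ f) ^ 3 = 1 := by rw [pow_right_comm, hφ3, one_pow]
      have hψf : (φ ^ f) ^ f = φ := by
        rw [← pow_mul, hq, pow_add, pow_mul, hφ3, one_pow, one_mul, pow_one]
      have hψm : (φ ^ f) ^ m = 1 := by
        obtain ⟨c, rfl⟩ := h3
        rw [pow_mul _ 3, hψ3, one_pow]
      refine ⟨![θ * y 0, φ ^ f * y 1, (φ ^ f) ^ 2 * y 2, y 3], ⟨?_, ?_⟩, ?_⟩
      · rw [if_pos (h3.mul_right n), hkn]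
        simp only [Matrix.cons_val]
        rw [mul_pow (φ ^ f), mul_pow ((φ ^ f) ^ 2), pow_right_comm _ 2, hψf]
        exact hφ
      · simp only [Matrix.cons_val]
        rw [← hθ']
        linear_combination θ * y 0 * y 1 * y 2 * hψ3
      · intro j
        fin_cases j
        · exact (mul_pow _ _ _).trans (by rw [hθ, one_mul]; exact hy 0)
        · exact (mul_pow _ _ _).trans (by rw [hψm, one_mul]; exact hy 1)
        · exact (mul_pow _ _ _).trans (by rw [pow_right_comm, hψm, one_pow, one_mul]; exact hy 2)
        · exact hy 3
    · have hpow : ∀ j, (![θ * y 0, y 1, y 2, y 3] : Fin 4 → K) j ^ m = w j := by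
        intro j
        fin_cases j
        · exact (mul_pow _ _ _).trans (by rw [hθ, one_mul]; exact hy 0)
        · exact hy 1
        · exact hy 2
        · exact hy 3
      refine ⟨![θ * y 0, y 1, y 2, y 3], ⟨?_, ?_⟩, hpow⟩
      · by_cases hn3 : 3 ∣ n
        · rw [if_pos (hn3.mul_left m), Nat.mul_div_assoc m hn3]
          rw [if_pos hn3] at h1
          simp only [pow_mul, hpow, h1]
        · have : ¬ 3 ∣ m * n := by
            rw [Nat.Prime.dvd_mul Nat.prime_three]; tauto
          rw [if_neg this]
          rw [if_neg hn3] at h1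
          simp only [pow_mul, hpow, h1]
      · simp only [Matrix.cons_val]
        rw [← hθ']; ring

/-! ### Fibres of the cover -/

lemma pow_coverExp_eq_one {m n : ℕ} (h : m * n ∣ 24) {x : K} (hm : x ^ m = 1)
    (hx : 3 ∣ m → x ^ (coverExp m * n) = 1) : x ^ coverExp m = 1 := by
  by_cases h3 : 3 ∣ m
  · obtain ⟨q, hq⟩ := exists_mul_self_eq_of_not_dvd (not_three_dvd_of_mul_dvd h h3)
    have h1 : x ^ (coverExp m * n * n) = 1 := by rw [pow_mul, hx h3, one_pow]
    have e : coverExp m * n * n = m * q + coverExp m := by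
      rw [mul_assoc, hq]
      nth_rw 2 [← three_mul_coverExp h3]
      ring
    rwa [e, pow_add, pow_mul, hm, one_pow, one_mul] at h1
  · rwa [coverExp_of_not_dvd h3]

lemma eq_of_cube_eq_one_of_mul_eq_one {x y z : K} (hx : x ^ 3 = 1) (h : x * y * z = 1)
    (hxy : x = y) : y = z := by
  subst hxy
  have hx0 : x ≠ 0 := by rintro rfl; norm_num at hx
  apply mul_left_cancel₀ (mul_ne_zero hx0 hx0)
  rw [h, ← hx]; ring

/-- For distinct cube roots of unity with product `1`, `γ = -α - β`. Eliminating `c` gives `(2α +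
β)a = -(α + 2β)b`, where the coefficients `2α + β` and `-(α + 2β)` have the same nonzero cube. -/
lemma cube_eq_cube {a b c α β γ : K} (h : a + b + c = 0) (h' : α * a + β * b + γ * c = 0)
    (hα : α ^ 3 = 1) (hβ : β ^ 3 = 1) (hγ : γ ^ 3 = 1) (hprod : α * β * γ = 1) (hab : α ≠ β) :
    a ^ 3 = b ^ 3 := by
  have hα0 : α ≠ 0 := by rintro rfl; norm_num at hα
  have hβ0 : β ≠ 0 := by rintro rfl; norm_num at hβ
  have h1 : α ^ 2 + α * β + β ^ 2 = 0 := by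
    have : (α - β) * (α ^ 2 + α * β + β ^ 2) = 0 := by linear_combination hα - hβ
    exact (mul_eq_zero.1 this).resolve_left (sub_ne_zero.2 hab)
  have hs : α * β * (α + β) = -1 := by linear_combination β * h1 - hβ
  have hγ' : γ = -α - β := by
    have e1 : α * β * (γ + α + β) = 0 := by linear_combination hprod + hs
    linear_combination (mul_eq_zero.1 e1).resolve_left (mul_ne_zero hα0 hβ0)
  have hγα : α - γ ≠ 0 := fun e =>
    hab ((eq_of_cube_eq_one_of_mul_eq_one hγ (by rw [← hprod]; ring) (sub_eq_zero.1 e).symm))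
  obtain rfl : c = -a - b := by linear_combination h
  subst hγ'
  apply mul_left_cancel₀ (pow_ne_zero 3 hγα)
  have e2 : (α - (-α - β)) * a = -((α + 2 * β) * b) := by linear_combination h'
  have e3 : (α - (-α - β)) ^ 3 = -(α + 2 * β) ^ 3 := by
    linear_combination 9 * hα + 9 * hβ + 18 * hs
  rw [← mul_pow, e2, e3]; ring

/-- Three cube roots of unity with product `1` are either all equal or pairwise distinct. In the
second case the two linear equations determine `(a : b : c)`, whose coordinates have equal cubes. -/
lemma eq_or_cube_eq {a b c α β γ : K} (h : a + b + c = 0) (h' : α * a + β * b + γ * c = 0)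
    (hα : α ^ 3 = 1) (hβ : β ^ 3 = 1) (hγ : γ ^ 3 = 1) (hprod : α * β * γ = 1) :
    (α = β ∧ β = γ) ∨ (a ^ 3 = b ^ 3 ∧ b ^ 3 = c ^ 3) := by
  have hprod' : β * γ * α = 1 := by rw [← hprod]; ring
  by_cases hab : α = β
  · exact Or.inl ⟨hab, eq_of_cube_eq_one_of_mul_eq_one hα hprod hab⟩
  by_cases hbc : β = γ
  · have := eq_of_cube_eq_one_of_mul_eq_one hβ hprod' hbc
    exact absurd (this.symm.trans hbc.symm) hab
  · exact Or.inr ⟨cube_eq_cube h h' hα hβ hγ hprod hab, cube_eq_cube (c := a)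
      (by rw [← h]; ring) (by rw [← h']; ring) hβ hγ hα hprod' hbc⟩

end Points

/-! ### Orbits of the Galois group on rational fibres. -/

section Fibres

variable {K : Type*} [Field K] {r : K}

lemma isWeberVector_scaleVector {m n : ℕ} {h : Fin 3 → rootsOfUnity m K} (hh : h ∈ coverGroup m K)
    {v : Fin 4 → K} (hv : IsWeberVector r (m * n) v) :
    IsWeberVector r (m * n) (scaleVector h v) := by
  obtain ⟨h1, h2⟩ := hv
  have hp := rootVal_pow_div_three n hh
  refine ⟨?_, ?_⟩
  · split_ifs at h1 hp ⊢
    · simp only [scaleVector, Matrix.cons_val, mul_pow, hp 1, hp 2]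
      rw [← mul_add, ← mul_add, h1, mul_zero]
    · simp only [scaleVector, Matrix.cons_val, mul_pow, hp, one_mul]
      exact h1
  · simp only [scaleVector, Matrix.cons_val]
    linear_combination h2 + v 0 * v 1 * v 2 * rootVal_prod_eq_one hh

theorem rootAct_mem_and_powMap_rootAct {m n : ℕ} {h : Fin 3 → rootsOfUnity m K}
    (hh : h ∈ coverGroup m K) {P : ℙ K (Fin 4 → K)} (hP : P ∈ weberCurve r (m * n)) :
    rootAct h P ∈ weberCurve r (m * n) ∧ powMap m (rootAct h P) = powMap m P := by
  induction P using Projectivization.ind with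
  | h v hv =>
    obtain ⟨hv', e⟩ := rootAct_mk h hv
    rw [e, mk_mem_weberCurve, powMap_mk, powMap_mk]
    refine ⟨isWeberVector_scaleVector hh ((mk_mem_weberCurve hv).1 hP), ?_⟩
    congr 1
    funext j
    fin_cases j
    · exact (mul_pow _ _ _).trans (by rw [rootVal_pow_eq_one, one_mul]; rfl)
    · exact (mul_pow _ _ _).trans (by rw [rootVal_pow_eq_one, one_mul]; rfl)
    · exact (mul_pow _ _ _).trans (by rw [rootVal_pow_eq_one, one_mul]; rfl)
    · rfl

/-- At such a point all three powers equal `16 X₃ⁿ`, and `X₀X₁X₂` times the first gradient equals `n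
X₀ⁿ` times the second; the coefficient `X₀X₁X₂` is nonzero. -/
lemma not_isNonsingularAt [CharZero K] (hr : r ^ 2 = 2) {n : ℕ} (hn : n ≠ 0) (h3 : ¬ 3 ∣ n)
    {u : Fin 4 → K} (hu0 : u ≠ 0) (hu : IsWeberVector r n u) (hu3 : u 3 ≠ 0)
    (h01 : u 0 ^ n = u 1 ^ n) (h12 : u 1 ^ n = u 2 ^ n) :
    ¬ IsNonsingularAt r n (Projectivization.mk K u hu0) := by
  obtain ⟨t, ht⟩ := Projectivization.exists_smul_eq_mk_rep K u hu0
  unfold IsNonsingularAt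
  have hw : IsWeberVector r n (Projectivization.mk K u hu0).rep := by
    rw [← ht]; exact isWeberVector_smul (t : K) hu
  have hw3 : (Projectivization.mk K u hu0).rep 3 ≠ 0 := by
    rw [← ht]; exact mul_ne_zero t.ne_zero hu3
  have hw01 : (Projectivization.mk K u hu0).rep 0 ^ n =
      (Projectivization.mk K u hu0).rep 1 ^ n := by
    rw [← ht]
    change ((t : K) * u 0) ^ n = ((t : K) * u 1) ^ n
    rw [mul_pow, mul_pow, h01]
  have hw12 : (Projectivization.mk K u hu0).rep 1 ^ n =
      (Projectivization.mk K u hu0).rep 2 ^ n := by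
    rw [← ht]
    change ((t : K) * u 1) ^ n = ((t : K) * u 2) ^ n
    rw [mul_pow, mul_pow, h12]
  generalize (Projectivization.mk K u hu0).rep = w at *
  obtain ⟨h1, h2⟩ := hw
  rw [if_neg h3] at h1
  have hS : w 0 ^ n = 16 * w 3 ^ n := by
    have : (3 : K) * (w 0 ^ n) = 3 * (16 * w 3 ^ n) := by
      linear_combination h1 + 2 * hw01 + hw12
    exact mul_left_cancel₀ (by norm_num) this
  have hxyz : w 0 * w 1 * w 2 ≠ 0 := by
    rw [h2]
    exact mul_ne_zero (weberConst_ne_zero hr n) (pow_ne_zero _ hw3)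
  have h0 : w 0 ≠ 0 := fun e => hxyz (by rw [e]; ring)
  have h1' : w 1 ≠ 0 := fun e => hxyz (by rw [e]; ring)
  have h2' : w 2 ≠ 0 := fun e => hxyz (by rw [e]; ring)
  have hpow : ∀ j, w j ^ (n - 1) * w j = w j ^ n := fun j => pow_sub_one_mul hn _
  intro hli
  rw [LinearIndependent.pair_iff] at hli
  refine hxyz (hli (w 0 * w 1 * w 2) (-(n * w 0 ^ n)) ?_).1
  funext j
  simp only [weberForm₁, weberForm₂, if_neg h3, Pi.add_apply, Pi.smul_apply, smul_eq_mul,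
    Pi.zero_apply, map_add, map_sub, Derivation.leibniz, Derivation.leibniz_pow, pderiv_X,
    pderiv_C, nsmul_eq_mul, map_mul, map_pow, eval_X, eval_C, map_natCast]
  fin_cases j
  · simp
    apply mul_right_cancel₀ h0
    linear_combination (w 0 * w 1 * w 2 * n) * hpow 0
  · simp
    apply mul_right_cancel₀ h1'
    linear_combination (w 0 * w 1 * w 2 * n) * (hpow 1 - hw01)
  · simp
    apply mul_right_cancel₀ h2'
    linear_combination (w 0 * w 1 * w 2 * n) * (hpow 2 - hw01 - hw12)
  · simp
    apply mul_right_cancel₀ hw3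
    linear_combination (-48 * w 0 * w 1 * w 2 * n) * hpow 3 - 3 * n * w 0 ^ n * h2 +
      3 * n * w 0 * w 1 * w 2 * hS

/-- The coordinate quotients are `m`-th roots of unity of product `1`. If `3 ∣ m`, the equations of
both points give two linear relations among the powers `v_i^(kn)`; by `eq_or_cube_eq` the quotients
have equal `kn`-th powers unless the image is one of the points excluded by `hns`. -/
lemma exists_scaleVector_eq [CharZero K] (hr : r ^ 2 = 2) {m n : ℕ} (hmn : m * n ∣ 24)
    {v w : Fin 4 → K} (hv : IsWeberVector r (m * n) v) (hw : IsWeberVector r (m * n) w)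
    (hv3 : v 3 = 1) (hw3 : w 3 = 1) (hvw : ∀ j, v j ^ m = w j ^ m)
    (hns : 3 ∣ m → ¬ ((v 0 ^ m) ^ n = (v 1 ^ m) ^ n ∧ (v 1 ^ m) ^ n = (v 2 ^ m) ^ n)) :
    ∃ h ∈ coverGroup m K, scaleVector h v = w := by
  have hm : m ≠ 0 := by rintro rfl; simp at hmn
  obtain ⟨hv1, hv2⟩ := hv
  obtain ⟨hw1, hw2⟩ := hw
  rw [hv3, one_pow, mul_one] at hv2
  rw [hw3, one_pow, mul_one] at hw2
  have hxyz : v 0 * v 1 * v 2 ≠ 0 := by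
    rw [hv2]; exact weberConst_ne_zero hr _
  have hex : ∀ j, ∃ y : rootsOfUnity m K, rootVal y * v j = w j := fun j => by
    obtain ⟨θ, hθ, e⟩ := exists_pow_eq_one_mul_eq hm (hvw j)
    obtain ⟨y, rfl⟩ := exists_rootVal_eq hm hθ
    exact ⟨y, e⟩
  choose y hy using hex
  have hprod : rootVal (y 0) * rootVal (y 1) * rootVal (y 2) = 1 := by
    apply mul_right_cancel₀ hxyz
    have : rootVal (y 0) * v 0 * (rootVal (y 1) * v 1) * (rootVal (y 2) * v 2) =
        v 0 * v 1 * v 2 := by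
      rw [hy, hy, hy, hv2, hw2]
    linear_combination this
  have hdiv : 3 ∣ m → ∀ i j : Fin 3, (rootVal (y i.castSucc) / rootVal (y j.castSucc)) ^
      (coverExp m * n) = 1 := by
    intro h3
    have h3' := h3.mul_right n
    rw [if_pos h3', mul_div_three_eq h3] at hv1 hw1
    rw [← hy 0, ← hy 1, ← hy 2, mul_pow, mul_pow, mul_pow] at hw1
    have e3 (x : K) : (x ^ (coverExp m * n)) ^ 3 = (x ^ m) ^ n := by
      rw [← pow_mul, ← pow_mul]
      congr 1
      nth_rw 2 [← three_mul_coverExp h3]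
      ring
    have hy3 (j) : (rootVal (y j) ^ (coverExp m * n)) ^ 3 = 1 := by
      rw [e3, rootVal_pow_eq_one, one_pow]
    rcases eq_or_cube_eq hv1 hw1 (hy3 0) (hy3 1) (hy3 2)
      (by rw [← mul_pow, ← mul_pow, hprod, one_pow]) with ⟨h01, h12⟩ | h
    · have hall : ∀ i : Fin 3, rootVal (y i.castSucc) ^ (coverExp m * n) =
          rootVal (y 0) ^ (coverExp m * n) := by
        intro i
        fin_cases i
        · rfl
        · exact h01.symm
        · exact (h01.trans h12).symm
      intro i j
      rw [div_pow, hall i, hall j, div_self (pow_ne_zero _ (rootVal_ne_zero _))]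
    · simp only [e3] at h
      exact absurd h (hns h3)
  refine ⟨fun i => y i.castSucc, ⟨?_, fun i j => ?_⟩, ?_⟩
  · apply rootVal_injective
    rw [rootVal_mul, rootVal_mul, rootVal_one]
    exact hprod
  · apply rootVal_injective
    rw [rootVal_pow, rootVal_pow]
    have := pow_coverExp_eq_one (n := n) hmn
      (x := rootVal (y i.castSucc) / rootVal (y j.castSucc))
      (by rw [div_pow, rootVal_pow_eq_one, rootVal_pow_eq_one, div_one]) (fun h3 => hdiv h3 i j)
    rwa [div_pow, div_eq_one_iff_eq (pow_ne_zero _ (rootVal_ne_zero _))] at this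
  · funext j
    fin_cases j
    · exact hy 0
    · exact hy 1
    · exact hy 2
    · exact hv3.trans hw3.symm

/-- The exponent of the first form defining `W_N`. -/
def formExp (N : ℕ) : ℕ := if 3 ∣ N then N / 3 else N

lemma isWeberVector_of_eq_zero {N : ℕ} (hN : N ≠ 0) {v : Fin 4 → K} (hv : IsWeberVector r N v)
    (hv3 : v 3 = 0) : v 0 ^ formExp N + v 1 ^ formExp N + v 2 ^ formExp N = 0 ∧
      v 0 * v 1 * v 2 = 0 := by
  obtain ⟨h1, h2⟩ := hv
  refine ⟨?_, by rw [h2, hv3]; ring⟩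
  unfold formExp
  split_ifs at h1 ⊢
  · exact h1
  · rw [h1, hv3, zero_pow hN, mul_zero]

/-- Take `a = p/p'` and `ρ = pq'/(p'q)`. Equal images give `ρᵐ = 1`; the two sum equations give
`ρ^formExp (m * n) = 1`. Together they give `ρᵏ = 1`. -/
lemma exists_root_mul_eq {m n : ℕ} (hmn : m * n ∣ 24) {p q p' q' t : K}
    (h : p ^ formExp (m * n) + q ^ formExp (m * n) = 0)
    (h' : p' ^ formExp (m * n) + q' ^ formExp (m * n) = 0)
    (hp : t * p' ^ m = p ^ m) (hq : t * q' ^ m = q ^ m) (hpq : p ≠ 0 ∨ q ≠ 0) :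
    ∃ (ρ : rootsOfUnity m K) (a : K), ρ ^ coverExp m = 1 ∧ a * p' = p ∧ a * q' = rootVal ρ * q := by
  have hm : m ≠ 0 := by rintro rfl; simp at hmn
  have he : formExp (m * n) ≠ 0 := by
    unfold formExp
    have : m * n ≠ 0 := by rintro e; rw [e] at hmn; simp at hmn
    split_ifs <;> omega
  have hz {x y : K} (hxy : x ^ formExp (m * n) + y ^ formExp (m * n) = 0) : x = 0 ↔ y = 0 := by
    constructor
    · rintro rfl
      rw [zero_pow he, zero_add] at hxy
      exact eq_zero_of_pow_eq_zero hxy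
    · rintro rfl
      rw [zero_pow he, add_zero] at hxy
      exact eq_zero_of_pow_eq_zero hxy
  have hp0 : p ≠ 0 := by
    rcases hpq with hp0 | hq0
    · exact hp0
    · exact fun e => hq0 ((hz h).1 e)
  have hq0 : q ≠ 0 := fun e => hp0 ((hz h).2 e)
  have hp0' : p' ≠ 0 := by
    rintro rfl
    rw [zero_pow hm, mul_zero] at hp
    exact pow_ne_zero _ hp0 hp.symm
  have hρ : (p * q' / (p' * q)) ^ m = 1 := by
    have : p' ^ m ≠ 0 := pow_ne_zero _ hp0'
    have hq' : q ^ m ≠ 0 := pow_ne_zero _ hq0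
    rw [div_pow, mul_pow, mul_pow, div_eq_one_iff_eq (mul_ne_zero this hq')]
    rw [← hp, ← hq]; ring
  have hρe : (p * q' / (p' * q)) ^ formExp (m * n) = 1 := by
    rw [div_pow, mul_pow, mul_pow,
      div_eq_one_iff_eq (mul_ne_zero (pow_ne_zero _ hp0') (pow_ne_zero _ hq0))]
    linear_combination p ^ formExp (m * n) * h' - p' ^ formExp (m * n) * h
  have hρk := pow_coverExp_eq_one hmn hρ (fun h3 => by
    rwa [formExp, if_pos (h3.mul_right n), mul_div_three_eq h3] at hρe)
  obtain ⟨ρ, hρ'⟩ := exists_rootVal_eq hm hρ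
  refine ⟨ρ, p / p', ?_, div_mul_cancel₀ _ hp0', ?_⟩
  · apply rootVal_injective
    rw [rootVal_pow, hρ', hρk, rootVal_one]
  · rw [hρ']
    field_simp

lemma mem_coverGroup_of_pow_eq_one {m : ℕ} {h : Fin 3 → rootsOfUnity m K}
    (hprod : h 0 * h 1 * h 2 = 1) (hh : ∀ i, h i ^ coverExp m = 1) : h ∈ coverGroup m K :=
  ⟨hprod, fun i j => (hh i).trans (hh j).symm⟩

/-- On `X₃ = 0` the product relation kills another coordinate. The remaining two are matched by a
root of unity `ρ`, and the vanishing coordinate absorbs `ρ⁻¹` so that the triple has product `1`. No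
nonsingularity is needed here. -/
lemma exists_smul_eq_scaleVector_of_eq_zero {m n : ℕ} (hmn : m * n ∣ 24)
    {v w : Fin 4 → K} (hv0 : v ≠ 0) (hv : IsWeberVector r (m * n) v)
    (hw : IsWeberVector r (m * n) w) (hv3 : v 3 = 0) {t : K} (ht : t ≠ 0)
    (hvw : ∀ j, t * w j ^ m = v j ^ m) :
    ∃ h ∈ coverGroup m K, ∃ a : K, a • w = scaleVector h v := by
  have hm : m ≠ 0 := by rintro rfl; simp at hmn
  have hN : m * n ≠ 0 := by rintro e; rw [e] at hmn; simp at hmn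
  have he : formExp (m * n) ≠ 0 := by
    unfold formExp
    split_ifs <;> omega
  have hz : ∀ j, v j = 0 → w j = 0 := by
    intro j hj
    have := hvw j
    rw [hj, zero_pow hm] at this
    exact eq_zero_of_pow_eq_zero ((mul_eq_zero.1 this).resolve_left ht)
  have hw3 := hz 3 hv3
  obtain ⟨h1, h2⟩ := isWeberVector_of_eq_zero hN hv hv3
  obtain ⟨h1', -⟩ := isWeberVector_of_eq_zero hN hw hw3
  have hne : ¬ (v 0 = 0 ∧ v 1 = 0 ∧ v 2 = 0) := by
    rintro ⟨e0, e1, e2⟩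
    apply hv0
    funext j
    fin_cases j
    exacts [e0, e1, e2, hv3]
  have h012 : v 0 = 0 ∨ v 1 = 0 ∨ v 2 = 0 := by
    rcases mul_eq_zero.1 h2 with h2 | h2
    · rcases mul_eq_zero.1 h2 with h2 | h2
      · exact Or.inl h2
      · exact Or.inr (Or.inl h2)
    · exact Or.inr (Or.inr h2)
  rcases h012 with e | e | e
  · have e' := hz _ e
    rw [e, zero_pow he, zero_add] at h1
    rw [e', zero_pow he, zero_add] at h1'
    obtain ⟨ρ, a, hρ, ha, ha'⟩ := exists_root_mul_eq hmn h1 h1' (hvw 1) (hvw 2) (by tauto)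
    refine ⟨![ρ⁻¹, 1, ρ], mem_coverGroup_of_pow_eq_one (by simp) ?_, a, ?_⟩
    · intro i
      fin_cases i <;> simp [hρ]
    · funext j
      fin_cases j <;> simp [scaleVector, e, e', ha, ha', hw3, hv3]
  · have e' := hz _ e
    rw [e, zero_pow he, add_zero] at h1
    rw [e', zero_pow he, add_zero] at h1'
    obtain ⟨ρ, a, hρ, ha, ha'⟩ := exists_root_mul_eq hmn h1 h1' (hvw 0) (hvw 2) (by tauto)
    refine ⟨![1, ρ⁻¹, ρ], mem_coverGroup_of_pow_eq_one (by simp) ?_, a, ?_⟩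
    · intro i
      fin_cases i <;> simp [hρ]
    · funext j
      fin_cases j <;> simp [scaleVector, e, e', ha, ha', hw3, hv3]
  · have e' := hz _ e
    rw [e, zero_pow he, add_zero] at h1
    rw [e', zero_pow he, add_zero] at h1'
    obtain ⟨ρ, a, hρ, ha, ha'⟩ := exists_root_mul_eq hmn h1 h1' (hvw 0) (hvw 1) (by tauto)
    refine ⟨![1, ρ, ρ⁻¹], mem_coverGroup_of_pow_eq_one (by simp) ?_, a, ?_⟩
    · intro i
      fin_cases i <;> simp [hρ]
    · funext j
      fin_cases j <;> simp [scaleVector, e, e', ha, ha', hw3, hv3]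

lemma rootAct_mk_eq {m : ℕ} {h : Fin 3 → rootsOfUnity m K} {v w : Fin 4 → K} (hv : v ≠ 0)
    (hw : w ≠ 0) {a : K} (ha : a • w = scaleVector h v) :
    rootAct h (Projectivization.mk K v hv) = Projectivization.mk K w hw := by
  obtain ⟨hv', e⟩ := rootAct_mk h hv
  rw [e, Projectivization.mk_eq_mk_iff']
  exact ⟨a, ha⟩

lemma exists_mk_eq_of_ne_zero {v : Fin 4 → K} (hv : v ≠ 0) (h : v 3 ≠ 0) :
    ∃ (v' : Fin 4 → K) (hv' : v' ≠ 0), v' 3 = 1 ∧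
      Projectivization.mk K v hv = Projectivization.mk K v' hv' := by
  have h1 : ((v 3)⁻¹ • v) 3 = 1 := inv_mul_cancel₀ h
  refine ⟨(v 3)⁻¹ • v, fun e => ?_, h1, ?_⟩
  · rw [e] at h1
    exact zero_ne_one h1
  · rw [Projectivization.mk_eq_mk_iff']
    exact ⟨v 3, smul_inv_smul₀ h v⟩

theorem exists_rootAct_eq [CharZero K] (hr : r ^ 2 = 2) {m n : ℕ} (hmn : m * n ∣ 24)
    {P Q : ℙ K (Fin 4 → K)} (hP : P ∈ weberCurve r (m * n)) (hQ : Q ∈ weberCurve r (m * n))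
    (hPQ : powMap m P = powMap m Q) (hns : IsNonsingularAt r n (powMap m P)) :
    ∃ h ∈ coverGroup m K, rootAct h P = Q := by
  have hm : m ≠ 0 := by rintro rfl; simp at hmn
  have hn : n ≠ 0 := by rintro rfl; simp at hmn
  induction P using Projectivization.ind with
  | h v hv =>
  induction Q using Projectivization.ind with
  | h w hw =>
    have hPQ' := hPQ
    rw [powMap_mk, powMap_mk, Projectivization.mk_eq_mk_iff'] at hPQ'
    obtain ⟨t, ht⟩ := hPQ'
    have ht' (j) : t * w j ^ m = v j ^ m := congrFun ht j
    have ht0 : t ≠ 0 := by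
      rintro rfl
      rw [zero_smul] at ht
      exact pow_ne_zero_of_ne_zero hv m ht.symm
    by_cases hv3 : v 3 = 0
    · obtain ⟨h, hh, a, ha⟩ := exists_smul_eq_scaleVector_of_eq_zero hmn hv
        ((mk_mem_weberCurve hv).1 hP) ((mk_mem_weberCurve hw).1 hQ) hv3 ht0 ht'
      exact ⟨h, hh, rootAct_mk_eq hv hw ha⟩
    · have hw3 : w 3 ≠ 0 := by
        intro e
        have := ht' 3
        rw [e, zero_pow hm, mul_zero] at this
        exact pow_ne_zero m hv3 this.symm
      obtain ⟨v', hv', hv3', ev⟩ := exists_mk_eq_of_ne_zero hv hv3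
      obtain ⟨w', hw', hw3', ew⟩ := exists_mk_eq_of_ne_zero hw hw3
      rw [ev] at hP hPQ hns ⊢
      rw [ew] at hQ hPQ ⊢
      rw [powMap_mk] at hns
      have hV := (mk_mem_weberCurve hv').1 hP
      rw [powMap_mk, powMap_mk, Projectivization.mk_eq_mk_iff'] at hPQ
      obtain ⟨s, hs⟩ := hPQ
      have hs' (j) : s * w' j ^ m = v' j ^ m := congrFun hs j
      -- Normalizing both points to `X₃ = 1` turns equality of the projective images into equality
      -- of the `m`-th powers themselves.
      have hs1 : s = 1 := by
        have := hs' 3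
        rwa [hv3', hw3', one_pow, mul_one] at this
      obtain ⟨h, hh, e⟩ := exists_scaleVector_eq hr hmn hV ((mk_mem_weberCurve hw').1 hQ) hv3' hw3'
        (fun j => by rw [← hs' j, hs1, one_mul]) (fun h3 hsing =>
          not_isNonsingularAt hr hn (not_three_dvd_of_mul_dvd hmn h3) _
            (isWeberVector_pow hr hmn hV) (by simp [hv3']) hsing.1 hsing.2 hns)
      exact ⟨h, hh, rootAct_mk_eq hv' hw' (a := 1) (by rw [one_smul, e])⟩

end Fibres

lemma exists_quotient_weberGamma_mulEquiv {K : Type*} [Field K] [Algebra K ℂ] {ζ : K}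
    (hζ : IsPrimitiveRoot ζ 24) {m n : ℕ} (hmn : m * n ∣ 24) :
    ∃ (_ : ((weberGamma (m * n)).subgroupOf (weberGamma n)).Normal)
      (θ : (weberGamma n ⧸ (weberGamma (m * n)).subgroupOf (weberGamma n)) ≃* coverGroup m K),
      ∀ (γ : SL(2, ℤ))
        (hγ : (QuotientGroup.mk γ : Matrix.ProjectiveSpecialLinearGroup (Fin 2) ℤ) ∈ weberGamma n)
        (i : Fin 3) (τ : ℍ),
        weberU i (γ • τ) ^ (24 / (m * n)) =
          algebraMap K ℂ (rootVal ((θ (QuotientGroup.mk ⟨QuotientGroup.mk γ, hγ⟩)).1 i)) *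
            weberU i τ ^ (24 / (m * n)) := by
  obtain ⟨Φ, hsurj, hker, hΦ⟩ := exists_weberGamma_hom hζ hmn
  rw [← hker]
  exact ⟨inferInstance, QuotientGroup.quotientKerEquivOfSurjective Φ hsurj, hΦ⟩

end Weber

theorem mainTheorem7 {K : Type*} [Field K] [Algebra K ℂ]
    (r : K) (hr : r ^ 2 = 2) (hrpos : algebraMap K ℂ r = (Real.sqrt 2 : ℂ))
    (ζ : K) (hζ : IsPrimitiveRoot ζ 24)
    (m n : ℕ) (hmn : m * n ∣ 24) :
    -- the curves are integral, and the cover is dominant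
    ∃ (_ : IsDomain (Weber.WeberRing r n)) (_ : IsDomain (Weber.WeberRing r (m * n)))
      (hinj : Function.Injective (Weber.pullback hr hmn).toRingHom)
      (H : Subgroup (Fin 3 → rootsOfUnity m K)),
      -- the cover of projective curves, and `H` as a group of automorphisms of it
      Set.MapsTo (Weber.powMap m) (Weber.weberCurve r (m * n)) (Weber.weberCurve r n) ∧
      (IsAlgClosed K →
        Set.SurjOn (Weber.powMap m) (Weber.weberCurve r (m * n)) (Weber.weberCurve r n)) ∧
      (∀ h ∈ H, ∀ P ∈ Weber.weberCurve r (m * n),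
        Weber.rootAct h P ∈ Weber.weberCurve r (m * n) ∧
        Weber.powMap m (Weber.rootAct h P) = Weber.powMap m P) ∧
      -- the fibres over nonsingular points of `W_n` are `H`-orbits
      (∀ P ∈ Weber.weberCurve r (m * n), ∀ Q ∈ Weber.weberCurve r (m * n),
        Weber.powMap m P = Weber.powMap m Q → Weber.IsNonsingularAt r n (Weber.powMap m P) →
        ∃ h ∈ H, Weber.rootAct h P = Q) ∧
      -- the cover is Galois, its automorphism group is `H` acting by scaling the coordinates,
      -- and `K(W_n)` is the field of `H`-invariants in `K(W_{mn})`
      IsGalois (Weber.pullbackField hr hmn hinj) (Weber.WeberField r (m * n)) ∧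
      (∃ e : H ≃* (Weber.WeberField r (m * n) ≃ₐ[Weber.pullbackField hr hmn hinj]
            Weber.WeberField r (m * n)),
        (∀ (h : H) (i : Fin 3),
          e h (Weber.coordFun r (m * n) i) =
            ((h.1 i : Kˣ) : K) • Weber.coordFun r (m * n) i) ∧
        (∀ f : Weber.WeberField r (m * n),
          f ∈ Weber.pullbackField hr hmn hinj ↔ ∀ h : H, e h f = f)) ∧
      -- `H` is isomorphic to `Γ_n / Γ_{mn}`, through the action on the Weber functions
      Weber.weberGamma (m * n) ≤ Weber.weberGamma n ∧
      (∃ (_ : ((Weber.weberGamma (m * n)).subgroupOf (Weber.weberGamma n)).Normal)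
          (θ : (Weber.weberGamma n ⧸
            (Weber.weberGamma (m * n)).subgroupOf (Weber.weberGamma n)) ≃* H),
        ∀ (γ : Matrix.SpecialLinearGroup (Fin 2) ℤ)
          (hγ : (QuotientGroup.mk γ : Matrix.ProjectiveSpecialLinearGroup (Fin 2) ℤ) ∈
            Weber.weberGamma n) (i : Fin 3) (τ : UpperHalfPlane),
          Weber.weberU i (γ • τ) ^ (24 / (m * n)) =
            algebraMap K ℂ (((θ (QuotientGroup.mk ⟨QuotientGroup.mk γ, hγ⟩)).1 i : Kˣ) : K) *
              Weber.weberU i τ ^ (24 / (m * n))) ∧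
      -- identification of `H`, and the degree of the cover
      (m = 3 → H = Weber.diagonalGroup m K) ∧
      (m ∣ 8 → H = Weber.antidiagonalGroup m K) ∧
      (m = 3 →
        Module.finrank (Weber.pullbackField hr hmn hinj) (Weber.WeberField r (m * n)) = 3) ∧
      (m ∣ 8 →
        Module.finrank (Weber.pullbackField hr hmn hinj) (Weber.WeberField r (m * n)) = m ^ 2) := by

  have : CharZero K := (algebraMap K ℂ).charZero
  have := Weber.weberRing_isDomain_of_dvd hr hζ ((Dvd.intro_left m rfl).trans hmn)
  have := Weber.weberRing_isDomain_of_dvd hr hζ hmn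
  have hinj := Weber.pullback_injective hr hζ hmn
  obtain ⟨hgal, he, hdeg⟩ := Weber.isGalois_and_exists_mulEquiv hr hmn hinj hζ
  refine ⟨inferInstance, inferInstance, hinj, Weber.coverGroup m K, Weber.mapsTo_powMap hr hmn,
    fun _ => Weber.surjOn_powMap hr hζ hmn,
    fun _ hh _ hP => Weber.rootAct_mem_and_powMap_rootAct hh hP,
    fun _ hP _ hQ => Weber.exists_rootAct_eq hr hmn hP hQ, hgal, he, Weber.weberGamma_le hmn,
    Weber.exists_quotient_weberGamma_mulEquiv hζ hmn, ?_, Weber.coverGroup_of_dvd_eight,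
    fun h3 => ?_, fun h8 => ?_⟩
  · rintro rfl
    exact Weber.coverGroup_three
  · subst h3
    exact hdeg
  · have h3 : ¬ 3 ∣ m := fun h => by
      have := h.trans h8
      revert this
      decide
    rw [hdeg, Weber.coverExp_of_not_dvd h3, sq]
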